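/- An instance of \textsc{Capacitated $k$-Median} (CKM) consists of a finite set $F$ of facilities, each $f\in F$ with a capacity $u_f\in\mathbb{Z}_{\ge 0}$, a finite set $C$ of clients, a metric $d$ on $F\cup C$ (distinct points may be at distance $0$), and a number $k\in\mathbb{Z}_{\ge 0}$. A feasible solution is a set $F'\subseteq F$ of at most $k$ open facilities together with an assignment $\phi:C\to F'$ with $|\phi^{-1}(f)|\le u_f$ for all $f\in F'$; its cost is $\sum_{c\in C}d(c,\phi(c))$, which is to be minimized. In \textsc{Uniform CKM} all capacities equal one number $u$. An instance is \emph{$\ell$-centered} if $d$ is the shortest-path metric, restricted to $F\cup C$, of a graph on $F\cup C\cup S$ with nonnegative real edge weights such that $|S|\le\ell$, the set $S$ is a clique, and every $v\in F\cup C$ is incident to exactly one edge, which joins $v$ to some $s^v\in S$. \textbf{Lemma.} \textsc{Uniform CKM} can be solved exactly in time $\ell^{k}\cdot n^{O(1)}$ on $\ell$-centered instances, where $n=|F|+|C|+|S|$. Precisely, there are an algorithm and a constant $A$ such that, for every $\ell\ge 1$ and every $\ell$-centered instance of \textsc{Uniform CKM}, given by its weighted graph on $F\cup C\cup S$ together with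 $u$ and $k$, the algorithm halts within $A\cdot\ell^{k}\cdot(n+1)^{A}$ elementary steps and returns a feasible solution of minimum cost, or reports that there is no feasible solution. Here an algorithm is a program of a random access machine whose integer cells hold words of value at most $(n+u+k+2)^{A}$, with unit-cost word arithmetic, comparison and indirect addressing, and whose real cells hold real numbers, which can only be moved, added, subtracted and compared, at unit cost. -/

import Mathlib

open scoped NNReal

/-! ## Capacitated k-median -/

/-- An instance of Capacitated k-Median: `numF` facilities with capacities, `numC` clients,
a (pseudo)metric on facilities and clients (distinct points may be at distance `0`), and the
upper bound `k` on the number of open facilities. -/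
structure CKM where
  numF : ℕ
  numC : ℕ
  cap : Fin numF → ℕ
  dist : Fin numF ⊕ Fin numC → Fin numF ⊕ Fin numC → ℝ
  dist_self : ∀ x, dist x x = 0
  dist_comm : ∀ x y, dist x y = dist y x
  dist_triangle : ∀ x y z, dist x z ≤ dist x y + dist y z
  k : ℕ

namespace CKM

/-- The points of an instance: facilities and clients. -/
abbrev Point (I : CKM) : Type := Fin I.numF ⊕ Fin I.numC

/-- A candidate solution: a set of opened facilities and an assignment of the clients. -/
structure Sol (I : CKM) where
  opened : Finset (Fin I.numF)
  assign : Fin I.numC → Fin I.numF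

/-- At most `k` facilities are open, clients are assigned to open facilities, and capacities
are respected. -/
def IsFeasible (I : CKM) (s : I.Sol) : Prop :=
  s.opened.card ≤ I.k ∧
  (∀ c, s.assign c ∈ s.opened) ∧
  ∀ f ∈ s.opened, (Finset.univ.filter fun c => s.assign c = f).card ≤ I.cap f

/-- The connection cost. -/
def cost (I : CKM) (s : I.Sol) : ℝ :=
  ∑ c, I.dist (Sum.inr c) (Sum.inl (s.assign c))

/-- A feasible solution of minimum cost. -/
def IsOptimal (I : CKM) (s : I.Sol) : Prop :=
  I.IsFeasible s ∧ ∀ s', I.IsFeasible s' → I.cost s ≤ I.cost s'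

/-- All facilities have the same capacity `u`. -/
def IsUniform (I : CKM) (u : ℕ) : Prop := ∀ f, I.cap f = u

end CKM

/-! ## Weighted graphs and centered instances -/

/-- A graph with nonnegative real edge weights (`weight` is only meaningful on edges). -/
structure WGraph (V : Type) where
  graph : SimpleGraph V
  weight : Sym2 V → ℝ≥0

/-- The shortest-path distance: the infimum of the total weights of the walks from `x` to `y`.
It is only used between vertices that are joined by a walk. -/
noncomputable def WGraph.dist {V : Type} (G : WGraph V) (x y : V) : ℝ≥0 :=
  ⨅ p : G.graph.Walk x y, (p.edges.map G.weight).sum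

/-- `G`, on the points of `I` together with `m` centers, makes `I` an `ℓ`-centered instance:
there are at most `ℓ` centers, the centers form a clique, every facility and every client is
incident to exactly one edge, which leads to a center, and `G` induces the metric of `I`. -/
def CKM.IsCenteredBy (I : CKM) (ℓ : ℕ) {m : ℕ} (G : WGraph (I.Point ⊕ Fin m)) : Prop :=
  m ≤ ℓ ∧
  (∀ s s' : Fin m, s ≠ s' → G.graph.Adj (Sum.inr s) (Sum.inr s')) ∧
  (∀ v : I.Point, ∃ s : Fin m, ∀ x, G.graph.Adj (Sum.inl v) x ↔ x = Sum.inr s) ∧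
  ∀ x y : I.Point, I.dist x y = (G.dist (Sum.inl x) (Sum.inl y) : ℝ)

/-! ## The machine model

A random access machine with two kinds of memory cells. Word cells hold natural numbers up to a
bound `W` (the largest machine word) and support word arithmetic and indirect addressing. Real
cells hold real numbers, which can only be moved, added, subtracted and compared. Every
elementary operation takes one time unit. A program is finite, so it uses finitely many
variables and (one-dimensional) arrays. -/

namespace RAM

/-- Memory contents: word variables and arrays, real variables and arrays. -/
structure State where
  nvar : ℕ → ℕ
  narr : ℕ → ℕ → ℕ
  rvar : ℕ → ℝ
  rarr : ℕ → ℕ → ℝ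

/-- Word expressions. -/
inductive NExp where
  | const (n : ℕ)
  | var (x : ℕ)
  | get (a : ℕ) (i : NExp)
  | add (e₁ e₂ : NExp)
  | sub (e₁ e₂ : NExp)
  | mul (e₁ e₂ : NExp)
  | div (e₁ e₂ : NExp)
  | mod (e₁ e₂ : NExp)

/-- The value of a word expression. -/
def NExp.eval (σ : State) : NExp → ℕ
  | .const n => n
  | .var x => σ.nvar x
  | .get a i => σ.narr a (i.eval σ)
  | .add e₁ e₂ => e₁.eval σ + e₂.eval σ
  | .sub e₁ e₂ => e₁.eval σ - e₂.eval σ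
  | .mul e₁ e₂ => e₁.eval σ * e₂.eval σ
  | .div e₁ e₂ => e₁.eval σ / e₂.eval σ
  | .mod e₁ e₂ => e₁.eval σ % e₂.eval σ

/-- All values computed during the evaluation are machine words, that is, at most `W`. -/
def NExp.Fits (W : ℕ) (σ : State) : NExp → Prop
  | .const n => n ≤ W
  | .var x => σ.nvar x ≤ W
  | .get a i => i.Fits W σ ∧ σ.narr a (i.eval σ) ≤ W
  | .add e₁ e₂ => e₁.Fits W σ ∧ e₂.Fits W σ ∧ e₁.eval σ + e₂.eval σ ≤ W
  | .sub e₁ e₂ => e₁.Fits W σ ∧ e₂.Fits W σ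
  | .mul e₁ e₂ => e₁.Fits W σ ∧ e₂.Fits W σ ∧ e₁.eval σ * e₂.eval σ ≤ W
  | .div e₁ e₂ => e₁.Fits W σ ∧ e₂.Fits W σ
  | .mod e₁ e₂ => e₁.Fits W σ ∧ e₂.Fits W σ

/-- The evaluation time: the number of nodes of the expression. -/
def NExp.time : NExp → ℕ
  | .const _ => 1
  | .var _ => 1
  | .get _ i => i.time + 1
  | .add e₁ e₂ => e₁.time + e₂.time + 1
  | .sub e₁ e₂ => e₁.time + e₂.time + 1
  | .mul e₁ e₂ => e₁.time + e₂.time + 1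
  | .div e₁ e₂ => e₁.time + e₂.time + 1
  | .mod e₁ e₂ => e₁.time + e₂.time + 1

/-- Real expressions. The only real constant is `0`. -/
inductive RExp where
  | zero
  | var (x : ℕ)
  | get (a : ℕ) (i : NExp)
  | add (e₁ e₂ : RExp)
  | sub (e₁ e₂ : RExp)

/-- The value of a real expression. -/
noncomputable def RExp.eval (σ : State) : RExp → ℝ
  | .zero => 0
  | .var x => σ.rvar x
  | .get a i => σ.rarr a (i.eval σ)
  | .add e₁ e₂ => e₁.eval σ + e₂.eval σ
  | .sub e₁ e₂ => e₁.eval σ - e₂.eval σ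

/-- All addresses computed during the evaluation are machine words. -/
def RExp.Fits (W : ℕ) (σ : State) : RExp → Prop
  | .zero => True
  | .var _ => True
  | .get _ i => i.Fits W σ
  | .add e₁ e₂ => e₁.Fits W σ ∧ e₂.Fits W σ
  | .sub e₁ e₂ => e₁.Fits W σ ∧ e₂.Fits W σ

/-- The evaluation time. -/
def RExp.time : RExp → ℕ
  | .zero => 1
  | .var _ => 1
  | .get _ i => i.time + 1
  | .add e₁ e₂ => e₁.time + e₂.time + 1
  | .sub e₁ e₂ => e₁.time + e₂.time + 1

/-- Tests: comparisons of words and of reals, and their Boolean combinations. -/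
inductive Test where
  | nle (e₁ e₂ : NExp)
  | rle (e₁ e₂ : RExp)
  | not (b : Test)
  | and (b₁ b₂ : Test)

/-- The test succeeds. -/
def Test.Holds (σ : State) : Test → Prop
  | .nle e₁ e₂ => e₁.eval σ ≤ e₂.eval σ
  | .rle e₁ e₂ => e₁.eval σ ≤ e₂.eval σ
  | .not b => ¬ b.Holds σ
  | .and b₁ b₂ => b₁.Holds σ ∧ b₂.Holds σ

/-- All words computed during the evaluation are at most `W`. -/
def Test.Fits (W : ℕ) (σ : State) : Test → Prop
  | .nle e₁ e₂ => e₁.Fits W σ ∧ e₂.Fits W σ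
  | .rle e₁ e₂ => e₁.Fits W σ ∧ e₂.Fits W σ
  | .not b => b.Fits W σ
  | .and b₁ b₂ => b₁.Fits W σ ∧ b₂.Fits W σ

/-- The evaluation time. -/
def Test.time : Test → ℕ
  | .nle e₁ e₂ => e₁.time + e₂.time + 1
  | .rle e₁ e₂ => e₁.time + e₂.time + 1
  | .not b => b.time + 1
  | .and b₁ b₂ => b₁.time + b₂.time + 1

/-- Programs: assignments to variables and to array cells, sequencing, branching, loops. -/
inductive Prog where
  | nop
  | setN (x : ℕ) (e : NExp)
  | setR (x : ℕ) (e : RExp)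
  | putN (a : ℕ) (i : NExp) (e : NExp)
  | putR (a : ℕ) (i : NExp) (e : RExp)
  | seq (p q : Prog)
  | ite (b : Test) (p q : Prog)
  | loop (b : Test) (p : Prog)

/-- `Exec W p σ t τ`: started in `σ`, the program `p` halts in the state `τ` after `t` time
units, and all words computed during the run are at most `W`. -/
inductive Exec (W : ℕ) : Prog → State → ℕ → State → Prop
  | nop (σ) : Exec W .nop σ 1 σ
  | setN (σ) (x : ℕ) (e : NExp) (h : e.Fits W σ) :
      Exec W (.setN x e) σ (e.time + 1)
        { σ with nvar := Function.update σ.nvar x (e.eval σ) }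
  | setR (σ) (x : ℕ) (e : RExp) (h : e.Fits W σ) :
      Exec W (.setR x e) σ (e.time + 1)
        { σ with rvar := Function.update σ.rvar x (e.eval σ) }
  | putN (σ) (a : ℕ) (i : NExp) (e : NExp) (hi : i.Fits W σ) (h : e.Fits W σ) :
      Exec W (.putN a i e) σ (i.time + e.time + 1)
        { σ with narr :=
            Function.update σ.narr a (Function.update (σ.narr a) (i.eval σ) (e.eval σ)) }
  | putR (σ) (a : ℕ) (i : NExp) (e : RExp) (hi : i.Fits W σ) (h : e.Fits W σ) :
      Exec W (.putR a i e) σ (i.time + e.time + 1)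
        { σ with rarr :=
            Function.update σ.rarr a (Function.update (σ.rarr a) (i.eval σ) (e.eval σ)) }
  | seq {p q : Prog} {σ ρ τ : State} {t₁ t₂ : ℕ} (h₁ : Exec W p σ t₁ ρ)
      (h₂ : Exec W q ρ t₂ τ) : Exec W (.seq p q) σ (t₁ + t₂) τ
  | ite_true {b : Test} {p q : Prog} {σ τ : State} {t : ℕ} (hf : b.Fits W σ)
      (hb : b.Holds σ) (h : Exec W p σ t τ) : Exec W (.ite b p q) σ (b.time + 1 + t) τ
  | ite_false {b : Test} {p q : Prog} {σ τ : State} {t : ℕ} (hf : b.Fits W σ)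
      (hb : ¬ b.Holds σ) (h : Exec W q σ t τ) : Exec W (.ite b p q) σ (b.time + 1 + t) τ
  | loop_true {b : Test} {p : Prog} {σ ρ τ : State} {t₁ t₂ : ℕ} (hf : b.Fits W σ)
      (hb : b.Holds σ) (h₁ : Exec W p σ t₁ ρ) (h₂ : Exec W (.loop b p) ρ t₂ τ) :
      Exec W (.loop b p) σ (b.time + 1 + t₁ + t₂) τ
  | loop_false {b : Test} {p : Prog} {σ : State} (hf : b.Fits W σ) (hb : ¬ b.Holds σ) :
      Exec W (.loop b p) σ (b.time + 1) σ

end RAM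

/-! ## Input and output -/

namespace CKM

variable {m : ℕ}

/-- The number of vertices of the graph: facilities, clients and centers. -/
def size (I : CKM) (m : ℕ) : ℕ := I.numF + I.numC + m

/-- The numbering of the vertices: facilities first, then clients, then centers. -/
def code (I : CKM) : I.Point ⊕ Fin m → ℕ
  | .inl (.inl f) => f
  | .inl (.inr c) => I.numF + c
  | .inr s => I.numF + I.numC + s

/-- A square matrix indexed by the vertices, stored row by row in an array that is `0`
elsewhere. -/
def flatten (I : CKM) {R : Type} [AddCommMonoid R]
    (M : I.Point ⊕ Fin m → I.Point ⊕ Fin m → R) (j : ℕ) : R :=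
  ∑ x, ∑ y, if I.code x * I.size m + I.code y = j then M x y else 0

open Classical in
/-- The initial state. The word variables 0 to 4 hold the numbers of facilities, of clients and
of centers, the capacity `u`, and `k`; word array 0 holds the adjacency matrix of the graph and
real array 0 the matrix of its edge weights. Everything else is `0`. -/
noncomputable def input (I : CKM) (u : ℕ) (G : WGraph (I.Point ⊕ Fin m)) : RAM.State where
  nvar x := if x = 0 then I.numF else if x = 1 then I.numC else if x = 2 then m
    else if x = 3 then u else if x = 4 then I.k else 0
  narr a := if a = 0 then I.flatten (fun x y => if G.graph.Adj x y then 1 else 0) else 0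
  rvar := 0
  rarr a := if a = 0 then
    I.flatten (fun x y => if G.graph.Adj x y then (G.weight s(x, y) : ℝ) else 0) else 0

/-- The final state `τ` holds a correct answer: if there is a feasible solution, word variable 0
is `1`, and word arrays 1 and 2 hold the indicator vector of the open facilities and the
assignment of the clients of an optimal solution; otherwise word variable 0 is `0`. -/
def Solved (I : CKM) (τ : RAM.State) : Prop :=
  ((∃ s, I.IsFeasible s) → τ.nvar 0 = 1 ∧ ∃ s, I.IsOptimal s ∧
    (∀ f : Fin I.numF, τ.narr 1 f = if f ∈ s.opened then 1 else 0) ∧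
    ∀ c : Fin I.numC, τ.narr 2 c = s.assign c) ∧
  ((¬ ∃ s, I.IsFeasible s) → τ.nvar 0 = 0)

end CKM

/-! ## A program logic -/

/-! In a centered graph a client c and a facility f have distance w(c) + D(cen c, cen f) + w(f),
where w is the weight of the pendant edge and D is the shortest-path metric on the centers
(`WGraph.dist_point`). So connecting c to f costs h(c, cen f) + w(f): facilities at one center
differ only in the additive term w(f).

Since all capacities agree, an open facility may hand all its clients to a closed facility of no
larger weight at the same center; this respects capacities and does not raise the cost
(`Serves.swap`). Hence only the number of open facilities at each center has to be guessed, the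
lightest ones being opened there. A guess is a tuple of K = min(k, |F|) centers; `greedy` opens, for
each entry, the lightest unopened facility at that center, and `exists_greedy_le` is the exchange
argument showing that some tuple is at least as good as any given solution. There are at most ℓ^k
tuples.

For a fixed tuple the best assignment is a transportation problem, solved by successive shortest
paths with prices. An assignment in which every client sits at a cheapest facility with respect to
cost plus price, and in which facilities with spare capacity have price 0, is optimal by linear
programming duality (`Equilibrium.cost_le`). A new client is inserted by a Dijkstra search over the
facilities, which ends at a nearest facility with spare capacity; raising the prices makes the
search path tight (`Search.augment`), and shifting clients along it restores the equilibrium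
(`Augment.step`, `Augment.finish`). The number of steps does not depend on the real weights, as only
additions, subtractions and comparisons of reals occur.

The machine side is a small total-correctness logic. `Tri` bounds the running time by size · (B +
1)^depth when every loop makes at most B rounds, and bounds every computed word by a power of a
bound N on the words stored. With B the number of vertices this covers everything except the loop
over the tuples, which is counted separately by `exec_loop` and contributes the factor ℓ^k. -/

namespace RAM

attribute [simp] NExp.eval RExp.eval Test.Holds

namespace State

/-- Assignment to a word variable. -/
def setN (σ : State) (x v : ℕ) : State := { σ with nvar := Function.update σ.nvar x v }

/-- Assignment to a real variable. -/
def setR (σ : State) (x : ℕ) (v : ℝ) : State := { σ with rvar := Function.update σ.rvar x v }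

/-- Assignment to a cell of a word array. -/
def putN (σ : State) (a i v : ℕ) : State :=
  { σ with narr := Function.update σ.narr a (Function.update (σ.narr a) i v) }

/-- Assignment to a cell of a real array. -/
def putR (σ : State) (a i : ℕ) (v : ℝ) : State :=
  { σ with rarr := Function.update σ.rarr a (Function.update (σ.rarr a) i v) }

section
variable (σ : State) (x a i v : ℕ) (r : ℝ)

@[simp] theorem setN_nvar : (σ.setN x v).nvar = Function.update σ.nvar x v := rfl
@[simp] theorem setN_narr : (σ.setN x v).narr = σ.narr := rfl
@[simp] theorem setN_rvar : (σ.setN x v).rvar = σ.rvar := rfl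
@[simp] theorem setN_rarr : (σ.setN x v).rarr = σ.rarr := rfl
@[simp] theorem setR_nvar : (σ.setR x r).nvar = σ.nvar := rfl
@[simp] theorem setR_narr : (σ.setR x r).narr = σ.narr := rfl
@[simp] theorem setR_rvar : (σ.setR x r).rvar = Function.update σ.rvar x r := rfl
@[simp] theorem setR_rarr : (σ.setR x r).rarr = σ.rarr := rfl
@[simp] theorem putN_nvar : (σ.putN a i v).nvar = σ.nvar := rfl
@[simp] theorem putN_narr : (σ.putN a i v).narr =
    Function.update σ.narr a (Function.update (σ.narr a) i v) := rfl
@[simp] theorem putN_rvar : (σ.putN a i v).rvar = σ.rvar := rfl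
@[simp] theorem putN_rarr : (σ.putN a i v).rarr = σ.rarr := rfl
@[simp] theorem putR_nvar : (σ.putR a i r).nvar = σ.nvar := rfl
@[simp] theorem putR_narr : (σ.putR a i r).narr = σ.narr := rfl
@[simp] theorem putR_rvar : (σ.putR a i r).rvar = σ.rvar := rfl
@[simp] theorem putR_rarr : (σ.putR a i r).rarr =
    Function.update σ.rarr a (Function.update (σ.rarr a) i r) := rfl

end

/-- All words in memory are at most `N`. -/
structure Bdd (N : ℕ) (σ : State) : Prop where
  two_le : 2 ≤ N
  nvar : ∀ x, σ.nvar x ≤ N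
  narr : ∀ a i, σ.narr a i ≤ N

variable {N : ℕ} {σ : State}

theorem Bdd.setN (h : σ.Bdd N) (x : ℕ) {v : ℕ} (hv : v ≤ N) : (σ.setN x v).Bdd N where
  two_le := h.two_le
  nvar z := by
    by_cases hz : z = x
    · subst hz; simpa using hv
    · simpa [hz] using h.nvar z
  narr := h.narr

theorem Bdd.putN (h : σ.Bdd N) (a i : ℕ) {v : ℕ} (hv : v ≤ N) : (σ.putN a i v).Bdd N where
  two_le := h.two_le
  nvar := h.nvar
  narr b j := by
    by_cases hb : b = a
    · subst hb
      by_cases hj : j = i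
      · subst hj; simpa using hv
      · simpa [hj] using h.narr b j
    · simpa [hb] using h.narr b j

end State

/-! ### Weights of expressions: exponents that bound all computed words -/

/-- An exponent bounding the words computed from words that are at most `N` by a power of `N`. -/
def NExp.weight : NExp → ℕ
  | .const n => n
  | .var _ => 1
  | .get _ i => i.weight + 1
  | .add e₁ e₂ => e₁.weight + e₂.weight + 1
  | .sub e₁ e₂ => e₁.weight + e₂.weight
  | .mul e₁ e₂ => e₁.weight + e₂.weight
  | .div e₁ e₂ => e₁.weight + e₂.weight
  | .mod e₁ e₂ => e₁.weight + e₂.weight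

/-- See `NExp.weight`. -/
def RExp.weight : RExp → ℕ
  | .zero => 0
  | .var _ => 0
  | .get _ i => i.weight
  | .add e₁ e₂ => e₁.weight + e₂.weight
  | .sub e₁ e₂ => e₁.weight + e₂.weight

/-- See `NExp.weight`. -/
def Test.weight : Test → ℕ
  | .nle e₁ e₂ => e₁.weight + e₂.weight
  | .rle e₁ e₂ => e₁.weight + e₂.weight
  | .not b => b.weight
  | .and b₁ b₂ => b₁.weight + b₂.weight

/-- See `NExp.weight`. -/
def Prog.weight : Prog → ℕ
  | .nop => 0
  | .setN _ e => e.weight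
  | .setR _ e => e.weight
  | .putN _ i e => i.weight + e.weight
  | .putR _ i e => i.weight + e.weight
  | .seq p q => p.weight + q.weight
  | .ite b p q => b.weight + p.weight + q.weight
  | .loop b p => b.weight + p.weight

section Fits
variable {N : ℕ} {σ : State}

theorem pow_le_of_add_le {N a b W : ℕ} (hN : 2 ≤ N) (hab : a ≤ b) (h : N ^ b ≤ W) : N ^ a ≤ W :=
  (Nat.pow_le_pow_right (by omega) hab).trans h

/-- A constant n satisfies n < 2^n ≤ N^n, which is why `weight` charges it its own value. A sum of
two powers of N is absorbed by one further factor N ≥ 2, and a read from memory is at most N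
whatever the address. -/
theorem NExp.eval_le (h : σ.Bdd N) (e : NExp) : e.eval σ ≤ N ^ e.weight := by
  have hN := h.two_le
  have mono : ∀ a b : ℕ, N ^ a ≤ N ^ (a + b) := fun a b =>
    Nat.pow_le_pow_right (by omega) (Nat.le_add_right a b)
  induction e with
  | const n => exact (Nat.lt_two_pow_self.le).trans (Nat.pow_le_pow_left hN n)
  | var x => simpa [weight] using h.nvar x
  | get a i _ =>
    refine (h.narr a _).trans ?_
    simpa [weight] using Nat.pow_le_pow_right (n := N) (by omega) (Nat.le_add_left 1 i.weight)
  | add e₁ e₂ h₁ h₂ =>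
    have h3 := h₁.trans (mono e₁.weight e₂.weight)
    have h4 := h₂.trans (mono e₂.weight e₁.weight)
    rw [add_comm e₂.weight] at h4
    simp only [eval, weight, pow_succ]
    nlinarith
  | sub e₁ e₂ h₁ h₂ => exact (Nat.sub_le _ _).trans (h₁.trans (mono _ _))
  | mul e₁ e₂ h₁ h₂ => simpa [weight, pow_add] using Nat.mul_le_mul h₁ h₂
  | div e₁ e₂ h₁ h₂ => exact (Nat.div_le_self _ _).trans (h₁.trans (mono _ _))
  | mod e₁ e₂ h₁ h₂ => exact (Nat.mod_le _ _).trans (h₁.trans (mono _ _))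

/-- Weights only grow from subexpressions to expressions, so the bound for the whole expression
serves for all intermediate values. -/
theorem NExp.fits (h : σ.Bdd N) {W : ℕ} (e : NExp) (hW : N ^ e.weight ≤ W) : e.Fits W σ := by
  have hN := h.two_le
  have heval := (e.eval_le h).trans hW
  induction e with
  | const n => exact heval
  | var x => exact heval
  | get a i ih =>
    have h1 : N ^ i.weight ≤ W := pow_le_of_add_le hN (by simp [weight]) hW
    exact ⟨ih h1 ((i.eval_le h).trans h1), heval⟩
  | add e₁ e₂ h₁ h₂ | mul e₁ e₂ h₁ h₂ =>
    have k₁ : N ^ e₁.weight ≤ W := pow_le_of_add_le hN (by simp [weight]; try omega) hW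
    have k₂ : N ^ e₂.weight ≤ W := pow_le_of_add_le hN (by simp [weight]; try omega) hW
    exact ⟨h₁ k₁ ((e₁.eval_le h).trans k₁), h₂ k₂ ((e₂.eval_le h).trans k₂), heval⟩
  | sub e₁ e₂ h₁ h₂ | div e₁ e₂ h₁ h₂ | mod e₁ e₂ h₁ h₂ =>
    have k₁ : N ^ e₁.weight ≤ W := pow_le_of_add_le hN (by simp [weight]) hW
    have k₂ : N ^ e₂.weight ≤ W := pow_le_of_add_le hN (by simp [weight]) hW
    exact ⟨h₁ k₁ ((e₁.eval_le h).trans k₁), h₂ k₂ ((e₂.eval_le h).trans k₂)⟩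

theorem RExp.fits (h : σ.Bdd N) {W : ℕ} (e : RExp) (hW : N ^ e.weight ≤ W) : e.Fits W σ := by
  have hN := h.two_le
  induction e with
  | zero => trivial
  | var x => trivial
  | get a i => exact i.fits h hW
  | add e₁ e₂ h₁ h₂ | sub e₁ e₂ h₁ h₂ =>
    exact ⟨h₁ (pow_le_of_add_le hN (by simp [weight]) hW),
      h₂ (pow_le_of_add_le hN (by simp [weight]) hW)⟩

theorem Test.fits (h : σ.Bdd N) {W : ℕ} (b : Test) (hW : N ^ b.weight ≤ W) : b.Fits W σ := by
  have hN := h.two_le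
  induction b with
  | nle e₁ e₂ =>
    exact ⟨e₁.fits h (pow_le_of_add_le hN (by simp [weight]) hW),
      e₂.fits h (pow_le_of_add_le hN (by simp [weight]) hW)⟩
  | rle e₁ e₂ =>
    exact ⟨e₁.fits h (pow_le_of_add_le hN (by simp [weight]) hW),
      e₂.fits h (pow_le_of_add_le hN (by simp [weight]) hW)⟩
  | not b ih => exact ih hW
  | and b₁ b₂ h₁ h₂ =>
    exact ⟨h₁ (pow_le_of_add_le hN (by simp [weight]) hW),
      h₂ (pow_le_of_add_le hN (by simp [weight]) hW)⟩

end Fits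

/-! ### Frames: the cells that a program does not write -/

/-- The program assigns to the word variable `x`. -/
def Prog.writesN (x : ℕ) : Prog → Bool
  | .setN y _ => x == y
  | .seq p q => p.writesN x || q.writesN x
  | .ite _ p q => p.writesN x || q.writesN x
  | .loop _ p => p.writesN x
  | _ => false

/-- The program assigns to the real variable `x`. -/
def Prog.writesR (x : ℕ) : Prog → Bool
  | .setR y _ => x == y
  | .seq p q => p.writesR x || q.writesR x
  | .ite _ p q => p.writesR x || q.writesR x
  | .loop _ p => p.writesR x
  | _ => false

/-- The program assigns to cells of the word array `a`. -/
def Prog.writesNArr (a : ℕ) : Prog → Bool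
  | .putN b _ _ => a == b
  | .seq p q => p.writesNArr a || q.writesNArr a
  | .ite _ p q => p.writesNArr a || q.writesNArr a
  | .loop _ p => p.writesNArr a
  | _ => false

/-- The program assigns to cells of the real array `a`. -/
def Prog.writesRArr (a : ℕ) : Prog → Bool
  | .putR b _ _ => a == b
  | .seq p q => p.writesRArr a || q.writesRArr a
  | .ite _ p q => p.writesRArr a || q.writesRArr a
  | .loop _ p => p.writesRArr a
  | _ => false

/-- The states agree on everything that `p` does not write. -/
structure Same (p : Prog) (σ τ : State) : Prop where
  nvar : ∀ x, p.writesN x = false → τ.nvar x = σ.nvar x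
  rvar : ∀ x, p.writesR x = false → τ.rvar x = σ.rvar x
  narr : ∀ a, p.writesNArr a = false → τ.narr a = σ.narr a
  rarr : ∀ a, p.writesRArr a = false → τ.rarr a = σ.rarr a

theorem Same.refl (p : Prog) (σ : State) : Same p σ σ :=
  ⟨fun _ _ => rfl, fun _ _ => rfl, fun _ _ => rfl, fun _ _ => rfl⟩

theorem Same.trans {p : Prog} {σ ρ τ : State} (h₁ : Same p σ ρ) (h₂ : Same p ρ τ) :
    Same p σ τ :=
  ⟨fun x hx => (h₂.nvar x hx).trans (h₁.nvar x hx), fun x hx => (h₂.rvar x hx).trans (h₁.rvar x hx),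
    fun x hx => (h₂.narr x hx).trans (h₁.narr x hx),
    fun x hx => (h₂.rarr x hx).trans (h₁.rarr x hx)⟩

theorem Same.seq_left {p : Prog} {σ τ : State} (h : Same p σ τ) (q : Prog) :
    Same (.seq p q) σ τ := by
  constructor <;> intro x hx
  · exact h.nvar x (by simp [Prog.writesN] at hx; exact hx.1)
  · exact h.rvar x (by simp [Prog.writesR] at hx; exact hx.1)
  · exact h.narr x (by simp [Prog.writesNArr] at hx; exact hx.1)
  · exact h.rarr x (by simp [Prog.writesRArr] at hx; exact hx.1)

theorem Same.seq_right {q : Prog} {σ τ : State} (h : Same q σ τ) (p : Prog) :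
    Same (.seq p q) σ τ := by
  constructor <;> intro x hx
  · exact h.nvar x (by simp [Prog.writesN] at hx; exact hx.2)
  · exact h.rvar x (by simp [Prog.writesR] at hx; exact hx.2)
  · exact h.narr x (by simp [Prog.writesNArr] at hx; exact hx.2)
  · exact h.rarr x (by simp [Prog.writesRArr] at hx; exact hx.2)

theorem Same.loop {p : Prog} {σ τ : State} (h : Same p σ τ) (b : Test) :
    Same (.loop b p) σ τ :=
  ⟨h.nvar, h.rvar, h.narr, h.rarr⟩

/-- The frame rule. As the `writes` functions are computable Booleans, its side conditions for a
concrete program hold by `rfl`. -/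
theorem Exec.same {W t : ℕ} {p : Prog} {σ τ : State} (h : Exec W p σ t τ) : Same p σ τ := by
  induction h with
  | nop | loop_false => exact Same.refl _ _
  | setN σ x e h =>
    refine ⟨fun z hz => ?_, fun _ _ => rfl, fun _ _ => rfl, fun _ _ => rfl⟩
    simp [Prog.writesN] at hz
    simp [hz]
  | setR σ x e h =>
    refine ⟨fun _ _ => rfl, fun z hz => ?_, fun _ _ => rfl, fun _ _ => rfl⟩
    simp [Prog.writesR] at hz
    simp [hz]
  | putN σ a i e hi h =>
    refine ⟨fun _ _ => rfl, fun _ _ => rfl, fun z hz => ?_, fun _ _ => rfl⟩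
    simp [Prog.writesNArr] at hz
    simp [hz]
  | putR σ a i e hi h =>
    refine ⟨fun _ _ => rfl, fun _ _ => rfl, fun _ _ => rfl, fun z hz => ?_⟩
    simp [Prog.writesRArr] at hz
    simp [hz]
  | seq _ _ ih₁ ih₂ => exact (ih₁.seq_left _).trans (ih₂.seq_right _)
  | ite_true hf hb h ih =>
    have := ih.seq_left
    exact ⟨(this _).nvar, (this _).rvar, (this _).narr, (this _).rarr⟩
  | ite_false hf hb h ih =>
    have := ih.seq_right
    exact ⟨(this _).nvar, (this _).rvar, (this _).narr, (this _).rarr⟩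
  | loop_true hf hb h₁ h₂ ih₁ ih₂ => exact (ih₁.loop _).trans ih₂

/-! ### Total correctness with loop bounds -/

/-- The cost of a program, not counting the repetition of loops. -/
def Prog.size : Prog → ℕ
  | .nop => 1
  | .setN _ e => e.time + 1
  | .setR _ e => e.time + 1
  | .putN _ i e => i.time + e.time + 1
  | .putR _ i e => i.time + e.time + 1
  | .seq p q => p.size + q.size
  | .ite b p q => b.time + 1 + p.size + q.size
  | .loop b p => b.time + 1 + p.size

/-- The nesting depth of the loops. -/
def Prog.depth : Prog → ℕ
  | .seq p q => max p.depth q.depth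
  | .ite _ p q => max p.depth q.depth
  | .loop _ p => p.depth + 1
  | _ => 0

/-- Started in `σ`, the program `p` halts in a state satisfying `Q`, provided that all words in
memory are at most `N` (then so are they afterwards). The bounds on time and on the computed words
are those of a program in which every loop makes at most `B` iterations. -/
def Tri (N B : ℕ) (p : Prog) (σ : State) (Q : State → Prop) : Prop :=
  σ.Bdd N → ∀ W, N ^ p.weight ≤ W → ∃ t τ, Exec W p σ t τ ∧ t ≤ p.size * (B + 1) ^ p.depth ∧
    τ.Bdd N ∧ Q τ

namespace Tri
variable {N B : ℕ} {p q : Prog} {σ : State} {Q R : State → Prop}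

theorem mono (h : Tri N B p σ R) (hQ : ∀ τ, Same p σ τ → R τ → Q τ) : Tri N B p σ Q := by
  intro hσ W hW
  obtain ⟨t, τ, h1, h2, h3, h4⟩ := h hσ W hW
  exact ⟨t, τ, h1, h2, h3, hQ τ h1.same h4⟩

theorem bdd (h : σ.Bdd N → Tri N B p σ Q) : Tri N B p σ Q := fun hσ => h hσ hσ

theorem nop (h : Q σ) : Tri N B .nop σ Q :=
  fun hσ _ _ => ⟨1, σ, .nop σ, by simp [Prog.size, Prog.depth], hσ, h⟩

theorem setN {x : ℕ} {e : NExp} (hb : σ.Bdd N → e.eval σ ≤ N) (h : Q (σ.setN x (e.eval σ))) :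
    Tri N B (.setN x e) σ Q :=
  fun hσ _ hW => ⟨_, _, .setN σ x e (e.fits hσ hW), by simp [Prog.size, Prog.depth],
    hσ.setN x (hb hσ), h⟩

theorem setR {x : ℕ} {e : RExp} (h : Q (σ.setR x (e.eval σ))) : Tri N B (.setR x e) σ Q :=
  fun hσ _ hW => ⟨_, _, .setR σ x e (e.fits hσ hW), by simp [Prog.size, Prog.depth],
    ⟨hσ.two_le, hσ.nvar, hσ.narr⟩, h⟩

theorem putN {a : ℕ} {i e : NExp} (hb : σ.Bdd N → e.eval σ ≤ N)
    (h : Q (σ.putN a (i.eval σ) (e.eval σ))) : Tri N B (.putN a i e) σ Q :=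
  fun hσ _ hW => ⟨_, _, .putN σ a i e
    (i.fits hσ (pow_le_of_add_le hσ.two_le (by simp [Prog.weight]) hW))
    (e.fits hσ (pow_le_of_add_le hσ.two_le (by simp [Prog.weight]) hW)),
    by simp [Prog.size, Prog.depth], hσ.putN a _ (hb hσ), h⟩

theorem putR {a : ℕ} {i : NExp} {e : RExp} (h : Q (σ.putR a (i.eval σ) (e.eval σ))) :
    Tri N B (.putR a i e) σ Q :=
  fun hσ _ hW => ⟨_, _, .putR σ a i e
    (i.fits hσ (pow_le_of_add_le hσ.two_le (by simp [Prog.weight]) hW))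
    (e.fits hσ (pow_le_of_add_le hσ.two_le (by simp [Prog.weight]) hW)),
    by simp [Prog.size, Prog.depth], ⟨hσ.two_le, hσ.nvar, hσ.narr⟩, h⟩

theorem size_mul_le {s s' d d' : ℕ} (hs : s ≤ s') (hd : d ≤ d') :
    s * (B + 1) ^ d ≤ s' * (B + 1) ^ d' :=
  Nat.mul_le_mul hs (Nat.pow_le_pow_right (Nat.succ_pos B) hd)

/-- The second program receives the frame of the first, so the intermediate assertion `R` need
mention only what `p` changes. -/
theorem seq (h₁ : Tri N B p σ R) (h₂ : ∀ ρ, Same p σ ρ → R ρ → Tri N B q ρ Q) :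
    Tri N B (.seq p q) σ Q := by
  intro hσ W hW
  obtain ⟨t, ρ, e1, l1, b1, r1⟩ :=
    h₁ hσ W (pow_le_of_add_le hσ.two_le (by simp [Prog.weight]) hW)
  obtain ⟨t', τ, e2, l2, b2, r2⟩ :=
    h₂ ρ e1.same r1 b1 W (pow_le_of_add_le hσ.two_le (by simp [Prog.weight]) hW)
  refine ⟨_, τ, e1.seq e2, ?_, b2, r2⟩
  have m1 := l1.trans (size_mul_le (B := B) le_rfl (le_max_left p.depth q.depth))
  have m2 := l2.trans (size_mul_le (B := B) le_rfl (le_max_right p.depth q.depth))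
  simp only [Prog.size, Prog.depth, add_mul]
  omega

theorem ite {b : Test} (h₁ : b.Holds σ → Tri N B p σ Q) (h₂ : ¬ b.Holds σ → Tri N B q σ Q) :
    Tri N B (.ite b p q) σ Q := by
  intro hσ W hW
  have hf := b.fits hσ (pow_le_of_add_le hσ.two_le (by simp [Prog.weight]; omega) hW)
  have one : b.time + 1 ≤ (b.time + 1) * (B + 1) ^ max p.depth q.depth :=
    Nat.le_mul_of_pos_right _ (by positivity)
  by_cases hb : b.Holds σ
  · obtain ⟨t, τ, e1, l1, b1, r1⟩ :=
      h₁ hb hσ W (pow_le_of_add_le hσ.two_le (by simp [Prog.weight]; omega) hW)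
    refine ⟨_, τ, .ite_true hf hb e1, ?_, b1, r1⟩
    have m1 := l1.trans (size_mul_le (B := B) le_rfl (le_max_left p.depth q.depth))
    simp only [Prog.size, Prog.depth, add_mul] at one ⊢
    omega
  · obtain ⟨t, τ, e1, l1, b1, r1⟩ :=
      h₂ hb hσ W (pow_le_of_add_le hσ.two_le (by simp [Prog.weight]) hW)
    refine ⟨_, τ, .ite_false hf hb e1, ?_, b1, r1⟩
    have m1 := l1.trans (size_mul_le (B := B) le_rfl (le_max_right p.depth q.depth))
    simp only [Prog.size, Prog.depth, add_mul] at one ⊢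
    omega

/-- A loop making exactly `n` iterations. -/
theorem exec_loop {b : Test} {n : ℕ} {Inv : ℕ → State → Prop} (h0 : Inv 0 σ)
    (hstep : ∀ i < n, ∀ ρ, Same p σ ρ → Inv i ρ → b.Holds ρ ∧ Tri N B p ρ (Inv (i + 1)))
    (hend : ∀ ρ, Same p σ ρ → Inv n ρ → ¬ b.Holds ρ ∧ Q ρ) (hσ : σ.Bdd N) {W : ℕ}
    (hW : N ^ (Prog.loop b p).weight ≤ W) :
    ∃ t τ, Exec W (.loop b p) σ t τ ∧
      t ≤ n * (b.time + 1 + p.size * (B + 1) ^ p.depth) + (b.time + 1) ∧ τ.Bdd N ∧ Q τ := by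
  set T := p.size * (B + 1) ^ p.depth with hT
  -- Induction on the number `j` of rounds still to come, hence the invariant at index `n - j`.
  have key : ∀ j ≤ n, ∀ ρ, Same p σ ρ → ρ.Bdd N → Inv (n - j) ρ →
      ∃ t τ, Exec W (.loop b p) ρ t τ ∧ t ≤ j * (b.time + 1 + T) + (b.time + 1) ∧
        τ.Bdd N ∧ Q τ := by
    intro j
    induction j with
    | zero =>
      intro _ ρ hs hρ hI
      have hf := b.fits hρ (pow_le_of_add_le hσ.two_le (by simp [Prog.weight]) hW)
      obtain ⟨hb, hQ⟩ := hend ρ hs hI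
      exact ⟨_, ρ, .loop_false hf hb, by omega, hρ, hQ⟩
    | succ j ih =>
      intro hj ρ hs hρ hI
      have hf := b.fits hρ (pow_le_of_add_le hσ.two_le (by simp [Prog.weight]) hW)
      obtain ⟨hb, hp⟩ := hstep (n - (j + 1)) (by omega) ρ hs hI
      obtain ⟨t, ρ', e1, l1, b1, r1⟩ :=
        hp hρ W (pow_le_of_add_le hσ.two_le (by simp [Prog.weight]) hW)
      obtain ⟨t', τ, e2, l2, b2, r2⟩ := ih (by omega) ρ' (hs.trans e1.same) b1
        (by rwa [show n - (j + 1) + 1 = n - j by omega] at r1)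
      refine ⟨_, τ, .loop_true hf hb e1 e2, ?_, b2, r2⟩
      rw [add_mul]
      omega
  exact key n le_rfl σ (Same.refl _ _) hσ (by simpa using h0)

/-- The last, failing test is paid for by the extra 1 in `B + 1`; each nesting level thus costs one
factor `B + 1`. -/
theorem loop {b : Test} {n : ℕ} {Inv : ℕ → State → Prop} (hn : n ≤ B) (h0 : Inv 0 σ)
    (hstep : ∀ i < n, ∀ ρ, Same p σ ρ → Inv i ρ → b.Holds ρ ∧ Tri N B p ρ (Inv (i + 1)))
    (hend : ∀ ρ, Same p σ ρ → Inv n ρ → ¬ b.Holds ρ ∧ Q ρ) : Tri N B (.loop b p) σ Q := by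
  intro hσ W hW
  obtain ⟨t, τ, e1, l1, b1, r1⟩ := exec_loop h0 hstep hend hσ hW
  refine ⟨t, τ, e1, l1.trans ?_, b1, r1⟩
  set T := p.size * (B + 1) ^ p.depth with hT
  have h1 : 1 ≤ (B + 1) ^ p.depth := Nat.one_le_pow _ _ (Nat.succ_pos B)
  have h2 : n * (b.time + 1 + T) ≤ B * (b.time + 1 + T) := Nat.mul_le_mul_right _ hn
  have h3 : b.time + 1 + T ≤ (b.time + 1 + p.size) * (B + 1) ^ p.depth := by
    rw [hT, add_mul]; gcongr; exact Nat.le_mul_of_pos_right _ h1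
  simp only [Prog.size, Prog.depth, pow_succ]
  calc n * (b.time + 1 + T) + (b.time + 1) ≤ (B + 1) * (b.time + 1 + T) := by
        rw [add_mul]; omega
    _ ≤ (B + 1) * ((b.time + 1 + p.size) * (B + 1) ^ p.depth) := by gcongr
    _ = _ := by ring

end Tri

/-! ### Derived tests and programs -/

/-- Strict comparison of words. -/
abbrev Test.nlt (e₁ e₂ : NExp) : Test := .not (.nle e₂ e₁)

/-- Equality of words. -/
abbrev Test.neq (e₁ e₂ : NExp) : Test := .and (.nle e₁ e₂) (.nle e₂ e₁)

/-- Strict comparison of reals. -/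
abbrev Test.rlt (e₁ e₂ : RExp) : Test := .not (.rle e₂ e₁)

/-- Run `p` with `x` equal to `0`, `1`, ..., up to the value of `y`, exclusively. -/
abbrev Prog.forLt (x y : ℕ) (p : Prog) : Prog :=
  .seq (.setN x (.const 0))
    (.loop (.nlt (.var x) (.var y)) (.seq p (.setN x (.add (.var x) (.const 1)))))

/-- Run `p` if `b` holds. -/
abbrev Prog.when (b : Test) (p : Prog) : Prog := .ite b p .nop

/-- The counter never exceeds the value of `y`, a word in memory, and so stays at most `N`. By `hI`
the invariant ignores `x`, which is reset and incremented outside `p`. -/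
theorem Tri.forLt {N B : ℕ} {p : Prog} {σ : State} {Q : State → Prop} {x y n : ℕ}
    (Inv : ℕ → State → Prop) (hy : σ.nvar y = n) (hn : n ≤ B)
    (hw : (x == y || p.writesN x || p.writesN y) = false)
    (hI : ∀ i ρ v, Inv i ρ → Inv i (ρ.setN x v)) (h0 : Inv 0 σ)
    (hstep : ∀ i < n, ∀ ρ, Same (.forLt x y p) σ ρ → ρ.nvar x = i → Inv i ρ →
      Tri N B p ρ (Inv (i + 1)))
    (hend : ∀ τ, Same (.forLt x y p) σ τ → Inv n τ → Q τ) : Tri N B (.forLt x y p) σ Q := by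
  simp only [Bool.or_eq_false_iff, beq_eq_false_iff_ne] at hw
  obtain ⟨⟨hxy, hpx⟩, hpy⟩ := hw
  have hyx : ∀ ρ, Same (.forLt x y p) σ ρ → ρ.nvar y = n := fun ρ hs =>
    (hs.nvar y (by simp [Prog.writesN, Ne.symm hxy, hpy])).trans hy
  refine Tri.bdd fun hσ => ?_
  have hnN : n ≤ N := hy ▸ hσ.nvar y
  refine Tri.seq (R := fun ρ => ρ.nvar x = 0 ∧ Inv 0 ρ)
    (Tri.setN (by simp) ⟨by simp, hI _ _ _ h0⟩) ?_
  rintro ρ₀ hs₀ ⟨hx0, hI0⟩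
  have hs₀' := hs₀.seq_left (.loop (.nlt (.var x) (.var y))
    (.seq p (.setN x (.add (.var x) (.const 1)))))
  have lift : ∀ ρ, Same (.seq p (.setN x (.add (.var x) (.const 1)))) ρ₀ ρ →
      Same (.forLt x y p) σ ρ := fun ρ hs => hs₀'.trans ((hs.loop _).seq_right _)
  refine Tri.loop (n := n) (Inv := fun i ρ => ρ.nvar x = i ∧ Inv i ρ) hn ⟨hx0, hI0⟩ ?_ ?_
  · rintro i hi ρ hs ⟨hx, hIi⟩
    refine ⟨by simp [hx, hyx ρ (lift ρ hs), hi], ?_⟩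
    refine Tri.seq (R := fun τ => τ.nvar x = i ∧ Inv (i + 1) τ)
      ((hstep i hi ρ (lift ρ hs) hx hIi).mono fun τ hs' h => ⟨(hs'.nvar x hpx).trans hx, h⟩) ?_
    rintro τ - ⟨hx', h'⟩
    refine Tri.setN (fun _ => by simp [hx']; omega) ⟨by simp [hx'], hI _ _ _ h'⟩
  · rintro ρ hs ⟨hx, hIn⟩
    exact ⟨by simp [hx, hyx ρ (lift ρ hs)], hend ρ (lift ρ hs) hIn⟩

end RAM

/-! ## Capacitated assignment with prices -/

namespace Assignment

variable {F c₀ : ℕ} {cap : ℕ → ℕ} {cst : ℕ → ℕ → ℝ} {a load : ℕ → ℕ} {y : ℕ → ℝ}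

/-- The clients below `n` are assigned to facilities below `F`, respecting capacities. -/
structure Feasible (F n : ℕ) (cap : ℕ → ℕ) (a : ℕ → ℕ) : Prop where
  lt : ∀ c < n, a c < F
  count_le : ∀ f < F, ((Finset.range n).filter fun c => a c = f).card ≤ cap f

/-- An assignment of the clients below `n` in equilibrium with the prices `y`. -/
structure Equilibrium (F n : ℕ) (cap : ℕ → ℕ) (cst : ℕ → ℕ → ℝ) (a load : ℕ → ℕ)
    (y : ℕ → ℝ) : Prop where
  lt : ∀ c < n, a c < F
  tight : ∀ c < n, ∀ f < F, cst c (a c) + y (a c) ≤ cst c f + y f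
  price_nonneg : ∀ f < F, 0 ≤ y f
  load_eq : ∀ f < F, load f = ((Finset.range n).filter fun c => a c = f).card
  load_le : ∀ f < F, load f ≤ cap f
  price_eq : ∀ f < F, load f < cap f → y f = 0

theorem sum_fiber {n : ℕ} (ha : ∀ c < n, a c < F) (y : ℕ → ℝ) :
    ∑ c ∈ Finset.range n, y (a c) =
      ∑ f ∈ Finset.range F, (((Finset.range n).filter fun c => a c = f).card : ℝ) * y f := by
  rw [← Finset.sum_fiberwise_of_maps_to (t := Finset.range F) (g := a)
    (fun c hc => by simpa using ha c (by simpa using hc))]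
  refine Finset.sum_congr rfl fun f _ => ?_
  rw [Finset.sum_congr rfl (g := fun _ => y f)
    (fun c hc => by rw [(Finset.mem_filter.1 hc).2])]
  simp

theorem Equilibrium.feasible {n : ℕ} (h : Equilibrium F n cap cst a load y) :
    Feasible F n cap a :=
  ⟨h.lt, fun f hf => h.load_eq f hf ▸ h.load_le f hf⟩

/-- An assignment in equilibrium has minimum cost. -/
theorem Equilibrium.cost_le {n : ℕ} (h : Equilibrium F n cap cst a load y) {b : ℕ → ℕ}
    (hb : Feasible F n cap b) :
    ∑ c ∈ Finset.range n, cst c (a c) ≤ ∑ c ∈ Finset.range n, cst c (b c) := by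
  have h1 : ∑ c ∈ Finset.range n, (cst c (a c) + y (a c)) ≤
      ∑ c ∈ Finset.range n, (cst c (b c) + y (b c)) :=
    Finset.sum_le_sum fun c hc => h.tight c (by simpa using hc) _ (hb.lt c (by simpa using hc))
  rw [Finset.sum_add_distrib, Finset.sum_add_distrib, sum_fiber h.lt, sum_fiber hb.lt] at h1
  -- Complementary slackness: a facility with spare capacity has price 0 and a full one carries the
  -- largest load allowed, so no feasible assignment pays more in prices than the equilibrium does.
  have h2 : ∑ f ∈ Finset.range F,
      (((Finset.range n).filter fun c => b c = f).card : ℝ) * y f ≤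
      ∑ f ∈ Finset.range F, (((Finset.range n).filter fun c => a c = f).card : ℝ) * y f := by
    refine Finset.sum_le_sum fun f hf => ?_
    have hf : f < F := by simpa using hf
    rw [← h.load_eq f hf]
    rcases (h.load_le f hf).lt_or_eq with hlt | heq
    · simp [h.price_eq f hf hlt]
    · rw [heq]
      exact mul_le_mul_of_nonneg_right (by exact_mod_cast hb.count_le f hf)
        (h.price_nonneg f hf)
  linarith

/-! ### Dijkstra's search for a facility with spare capacity -/

/-- The amount by which client `c` prefers its facility to `g` at prices `y`. -/
def slack (cst : ℕ → ℕ → ℝ) (a : ℕ → ℕ) (y : ℕ → ℝ) (c g : ℕ) : ℝ :=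
  cst c g + y g - cst c (a c) - y (a c)

/-- The invariant of Dijkstra's algorithm for inserting client `c₀`. A facility `f` is visited if
`ord f ≠ 0`, and `R` tells which pairs of a client and a facility are already relaxed. -/
structure Search (F c₀ : ℕ) (cap : ℕ → ℕ) (cst : ℕ → ℕ → ℝ) (a load : ℕ → ℕ) (y : ℕ → ℝ)
    (R : ℕ → ℕ → Prop) (r : ℕ) (L : ℕ → ℝ) (ord prev : ℕ → ℕ) : Prop where
  ord_le : ∀ f < F, ord f ≤ r
  card : ((Finset.range F).filter fun f => ord f ≠ 0).card = r
  full : ∀ f < F, ord f ≠ 0 → cap f ≤ load f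
  mono : ∀ f < F, ∀ g < F, ord f ≠ 0 → ord g = 0 → L f ≤ L g
  start : ∀ f < F, L f ≤ cst c₀ f + y f
  relaxed : ∀ c < c₀, ∀ g < F, ord (a c) ≠ 0 → R c g → L g ≤ L (a c) + slack cst a y c g
  parent : ∀ f < F, (prev f = c₀ ∧ L f = cst c₀ f + y f) ∨
    (prev f < c₀ ∧ ord (a (prev f)) ≠ 0 ∧ (ord f ≠ 0 → ord (a (prev f)) < ord f) ∧
      L f = L (a (prev f)) + slack cst a y (prev f) f)

theorem Search.init (ord : ℕ → ℕ) (hord : ∀ f < F, ord f = 0) (L : ℕ → ℝ)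
    (hL : ∀ f < F, L f = cst c₀ f + y f) (prev : ℕ → ℕ) (hp : ∀ f < F, prev f = c₀)
    (he : Equilibrium F c₀ cap cst a load y) :
    Search F c₀ cap cst a load y (fun _ _ => True) 0 L ord prev where
  ord_le f hf := (hord f hf).le
  card := by
    rw [Finset.card_eq_zero, Finset.filter_eq_empty_iff]
    intro f hf
    simpa using hord f (by simpa using hf)
  full f hf h := absurd (hord f hf) h
  mono f hf _ _ h _ := absurd (hord f hf) h
  start f hf := (hL f hf).le
  relaxed c hc _ _ h := absurd (hord _ (he.lt c hc)) h
  parent f hf := Or.inl ⟨hp f hf, hL f hf⟩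

variable {R R' : ℕ → ℕ → Prop} {r : ℕ} {L : ℕ → ℝ} {ord prev : ℕ → ℕ}

theorem Search.weaken (h : Search F c₀ cap cst a load y R r L ord prev)
    (hR : ∀ c < c₀, ∀ g < F, R' c g → R c g) :
    Search F c₀ cap cst a load y R' r L ord prev :=
  { h with relaxed := fun c hc g hg ho hr => h.relaxed c hc g hg ho (hR c hc g hg hr) }

theorem Search.le_of_lt (h : Search F c₀ cap cst a load y R r L ord prev) : r ≤ F := by
  rw [← h.card]
  exact (Finset.card_filter_le _ _).trans (by simp)

/-- Visit a full facility. -/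
theorem Search.visit (he : Equilibrium F c₀ cap cst a load y)
    (h : Search F c₀ cap cst a load y (fun _ _ => True) r L ord prev) {s : ℕ} (hs : s < F)
    (hs0 : ord s = 0) (hmin : ∀ f < F, ord f = 0 → L s ≤ L f) (hfull : cap s ≤ load s) :
    Search F c₀ cap cst a load y (fun c _ => a c ≠ s) (r + 1) L
      (Function.update ord s (r + 1)) prev where
  ord_le f hf := by
    by_cases hfs : f = s
    · simp [hfs]
    · simpa [hfs] using (h.ord_le f hf).trans (Nat.le_succ r)
  card := by
    have : (Finset.range F).filter (fun f => Function.update ord s (r + 1) f ≠ 0) =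
        insert s ((Finset.range F).filter fun f => ord f ≠ 0) := by
      ext f
      by_cases hfs : f = s
      · simp [hfs, hs]
      · simp [hfs]
    rw [this, Finset.card_insert_of_notMem (by simp [hs0]), h.card]
  full f hf := by
    by_cases hfs : f = s
    · subst hfs; exact fun _ => hfull
    · simpa [hfs] using h.full f hf
  mono f hf g hg h1 h2 := by
    have hgs : g ≠ s := by rintro rfl; simp at h2
    rw [Function.update_of_ne hgs] at h2
    by_cases hfs : f = s
    · subst hfs; exact hmin g hg h2
    · rw [Function.update_of_ne hfs] at h1
      exact h.mono f hf g hg h1 h2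
  start := h.start
  relaxed c hc g hg h1 h2 := by
    rw [Function.update_of_ne h2] at h1
    exact h.relaxed c hc g hg h1 trivial
  parent f hf := by
    rcases h.parent f hf with h1 | ⟨h1, h2, h3, h4⟩
    · exact Or.inl h1
    -- The predecessor is visited and `s` is not, so its rank is unchanged; the rank `r + 1` given
    -- to `s` exceeds all earlier ones.
    · have hne : a (prev f) ≠ s := by rintro h; exact h2 (h ▸ hs0)
      refine Or.inr ⟨h1, by rwa [Function.update_of_ne hne], ?_, h4⟩
      rw [Function.update_of_ne hne]
      by_cases hfs : f = s
      · intro _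
        simpa [hfs] using Nat.lt_succ_of_le (h.ord_le _ (he.lt _ h1))
      · simpa [hfs] using h3

/-- Equilibrium makes slacks nonnegative. Relaxing from a facility with the largest visited label
therefore can lower only unvisited labels, and leaves them above all visited ones. -/
theorem Search.relax (he : Equilibrium F c₀ cap cst a load y)
    (h : Search F c₀ cap cst a load y R r L ord prev)
    {c g : ℕ} (hc : c < c₀) (hg : g < F) (hvis : ord (a c) ≠ 0)
    (htop : ∀ f < F, ord f ≠ 0 → L f ≤ L (a c))
    (hlt : L (a c) + slack cst a y c g < L g) :
    ord g = 0 ∧ Search F c₀ cap cst a load y (fun c' g' => R c' g' ∨ (c' = c ∧ g' = g)) r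
      (Function.update L g (L (a c) + slack cst a y c g)) ord (Function.update prev g c) := by
  have hsl : 0 ≤ slack cst a y c g := by
    have := he.tight c hc g hg
    unfold slack; linarith
  have hg0 : ord g = 0 := by
    by_contra hne
    have := htop g hg hne
    linarith
  have hkeep : ∀ f, ord f ≠ 0 →
      Function.update L g (L (a c) + slack cst a y c g) f = L f := fun f hf =>
    Function.update_of_ne (by rintro rfl; exact hf hg0) _ _
  refine ⟨hg0, ⟨h.ord_le, h.card, h.full, ?_, ?_, ?_, ?_⟩⟩
  · intro f hf g' hg' hf0 hg'0
    rw [hkeep f hf0]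
    by_cases hgg : g' = g
    · subst hgg
      have := htop f hf hf0
      simp; linarith
    · simpa [hgg] using h.mono f hf g' hg' hf0 hg'0
  · intro f hf
    have := h.start f hf
    by_cases hfg : f = g
    · subst hfg; simp; linarith
    · simpa [hfg] using this
  · intro c' hc' g' hg' hv hr
    rw [hkeep _ hv]
    by_cases hgg : g' = g
    · subst hgg
      simp only [Function.update_self]
      rcases hr with hr | ⟨rfl, -⟩
      · exact hlt.le.trans (h.relaxed c' hc' g' hg' hv hr)
      · rfl
    · rw [Function.update_of_ne hgg]
      exact h.relaxed c' hc' g' hg' hv (hr.resolve_right fun h => hgg h.2)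
  · intro f hf
    by_cases hfg : f = g
    · subst hfg
      refine Or.inr ⟨by simpa using hc, by simpa using hvis, fun h => absurd hg0 h, ?_⟩
      simp only [Function.update_self, hkeep _ hvis]
    · simp only [Function.update_of_ne hfg]
      rcases h.parent f hf with h1 | ⟨h1, h2, h3, h4⟩
      · exact Or.inl h1
      · exact Or.inr ⟨h1, h2, h3, by rw [hkeep _ h2, h4]⟩

theorem Search.no_relax (h : Search F c₀ cap cst a load y R r L ord prev)
    {c g : ℕ} (hle : L g ≤ L (a c) + slack cst a y c g) :
    Search F c₀ cap cst a load y (fun c' g' => R c' g' ∨ (c' = c ∧ g' = g)) r L ord prev := by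
  refine { h with relaxed := fun c' hc' g' hg' hv hr => ?_ }
  rcases hr with hr | ⟨rfl, rfl⟩
  · exact h.relaxed c' hc' g' hg' hv hr
  · exact hle

/-- The search cannot visit all facilities if there is capacity left. -/
theorem Search.lt (he : Equilibrium F c₀ cap cst a load y)
    (h : Search F c₀ cap cst a load y R r L ord prev)
    (hcap : c₀ < ∑ f ∈ Finset.range F, cap f) : r < F := by
  refine lt_of_le_of_ne h.le_of_lt fun hr => ?_
  have hall : ∀ f < F, ord f ≠ 0 := by
    have : (Finset.range F).filter (fun f => ord f ≠ 0) = Finset.range F :=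
      Finset.eq_of_subset_of_card_le (Finset.filter_subset _ _) (by rw [h.card, hr]; simp)
    intro f hf
    have hm : f ∈ (Finset.range F).filter (fun f => ord f ≠ 0) := by rw [this]; simpa using hf
    exact (Finset.mem_filter.1 hm).2
  -- Visited facilities are full; if all were visited, the `c₀` clients assigned so far would
  -- exhaust the total capacity.
  have h1 : ∑ f ∈ Finset.range F, cap f ≤
      ∑ f ∈ Finset.range F, ((Finset.range c₀).filter fun c => a c = f).card :=
    Finset.sum_le_sum fun f hf => by
      have hf : f < F := by simpa using hf
      exact he.load_eq f hf ▸ h.full f hf (hall f hf)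
  rw [← Finset.card_eq_sum_card_fiberwise
    (fun c hc => by simpa using he.lt c (by simpa using hc))] at h1
  simp at h1
  omega

theorem Search.exists_unvisited (h : Search F c₀ cap cst a load y R r L ord prev) (hr : r < F) :
    ∃ f < F, ord f = 0 := by
  by_contra! hall
  have : (Finset.range F).filter (fun f => ord f ≠ 0) = Finset.range F :=
    Finset.filter_true_of_mem fun f hf => hall f (by simpa using hf)
  have hc := h.card
  rw [this] at hc
  simp at hc
  omega

/-! ### Price update and augmentation -/

/-- The facility `g` is a nearest facility with spare capacity. -/
structure Target (F : ℕ) (cap load : ℕ → ℕ) (L : ℕ → ℝ) (ord : ℕ → ℕ) (g : ℕ) : Prop where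
  lt : g < F
  ord_eq : ord g = 0
  min : ∀ f < F, ord f = 0 → L g ≤ L f
  spare : load g < cap g

/-- The prices after a search that ends in `g`. -/
noncomputable def newPrice (y L : ℕ → ℝ) (Λ : ℝ) (f : ℕ) : ℝ :=
  if L f < Λ then y f + (Λ - L f) else y f

/-- The invariant of the augmentation: facility `g` has one unit of reserved capacity, and
`load` counts it; `j` steps are done. Here `a₀` is the assignment before the augmentation. -/
structure Augment (F c₀ : ℕ) (cap : ℕ → ℕ) (cst : ℕ → ℕ → ℝ) (a₀ ord prev : ℕ → ℕ) (L : ℕ → ℝ)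
    (Λ : ℝ) (load : ℕ → ℕ) (y : ℕ → ℝ) (j : ℕ) (a : ℕ → ℕ) (g : ℕ) : Prop where
  lt : ∀ c < c₀, a c < F
  tight : ∀ c < c₀, ∀ f < F, cst c (a c) + y (a c) ≤ cst c f + y f
  price_nonneg : ∀ f < F, 0 ≤ y f
  load_eq : ∀ f < F, load f =
    ((Finset.range c₀).filter fun c => a c = f).card + if f = g then 1 else 0
  load_le : ∀ f < F, load f ≤ cap f
  price_eq : ∀ f < F, load f < cap f → y f = 0
  hole_lt : g < F
  hole_le : L g ≤ Λ
  root : ∀ f < F, L f ≤ Λ → prev f = c₀ → ∀ f' < F, cst c₀ f + y f ≤ cst c₀ f' + y f'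
  parent : ∀ f < F, L f ≤ Λ → prev f ≠ c₀ → prev f < c₀ ∧ a₀ (prev f) < F ∧
    ord (a₀ (prev f)) ≠ 0 ∧ (ord f ≠ 0 → ord (a₀ (prev f)) < ord f) ∧ L (a₀ (prev f)) ≤ Λ ∧
    cst (prev f) f + y f = cst (prev f) (a₀ (prev f)) + y (a₀ (prev f))
  rank : prev g ≠ c₀ → ord (a₀ (prev g)) + j ≤ F ∧
    ∀ c < c₀, ord (a₀ c) ≤ ord (a₀ (prev g)) → a c = a₀ c

/-- Only facilities with label below that of `g` become dearer; these are visited, hence full, and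
may carry a positive price. The relaxed inequalities keep all clients at cheapest facilities, and
the equations for `prev` turn into indifference of the client `prev f` between its own facility and
`f`. No client has moved yet: one unit of `g` is merely reserved. -/
theorem Search.augment (he : Equilibrium F c₀ cap cst a load y)
    (h : Search F c₀ cap cst a load y (fun _ _ => True) r L ord prev) {g : ℕ}
    (hg : Target F cap load L ord g) :
    Augment F c₀ cap cst a ord prev L (L g) (Function.update load g (load g + 1))
      (newPrice y L (L g)) 0 a g := by
  have hvisle : ∀ f < F, ord f ≠ 0 → L f ≤ L g := fun f hf h0 =>
    h.mono f hf g hg.lt h0 hg.ord_eq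
  have hvis : ∀ f < F, L f < L g → ord f ≠ 0 := fun f hf hl h0 =>
    absurd (hg.min f hf h0) (not_le.2 hl)
  -- The new price is the maximum of `y f` and `y f + (L g - L f)`: `hp` gives its value for small
  -- labels, `hp1` and `hp2` the two lower bounds.
  have hp : ∀ f, L f ≤ L g → newPrice y L (L g) f = y f + (L g - L f) := by
    intro f hf
    unfold newPrice
    split_ifs with hlt
    · rfl
    · rw [le_antisymm hf (not_lt.1 hlt)]; simp
  have hp1 : ∀ f, y f ≤ newPrice y L (L g) f := by
    intro f; unfold newPrice; split_ifs <;> linarith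
  have hp2 : ∀ f, y f + (L g - L f) ≤ newPrice y L (L g) f := by
    intro f; unfold newPrice; split_ifs <;> linarith
  refine ⟨he.lt, ?_, fun f hf => (he.price_nonneg f hf).trans (hp1 f), ?_, ?_, ?_, hg.lt, le_rfl,
    ?_, ?_, ?_⟩
  · intro c hc f hf
    have ht := he.tight c hc f hf
    by_cases hlt : L (a c) < L g
    · have hr := h.relaxed c hc f hf (hvis _ (he.lt c hc) hlt) trivial
      rw [hp _ hlt.le]
      have := hp2 f
      unfold slack at hr
      linarith
    · have : newPrice y L (L g) (a c) = y (a c) := by simp [newPrice, hlt]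
      rw [this]
      have := hp1 f
      linarith
  · intro f hf
    by_cases hfg : f = g
    · subst hfg; simp [he.load_eq f hf]
    · simp [hfg, he.load_eq f hf]
  · intro f hf
    by_cases hfg : f = g
    · subst hfg; simpa using hg.spare
    · simpa [hfg] using he.load_le f hf
  · intro f hf hlt
    have hlt' : load f < cap f := by
      by_cases hfg : f = g
      · subst hfg; exact hg.spare
      · simpa [hfg] using hlt
    have hnot : ¬ L f < L g := fun hl => absurd (h.full f hf (hvis f hf hl)) (not_le.2 hlt')
    simpa [newPrice, hnot] using he.price_eq f hf hlt'
  · intro f hf hle hpf f' hf'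
    rcases h.parent f hf with ⟨-, h1⟩ | ⟨h1, -⟩
    · rw [hp f hle]
      have h2 := hp2 f'
      have h3 := h.start f' hf'
      linarith
    · omega
  · intro f hf hle hpf
    rcases h.parent f hf with ⟨h1, -⟩ | ⟨h1, h2, h3, h4⟩
    · exact absurd h1 hpf
    · have h5 := hvisle _ (he.lt _ h1) h2
      refine ⟨h1, he.lt _ h1, h2, h3, h5, ?_⟩
      rw [hp f hle, hp _ h5]
      unfold slack at h4
      linarith
  · intro hpg
    rcases h.parent g hg.lt with ⟨h1, -⟩ | ⟨h1, -⟩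
    · exact absurd h1 hpg
    · exact ⟨(h.ord_le _ (he.lt _ h1)).trans h.le_of_lt, fun _ _ _ => rfl⟩

variable {a₀ : ℕ → ℕ} {Λ : ℝ} {j g : ℕ}

/-- The client `prev g` is indifferent between its facility and `g`, so it may take the reserved
unit; its old place becomes the new reserved unit and `load` stays correct. Ranks strictly decrease
along the path, so clients further up have not moved yet and the path has at most `F` steps. -/
theorem Augment.step (h : Augment F c₀ cap cst a₀ ord prev L Λ load y j a g) (hp : prev g ≠ c₀) :
    Augment F c₀ cap cst a₀ ord prev L Λ load y (j + 1) (Function.update a (prev g) g)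
      (a (prev g)) := by
  obtain ⟨h1, h2, h3, h4, h5, h6⟩ := h.parent g h.hole_lt h.hole_le hp
  obtain ⟨r1, r2⟩ := h.rank hp
  have hac := r2 (prev g) h1 le_rfl
  refine ⟨?_, ?_, h.price_nonneg, ?_, h.load_le, h.price_eq, by rwa [hac], by rwa [hac], h.root,
    h.parent, ?_⟩
  · intro c hc
    by_cases hcp : c = prev g
    · simpa [hcp] using h.hole_lt
    · simpa [hcp] using h.lt c hc
  · intro c hc f hf
    by_cases hcp : c = prev g
    · have := h.tight c hc f hf
      subst hcp
      rw [hac] at this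
      simpa [h6] using this
    · simpa [hcp] using h.tight c hc f hf
  · intro f hf
    rw [h.load_eq f hf]
    have hmem : prev g ∈ Finset.range c₀ := by simpa using h1
    simp only [Finset.card_filter]
    rw [← Finset.add_sum_erase _ _ hmem, ← Finset.add_sum_erase _ _ hmem]
    have : ∑ c ∈ (Finset.range c₀).erase (prev g),
        (if Function.update a (prev g) g c = f then 1 else 0) =
        ∑ c ∈ (Finset.range c₀).erase (prev g), if a c = f then 1 else 0 :=
      Finset.sum_congr rfl fun c hc => by
        rw [Function.update_of_ne (Finset.ne_of_mem_erase hc)]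
    rw [this, Function.update_self]
    simp only [eq_comm (a := f)]
    ring
  · rw [hac]
    intro hp'
    obtain ⟨k1, k2, k3, k4, -⟩ := h.parent _ h2 h5 hp'
    have k5 := k4 h3
    refine ⟨by omega, fun c hc hle => ?_⟩
    -- Such a client sits at a facility of smaller rank than the one just vacated by `prev g`.
    have hne : c ≠ prev g := by rintro rfl; omega
    rw [Function.update_of_ne hne]
    exact r2 c hc (by omega)

/-- The augmentation loop always makes `F` rounds; once the hole is a facility reached directly from
`c₀`, the remaining rounds are idle and `rank` is vacuous. -/
theorem Augment.stay (h : Augment F c₀ cap cst a₀ ord prev L Λ load y j a g) (hp : prev g = c₀)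
    (j' : ℕ) : Augment F c₀ cap cst a₀ ord prev L Λ load y j' a g :=
  { h with rank := fun hne => absurd hp hne }

/-- After `F` rounds `rank` would force rank 0 on a visited facility if the path continued. So the
hole is a facility reached from `c₀` itself, which `root` shows to be cheapest for `c₀`. -/
theorem Augment.finish (h : Augment F c₀ cap cst a₀ ord prev L Λ load y F a g) :
    Equilibrium F (c₀ + 1) cap cst (Function.update a c₀ g) load y := by
  have hp : prev g = c₀ := by
    by_contra hp
    have h1 := (h.rank hp).1
    have h2 := (h.parent g h.hole_lt h.hole_le hp).2.2.1
    omega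
  have hkeep : ∀ c < c₀, Function.update a c₀ g c = a c := fun c hc =>
    Function.update_of_ne hc.ne _ _
  refine ⟨?_, ?_, h.price_nonneg, ?_, h.load_le, h.price_eq⟩
  · intro c hc
    rcases Nat.lt_succ_iff_lt_or_eq.1 hc with hc | rfl
    · rw [hkeep c hc]; exact h.lt c hc
    · simpa using h.hole_lt
  · intro c hc f hf
    rcases Nat.lt_succ_iff_lt_or_eq.1 hc with hc | rfl
    · rw [hkeep c hc]; exact h.tight c hc f hf
    · simpa using h.root g h.hole_lt h.hole_le hp f hf
  · intro f hf
    rw [h.load_eq f hf, Finset.card_filter, Finset.card_filter, Finset.sum_range_succ]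
    congr 1
    · exact Finset.sum_congr rfl fun c hc => by rw [hkeep c (by simpa using hc)]
    · simp [eq_comm]

end Assignment

/-! ### Selecting a minimum -/

open Classical in
/-- The first index below `i` that minimizes `w` among those satisfying `P`, or `F`. -/
noncomputable def argmin (F : ℕ) (P : ℕ → Prop) (w : ℕ → ℝ) : ℕ → ℕ
  | 0 => F
  | i + 1 => if P i ∧ ¬ (argmin F P w i < F ∧ w (argmin F P w i) ≤ w i) then i
      else argmin F P w i

theorem argmin_spec {F : ℕ} {P : ℕ → Prop} {w : ℕ → ℝ} {i : ℕ} (hi : i ≤ F) :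
    (argmin F P w i = F ∧ ∀ f < i, ¬ P f) ∨
      (argmin F P w i < i ∧ P (argmin F P w i) ∧ ∀ f < i, P f → w (argmin F P w i) ≤ w f) := by
  induction i with
  | zero => exact Or.inl ⟨rfl, by simp⟩
  | succ i ih =>
    simp only [argmin]
    split_ifs with h
    · refine Or.inr ⟨by omega, h.1, fun f hf hP => ?_⟩
      rcases Nat.lt_succ_iff_lt_or_eq.1 hf with hf | rfl
      · rcases ih (by omega) with ⟨-, h2⟩ | ⟨h1, h2, h3⟩
        · exact absurd hP (h2 f hf)
        · have h4 := h3 f hf hP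
          by_contra h5
          exact h.2 ⟨by omega, by linarith⟩
      · exact le_rfl
    · rcases ih (by omega) with ⟨h1, h2⟩ | ⟨h1, h2, h3⟩
      · refine Or.inl ⟨h1, fun f hf hP => ?_⟩
        rcases Nat.lt_succ_iff_lt_or_eq.1 hf with hf | rfl
        · exact h2 f hf hP
        · exact h ⟨hP, by omega⟩
      · refine Or.inr ⟨by omega, h2, fun f hf hP => ?_⟩
        rcases Nat.lt_succ_iff_lt_or_eq.1 hf with hf | rfl
        · exact h3 f hf hP
        · by_contra h4
          exact h ⟨hP, fun h5 => h4 h5.2⟩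

theorem argmin_congr {F : ℕ} {P P' : ℕ → Prop} (w : ℕ → ℝ) {i : ℕ} (h : ∀ f < i, P f ↔ P' f) :
    argmin F P w i = argmin F P' w i := by
  induction i with
  | zero => rfl
  | succ i ih =>
    have hi := ih fun f hf => h f (by omega)
    have hP := h i (by omega)
    rw [argmin, argmin, hi]
    split_ifs with h1 h2 h2
    · rfl
    · exact absurd ⟨hP.1 h1.1, h1.2⟩ h2
    · exact absurd ⟨hP.2 h2.1, h2.2⟩ h1
    · rfl

namespace RAM

/-- Store in `s` the first `x` below `y` that minimizes the entry of the real array `ra` among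
those passing the test `b`; store `y` if there is none. -/
abbrev Prog.argmin (x s y : ℕ) (b : Test) (ra : ℕ) : Prog :=
  .seq (.setN s (.var y)) (.forLt x y (.when
    (.and b (.not (.and (.nlt (.var s) (.var y)) (.rle (.get ra (.var s)) (.get ra (.var x))))))
    (.setN s (.var x))))

variable {N B : ℕ} {σ : State}

/-- The test `b` is evaluated in many states of the loop; `hb` ties all of them to one predicate `P`
fixed beforehand. -/
theorem Tri.argmin {x s y ra F : ℕ} {b : Test} {P : ℕ → Prop}
    (hw : (x == y || x == s || y == s) = false) (hy : σ.nvar y = F) (hF : F ≤ B)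
    (hb : ∀ ρ, Same (.argmin x s y b ra) σ ρ → (b.Holds ρ ↔ P (ρ.nvar x))) :
    Tri N B (.argmin x s y b ra) σ fun τ => τ.nvar s = _root_.argmin F P (σ.rarr ra) F := by
  simp only [Bool.or_eq_false_iff, beq_eq_false_iff_ne] at hw
  obtain ⟨⟨hxy, hxs⟩, hys⟩ := hw
  refine Tri.seq (R := fun ρ => ρ.nvar s = F)
    (Tri.setN (fun hσ => hσ.nvar y) (by simp [hy])) fun ρ₀ hs₀ h₀ => ?_
  have hy₀ : ρ₀.nvar y = F := (hs₀.nvar y (by simpa [Prog.writesN] using hys)).trans hy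
  refine Tri.forLt (fun i ρ => ρ.nvar s = _root_.argmin F P (σ.rarr ra) i) hy₀ hF
    (by simp [Prog.writesN, hxy, hxs, hys]) (fun i ρ v h => by simpa [Ne.symm hxs] using h)
    (by simpa [_root_.argmin] using h₀) ?_ fun τ _ h => h
  intro i hi ρ hs hx hI
  have hsσ := (hs₀.seq_left _).trans (hs.seq_right _)
  have hbρ := hb ρ hsσ
  have hyρ : ρ.nvar y = F := by
    rw [hsσ.nvar y (by simp [Prog.writesN, hys, Ne.symm hxy]), hy]
  have hrρ : ρ.rarr ra = σ.rarr ra := hsσ.rarr ra (by simp [Prog.writesRArr])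
  have hcond : (Test.and b (.not (.and (.nlt (.var s) (.var y))
      (.rle (.get ra (.var s)) (.get ra (.var x)))))).Holds ρ ↔
      P i ∧ ¬ (_root_.argmin F P (σ.rarr ra) i < F ∧
        σ.rarr ra (_root_.argmin F P (σ.rarr ra) i) ≤ σ.rarr ra i) := by
    simp only [Test.Holds, NExp.eval, RExp.eval, hbρ, hx, hI, hyρ, hrρ, not_le]
  refine Tri.ite (fun h => Tri.setN (fun hσ => hσ.nvar x) ?_) (fun h => Tri.nop ?_)
  · rw [hcond] at h
    simp [_root_.argmin, if_pos h, hx]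
  · rw [hcond] at h
    simp [_root_.argmin, if_neg h, hI]

/-! ### Assigning the clients to the open facilities

Word array 5 tells which facilities are open, word variable 3 holds their capacity, and real array
3 holds the costs. The assignment and the loads are computed in word arrays 7 and 8 and the prices
in real array 4. -/

namespace Assign

open Assignment

/-- The cost of assigning client `c` to facility `f`. -/
abbrev costAt (c f : ℕ) : RExp := .get 3 (.add (.mul (.var c) (.var 0)) (.var f))

/-- The distance to facility 17 via facility 19 and its client 18. -/
abbrev relaxed : RExp :=
  .add (.get 5 (.var 19)) (.sub (.sub (.add (costAt 18 17) (.get 4 (.var 17))) (costAt 18 19))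
    (.get 4 (.var 19)))

/-- Relax all pairs of a client of facility 19 and a facility. -/
abbrev relax : Prog :=
  .forLt 18 14 (.when (.neq (.get 7 (.var 18)) (.var 19)) (.forLt 17 0
    (.when (.rlt relaxed (.get 5 (.var 17)))
      (.seq (.putR 5 (.var 17) relaxed) (.putN 10 (.var 17) (.var 18))))))

/-- Visit facilities until one with spare capacity is found. -/
abbrev search : Prog :=
  .seq (.setN 15 (.const 0)) (.forLt 16 0 (.when (.neq (.var 15) (.const 0))
    (.seq (.argmin 17 19 0 (.neq (.get 9 (.var 17)) (.const 0)) 5)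
      (.ite (.nlt (.get 8 (.var 19)) (.mul (.get 5 (.var 19)) (.var 3)))
        (.setN 15 (.const 1))
        (.seq (.putN 9 (.var 19) (.add (.var 16) (.const 1))) relax)))))

/-- Initialize the search. -/
abbrev init : Prog :=
  .forLt 17 0 (.seq (.putR 5 (.var 17) (.add (costAt 14 17) (.get 4 (.var 17))))
    (.seq (.putN 9 (.var 17) (.const 0)) (.putN 10 (.var 17) (.var 14))))

/-- Update the prices after a search that ends in facility 19. -/
abbrev price : Prog :=
  .seq (.setR 1 (.get 5 (.var 19))) (.forLt 17 0 (.when (.rlt (.get 5 (.var 17)) (.var 1))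
    (.putR 4 (.var 17) (.add (.get 4 (.var 17)) (.sub (.var 1) (.get 5 (.var 17)))))))

/-- Shift clients along the path that leads to facility 19. -/
abbrev augment : Prog :=
  .seq (.putN 8 (.var 19) (.add (.get 8 (.var 19)) (.const 1)))
    (.seq (.forLt 16 0 (.when (.not (.neq (.get 10 (.var 19)) (.var 14)))
      (.seq (.setN 18 (.get 10 (.var 19))) (.seq (.setN 17 (.get 7 (.var 18)))
        (.seq (.putN 7 (.var 18) (.var 19)) (.setN 19 (.var 17)))))))
      (.putN 7 (.var 14) (.var 19)))

/-- Insert client 14 into the assignment. -/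
abbrev insert : Prog := .seq init (.seq search (.seq price augment))

/-- Compute an assignment of minimum cost. -/
abbrev main : Prog :=
  .seq (.forLt 17 0 (.seq (.putR 4 (.var 17) .zero) (.putN 8 (.var 17) (.const 0))))
    (.forLt 14 1 insert)

/-- The memory holds an assignment problem. -/
structure Problem (B F C u : ℕ) (op : ℕ → ℕ) (cst : ℕ → ℕ → ℝ) (σ : State) : Prop where
  numF : σ.nvar 0 = F
  numC : σ.nvar 1 = C
  unit : σ.nvar 3 = u
  opened : σ.narr 5 = op
  cost : ∀ c f, σ.rarr 3 (c * F + f) = cst c f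
  numF_le : F ≤ B
  numC_le : C ≤ B

variable {F C u c₀ r s : ℕ} {op : ℕ → ℕ} {cst : ℕ → ℕ → ℝ} {a load ord prev : ℕ → ℕ}
  {y L : ℕ → ℝ}

theorem Problem.same (h : Problem B F C u op cst σ) {p : Prog} {τ : State} (hs : Same p σ τ)
    (hp : (p.writesN 0 || p.writesN 1 || p.writesN 3 || p.writesNArr 5 || p.writesRArr 3) =
      false) : Problem B F C u op cst τ := by
  simp only [Bool.or_eq_false_iff] at hp
  obtain ⟨⟨⟨⟨h0, h1⟩, h3⟩, h5⟩, hr⟩ := hp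
  exact ⟨(hs.nvar 0 h0).trans h.numF, (hs.nvar 1 h1).trans h.numC, (hs.nvar 3 h3).trans h.unit,
    (hs.narr 5 h5).trans h.opened, fun c f => by rw [hs.rarr 3 hr, h.cost], h.numF_le, h.numC_le⟩

/-- The capacities. -/
abbrev caps (op : ℕ → ℕ) (u f : ℕ) : ℕ := op f * u

/-- The relation of relaxed pairs grows with the two counters from the clients away from `s` to all
clients. Labels of visited facilities never change, so `s` keeps the largest visited label
throughout. -/
theorem tri_relax (hc : Problem B F C u op cst σ) (h14 : σ.nvar 14 = c₀) (hc₀ : c₀ ≤ B)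
    (h19 : σ.nvar 19 = s) (ha : σ.narr 7 = a) (hy : σ.rarr 4 = y) (hvis : ord s ≠ 0)
    (he : Equilibrium F c₀ (caps op u) cst a load y)
    (h : Search F c₀ (caps op u) cst a load y (fun c _ => a c ≠ s) r (σ.rarr 5) ord (σ.narr 10))
    (htop : ∀ f < F, ord f ≠ 0 → σ.rarr 5 f ≤ σ.rarr 5 s) :
    Tri N B relax σ fun τ => Search F c₀ (caps op u) cst a load y (fun _ _ => True) r
      (τ.rarr 5) ord (τ.narr 10) := by
  refine Tri.forLt (fun i ρ => Search F c₀ (caps op u) cst a load y (fun c _ => a c ≠ s ∨ c < i) r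
      (ρ.rarr 5) ord (ρ.narr 10) ∧ ∀ f < F, ord f ≠ 0 → ρ.rarr 5 f ≤ ρ.rarr 5 s) h14 hc₀ rfl
    (fun _ _ _ h => h) ⟨h.weaken (by simp), htop⟩ ?_
    fun τ _ h => h.1.weaken fun c hc _ _ _ => Or.inr hc
  rintro i hi ρ hs hx ⟨hI, hT⟩
  have hcρ := hc.same hs rfl
  have h7 : ρ.narr 7 = a := (hs.narr 7 rfl).trans ha
  have h19ρ : ρ.nvar 19 = s := (hs.nvar 19 rfl).trans h19
  refine Tri.ite (fun hb => ?_) (fun hb => Tri.nop ⟨hI.weaken fun c hc g _ hor => ?_, hT⟩)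
  · have has : a i = s := by
      simp [hx, h7, h19ρ] at hb; omega
    refine Tri.forLt (fun j ρ' => Search F c₀ (caps op u) cst a load y
        (fun c g => a c ≠ s ∨ c < i ∨ (c = i ∧ g < j)) r
        (ρ'.rarr 5) ord (ρ'.narr 10) ∧ ∀ f < F, ord f ≠ 0 → ρ'.rarr 5 f ≤ ρ'.rarr 5 s)
      hcρ.numF hc.numF_le rfl (fun _ _ _ h => h) ⟨hI.weaken (by simp), hT⟩ ?_
      fun τ _ h => ⟨h.1.weaken fun c hc g hg hor => ?_, h.2⟩
    · rintro j hj ρ' hs' hx' ⟨hI', hT'⟩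
      have hcρ' := hcρ.same hs' rfl
      have h19' : ρ'.nvar 19 = s := (hs'.nvar 19 rfl).trans h19ρ
      have h18' : ρ'.nvar 18 = i := (hs'.nvar 18 rfl).trans hx
      have h4' : ρ'.rarr 4 = y := ((hs'.rarr 4 rfl).trans (hs.rarr 4 rfl)).trans hy
      have hval : relaxed.eval ρ' = ρ'.rarr 5 (a i) + slack cst a y i j := by
        simp [slack, h19', h18', hx', h4', hcρ'.numF, hcρ'.cost, has]
      have hww : ∀ c < c₀, ∀ g < F, (a c ≠ s ∨ c < i ∨ (c = i ∧ g < j + 1)) →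
          (a c ≠ s ∨ c < i ∨ (c = i ∧ g < j)) ∨ (c = i ∧ g = j) := by
        intro c _ g _ h; omega
      refine Tri.ite (fun hb' => ?_) (fun hb' => Tri.nop ⟨?_, hT'⟩)
      · simp only [Test.Holds, hval] at hb'
        simp only [RExp.eval, NExp.eval, hx', not_le] at hb'
        obtain ⟨hj0, hS⟩ := hI'.relax he hi hj (by rwa [has]) (by rwa [has]) hb'
        refine Tri.seq (R := fun τ => τ = ρ'.putR 5 j (ρ'.rarr 5 (a i) + slack cst a y i j))
          (Tri.putR (by rw [hval]; simp [hx'])) ?_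
        rintro _ - rfl
        refine Tri.putN (fun hσ => hσ.nvar 18) ?_
        refine ⟨?_, fun f hf hf0 => ?_⟩
        · simpa [hx', h18'] using hS.weaken hww
        · have hfj : f ≠ j := by rintro rfl; exact hf0 hj0
          have hsj : s ≠ j := by rintro rfl; exact hvis hj0
          simpa [hfj, hsj] using hT' f hf hf0
      · simp only [Test.Holds, hval] at hb'
        simp only [RExp.eval, NExp.eval, hx', not_not] at hb'
        exact (hI'.no_relax hb').weaken hww
    · omega
  · rcases hor with h1 | h1
    · exact Or.inl h1
    · rcases Nat.lt_succ_iff_lt_or_eq.1 h1 with h1 | rfl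
      · exact Or.inr h1
      · refine Or.inl fun has => hb ?_
        simp [hx, h7, h19ρ, has]

theorem tri_init (hc : Problem B F C u op cst σ) (h14 : σ.nvar 14 = c₀)
    (he : Equilibrium F c₀ (caps op u) cst (σ.narr 7) (σ.narr 8) (σ.rarr 4)) :
    Tri N B init σ fun τ => Search F c₀ (caps op u) cst (σ.narr 7) (σ.narr 8) (σ.rarr 4)
      (fun _ _ => True) 0 (τ.rarr 5) (τ.narr 9) (τ.narr 10) := by
  refine Tri.forLt (fun i ρ => ∀ f < i, ρ.narr 9 f = 0 ∧ ρ.narr 10 f = c₀ ∧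
    ρ.rarr 5 f = cst c₀ f + σ.rarr 4 f) hc.numF hc.numF_le rfl (fun _ _ _ h => h) (by simp) ?_
    fun τ _ h => Search.init _ (fun f hf => (h f hf).1) _ (fun f hf => (h f hf).2.2) _
      (fun f hf => (h f hf).2.1) he
  intro i hi ρ hs hx hI
  have hcρ := hc.same hs rfl
  have h14' : ρ.nvar 14 = c₀ := (hs.nvar 14 rfl).trans h14
  have h4 : ρ.rarr 4 = σ.rarr 4 := hs.rarr 4 rfl
  refine Tri.seq (R := fun τ => τ = ρ.putR 5 i (cst c₀ i + σ.rarr 4 i))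
    (Tri.putR (by simp [hx, h14', hcρ.numF, hcρ.cost, h4])) ?_
  rintro _ - rfl
  refine Tri.seq (R := fun τ => τ = (ρ.putR 5 i (cst c₀ i + σ.rarr 4 i)).putN 9 i 0)
    (Tri.putN (by simp) (by simp [hx])) ?_
  rintro _ - rfl
  refine Tri.putN (fun hσ => hσ.nvar 14) fun f hf => ?_
  rcases Nat.lt_succ_iff_lt_or_eq.1 hf with hf | rfl
  · simpa [hx, hf.ne] using hI f hf
  · simp [hx, h14']

/-- Variable 15 freezes the state once a nearest unvisited facility has spare capacity. Were it
still 0 after `F` rounds, all `F` facilities would be visited, which `Search.lt` excludes. -/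
theorem tri_search (hc : Problem B F C u op cst σ) (h14 : σ.nvar 14 = c₀) (hc₀ : c₀ ≤ B)
    (hcap : c₀ < ∑ f ∈ Finset.range F, caps op u f)
    (ha : σ.narr 7 = a) (hl : σ.narr 8 = load) (hy : σ.rarr 4 = y)
    (he : Equilibrium F c₀ (caps op u) cst a load y)
    (h : Search F c₀ (caps op u) cst a load y (fun _ _ => True) 0 (σ.rarr 5) (σ.narr 9)
      (σ.narr 10)) :
    Tri N B search σ fun τ => (∃ r, Search F c₀ (caps op u) cst a load y (fun _ _ => True) r
      (τ.rarr 5) (τ.narr 9) (τ.narr 10)) ∧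
      Target F (caps op u) load (τ.rarr 5) (τ.narr 9) (τ.nvar 19) := by
  refine Tri.seq (R := fun τ => τ = σ.setN 15 0) (Tri.setN (by simp) (by simp)) ?_
  rintro _ - rfl
  refine Tri.forLt (fun i ρ =>
    (ρ.nvar 15 = 0 ∧ Search F c₀ (caps op u) cst a load y (fun _ _ => True) i
      (ρ.rarr 5) (ρ.narr 9) (ρ.narr 10)) ∨
    (ρ.nvar 15 = 1 ∧ (∃ r, Search F c₀ (caps op u) cst a load y (fun _ _ => True) r
      (ρ.rarr 5) (ρ.narr 9) (ρ.narr 10)) ∧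
      Target F (caps op u) load (ρ.rarr 5) (ρ.narr 9) (ρ.nvar 19))) (n := F)
    (by simpa using hc.numF) hc.numF_le rfl (fun _ _ _ h => h) (Or.inl ⟨by simp, h⟩) ?_ ?_
  swap
  · rintro τ - (⟨-, h⟩ | ⟨-, h⟩)
    · exact absurd (h.lt he hcap) (lt_irrefl _)
    · exact h
  intro i hi ρ hs hx hI
  refine Tri.ite (fun hb => ?_) (fun hb => Tri.nop (Or.inr ?_))
  swap
  · rcases hI with ⟨h1, -⟩ | h1
    · simp [h1] at hb
    · exact h1
  rcases hI with ⟨-, hS⟩ | ⟨h1, -⟩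
  swap
  · simp [h1] at hb
  have hc1 : Problem B F C u op cst ρ :=
    (Problem.mk (σ := σ.setN 15 0) hc.numF hc.numC hc.unit hc.opened hc.cost hc.numF_le
      hc.numC_le).same hs rfl
  refine Tri.seq (Tri.argmin (P := fun f => ρ.narr 9 f = 0) (F := F) rfl hc1.numF hc.numF_le
    fun ρ' hs' => ?_) ?_
  · have : ρ'.narr 9 = ρ.narr 9 := hs'.narr 9 rfl
    simp [this]
  intro ρ' hs' hmin
  have hc2 := hc1.same hs' rfl
  have h9 : ρ'.narr 9 = ρ.narr 9 := hs'.narr 9 rfl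
  have h5 : ρ'.rarr 5 = ρ.rarr 5 := hs'.rarr 5 rfl
  have h10 : ρ'.narr 10 = ρ.narr 10 := hs'.narr 10 rfl
  have h8 : ρ'.narr 8 = load := ((hs'.narr 8 rfl).trans (hs.narr 8 rfl)).trans hl
  have h7 : ρ'.narr 7 = a := ((hs'.narr 7 rfl).trans (hs.narr 7 rfl)).trans ha
  have h4 : ρ'.rarr 4 = y := ((hs'.rarr 4 rfl).trans (hs.rarr 4 rfl)).trans hy
  have h14' : ρ'.nvar 14 = c₀ := ((hs'.nvar 14 rfl).trans (hs.nvar 14 rfl)).trans h14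
  have h16 : ρ'.nvar 16 = i := (hs'.nvar 16 rfl).trans hx
  obtain ⟨hlt, h0, hle⟩ : ρ'.nvar 19 < F ∧ ρ'.narr 9 (ρ'.nvar 19) = 0 ∧
      ∀ f < F, ρ'.narr 9 f = 0 → ρ'.rarr 5 (ρ'.nvar 19) ≤ ρ'.rarr 5 f := by
    rw [hmin, h9, h5]
    rcases argmin_spec (F := F) (P := fun f => ρ.narr 9 f = 0) (w := ρ.rarr 5) le_rfl with
      ⟨-, h2⟩ | h2
    · obtain ⟨f, hf, hf0⟩ := hS.exists_unvisited hi
      exact absurd hf0 (h2 f hf)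
    · exact h2
  rw [← h9, ← h5, ← h10] at hS
  refine Tri.ite (fun hb' => Tri.setN (fun hσ => by have := hσ.two_le; simp; omega) ?_)
    (fun hb' => ?_)
  · refine Or.inr ⟨by simp, ⟨i, hS⟩, ⟨hlt, h0, hle, ?_⟩⟩
    simpa [h8, hc2.opened, hc2.unit] using hb'
  · have hfull : caps op u (ρ'.nvar 19) ≤ load (ρ'.nvar 19) := by
      simpa [h8, hc2.opened, hc2.unit] using hb'
    refine Tri.seq (R := fun τ => τ = ρ'.putN 9 (ρ'.nvar 19) (i + 1)) (Tri.putN ?_ (by simp [h16]))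
      ?_
    · intro hσ
      have := hσ.nvar 0
      rw [hc2.numF] at this
      simp [h16]; omega
    rintro _ - rfl
    set s := ρ'.nvar 19
    have hv := hS.visit he hlt h0 hle hfull
    refine (tri_relax (σ := ρ'.putN 9 s (i + 1)) (s := s) (ord := Function.update (ρ'.narr 9) s (i + 1)) (r := i + 1)
      ⟨hc2.numF, hc2.numC, hc2.unit, hc2.opened, hc2.cost, hc2.numF_le, hc2.numC_le⟩
      h14' hc₀ rfl h7 h4 (by simp) he hv ?_).mono ?_
    · intro f hf hf0
      by_cases hfs : f = s
      · simp [hfs]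
      · exact hS.mono f hf s hlt (by simpa [hfs] using hf0) h0
    · intro τ hs'' hτ
      refine Or.inl ⟨?_, ?_⟩
      · have h15 : ρ.nvar 15 = 0 := by simpa using hb
        rw [hs''.nvar 15 rfl]
        simpa [hs'.nvar 15 rfl] using h15
      · rw [hs''.narr 9 rfl]
        simpa using hτ

theorem tri_price {g : ℕ} (hF : σ.nvar 0 = F) (hFB : F ≤ B) (h19 : σ.nvar 19 = g) :
    Tri N B price σ fun τ => ∀ f < F, τ.rarr 4 f =
      newPrice (σ.rarr 4) (σ.rarr 5) (σ.rarr 5 g) f := by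
  refine Tri.seq (R := fun τ => τ = σ.setR 1 (σ.rarr 5 g)) (Tri.setR (by simp [h19])) ?_
  rintro _ - rfl
  refine Tri.forLt (fun i ρ => ∀ f, ρ.rarr 4 f = if f < i then
    newPrice (σ.rarr 4) (σ.rarr 5) (σ.rarr 5 g) f else σ.rarr 4 f) (n := F) hF hFB rfl
    (fun _ _ _ h => h) (by simp) ?_ fun τ _ h f hf => by rw [h f, if_pos hf]
  intro i hi ρ hs hx hI
  have h5 : ρ.rarr 5 = σ.rarr 5 := hs.rarr 5 rfl
  have h1 : ρ.rvar 1 = σ.rarr 5 g := (hs.rvar 1 rfl).trans (by simp)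
  refine Tri.ite (fun hb => Tri.putR fun f => ?_) (fun hb => Tri.nop fun f => ?_)
  · rcases lt_trichotomy f i with hf | rfl | hf
    · simp [hx, hf.ne, hI f, hf, Nat.lt_succ_of_lt hf]
    · simp [hx, h5, h1] at hb
      simp [hx, hI f, newPrice, hb, h1, h5]
    · simp [hx, hf.ne', hI f, Nat.not_lt.2 hf, hf.not_gt]
  · rcases lt_trichotomy f i with hf | rfl | hf
    · simp [hI f, hf, Nat.lt_succ_of_lt hf]
    · simp [hx, h5, h1] at hb
      simp [hI f, newPrice, hb.not_gt]
    · simp [hI f, Nat.not_lt.2 hf, hf.not_gt]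

/-- Needed because the program agrees with `newPrice` only below `F`. -/
theorem _root_.Assignment.Augment.congr_price {cap : ℕ → ℕ} {a₀ : ℕ → ℕ} {Λ : ℝ} {j g : ℕ}
    (h : Augment F c₀ cap cst a₀ ord prev L Λ load y j a g) {y' : ℕ → ℝ}
    (hy : ∀ f < F, y' f = y f) : Augment F c₀ cap cst a₀ ord prev L Λ load y' j a g where
  lt := h.lt
  tight c hc f hf := by rw [hy f hf, hy _ (h.lt c hc)]; exact h.tight c hc f hf
  price_nonneg f hf := by rw [hy f hf]; exact h.price_nonneg f hf
  load_eq := h.load_eq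
  load_le := h.load_le
  price_eq f hf := by rw [hy f hf]; exact h.price_eq f hf
  hole_lt := h.hole_lt
  hole_le := h.hole_le
  root f hf h1 h2 f' hf' := by rw [hy f hf, hy f' hf']; exact h.root f hf h1 h2 f' hf'
  parent f hf h1 h2 := by
    obtain ⟨k1, k2, k3⟩ := h.parent f hf h1 h2
    exact ⟨k1, k2, by rw [hy f hf, hy _ k2]; exact k3⟩
  rank := h.rank

/-- By `hl` the incremented load is at most the number of clients, a word already in memory, so the
bound `N` survives. -/
theorem tri_augment {cap : ℕ → ℕ} {a₀ : ℕ → ℕ} {Λ : ℝ} (hF : σ.nvar 0 = F) (hFB : F ≤ B)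
    (h14 : σ.nvar 14 = c₀) (hp : σ.narr 10 = prev) (hl : σ.narr 8 (σ.nvar 19) < σ.nvar 1)
    (h : Augment F c₀ cap cst a₀ ord prev L Λ
      (Function.update (σ.narr 8) (σ.nvar 19) (σ.narr 8 (σ.nvar 19) + 1)) (σ.rarr 4) 0 (σ.narr 7)
      (σ.nvar 19)) :
    Tri N B augment σ fun τ => Equilibrium F (c₀ + 1) cap cst (τ.narr 7) (τ.narr 8)
      (τ.rarr 4) := by
  set g := σ.nvar 19 with hg
  refine Tri.seq (R := fun τ => τ = σ.putN 8 g (σ.narr 8 g + 1)) (Tri.putN ?_ (by simp [hg])) ?_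
  · intro hσ
    have := hσ.nvar 1
    simp [← hg]; omega
  rintro _ - rfl
  refine Tri.seq (R := fun τ => τ.nvar 14 = c₀ ∧ Augment F c₀ cap cst a₀ ord prev L Λ (τ.narr 8)
    (τ.rarr 4) F (τ.narr 7) (τ.nvar 19)) ?_ ?_
  · refine Tri.forLt (fun i τ => Augment F c₀ cap cst a₀ ord prev L Λ (τ.narr 8)
      (τ.rarr 4) i (τ.narr 7) (τ.nvar 19)) (n := F) hF hFB rfl (fun _ _ _ h => h)
      (by simpa [← hg] using h) ?_ fun τ hs h => ⟨(hs.nvar 14 rfl).trans h14, h⟩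
    intro i hi ρ hs hx hI
    have h10 : ρ.narr 10 = prev := (hs.narr 10 rfl).trans hp
    have h14' : ρ.nvar 14 = c₀ := (hs.nvar 14 rfl).trans h14
    refine Tri.ite (fun hb => ?_) (fun hb => Tri.nop (hI.stay ?_ _))
    · have hne : prev (ρ.nvar 19) ≠ c₀ := by
        rintro heq
        simp [h10, h14', heq] at hb
      have hst := hI.step hne
      set g := ρ.nvar 19 with hg
      refine Tri.seq (R := fun τ => τ = ρ.setN 18 (prev g))
        (Tri.setN (fun hσ => hσ.narr 10 _) (by simp [h10, ← hg])) ?_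
      rintro _ - rfl
      refine Tri.seq (R := fun τ => τ = (ρ.setN 18 (prev g)).setN 17 (ρ.narr 7 (prev g)))
        (Tri.setN (fun hσ => hσ.narr 7 _) (by simp)) ?_
      rintro _ - rfl
      refine Tri.seq (R := fun τ => τ = ((ρ.setN 18 (prev g)).setN 17 (ρ.narr 7 (prev g))).putN 7
        (prev g) g) (Tri.putN (fun hσ => hσ.nvar 19) (by simp [← hg])) ?_
      rintro _ - rfl
      refine Tri.setN (fun hσ => hσ.nvar 17) (by simpa using hst)
    · simp [h10, h14'] at hb
      omega
  · rintro ρ - ⟨h14', hA⟩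
    exact Tri.putN (fun hσ => hσ.nvar 19) (by simpa [h14'] using hA.finish)

theorem tri_insert (hc : Problem B F C u op cst σ) (h14 : σ.nvar 14 = c₀) (hc₀ : c₀ < C)
    (hcap : C ≤ ∑ f ∈ Finset.range F, caps op u f)
    (he : Equilibrium F c₀ (caps op u) cst (σ.narr 7) (σ.narr 8) (σ.rarr 4)) :
    Tri N B insert σ fun τ => Equilibrium F (c₀ + 1) (caps op u) cst (τ.narr 7) (τ.narr 8)
      (τ.rarr 4) := by
  have hcB := hc.numC_le
  refine Tri.seq (tri_init hc h14 he) fun ρ₁ s₁ i₁ => ?_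
  have c₁ := hc.same s₁ rfl
  refine Tri.seq (tri_search c₁ ((s₁.nvar 14 rfl).trans h14) (by omega) (by omega)
    (s₁.narr 7 rfl) (s₁.narr 8 rfl) (s₁.rarr 4 rfl) he i₁) ?_
  rintro ρ₂ s₂ ⟨⟨r, i₂⟩, ht⟩
  have c₂ := c₁.same s₂ rfl
  refine Tri.seq (tri_price c₂.numF c₂.numF_le rfl) fun ρ₃ s₃ i₃ => ?_
  have c₃ := c₂.same s₃ rfl
  have h7 : ρ₃.narr 7 = σ.narr 7 := ((s₃.narr 7 rfl).trans (s₂.narr 7 rfl)).trans (s₁.narr 7 rfl)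
  have h8 : ρ₃.narr 8 = σ.narr 8 := ((s₃.narr 8 rfl).trans (s₂.narr 8 rfl)).trans (s₁.narr 8 rfl)
  have h4 : ρ₂.rarr 4 = σ.rarr 4 := (s₂.rarr 4 rfl).trans (s₁.rarr 4 rfl)
  have h19 : ρ₃.nvar 19 = ρ₂.nvar 19 := s₃.nvar 19 rfl
  have h14' : ρ₃.nvar 14 = c₀ :=
    (((s₃.nvar 14 rfl).trans (s₂.nvar 14 rfl)).trans (s₁.nvar 14 rfl)).trans h14
  rw [h4] at i₃
  refine tri_augment (prev := ρ₂.narr 10) c₃.numF c₃.numF_le h14' (s₃.narr 10 rfl) ?_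
    (L := ρ₂.rarr 5) (ord := ρ₂.narr 9) (Λ := ρ₂.rarr 5 (ρ₂.nvar 19)) (a₀ := σ.narr 7) ?_
  · rw [h8, h19, he.load_eq _ ht.lt, c₃.numC]
    exact lt_of_le_of_lt (Finset.card_filter_le _ _) (by simpa using hc₀)
  · rw [h7, h8, h19]
    exact (i₂.augment he ht).congr_price i₃

/-- The program computes a feasible assignment of minimum cost if there is enough capacity. -/
theorem tri_main (hc : Problem B F C u op cst σ)
    (hcap : C ≤ ∑ f ∈ Finset.range F, caps op u f) :
    Tri N B main σ fun τ => Feasible F C (caps op u) (τ.narr 7) ∧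
      ∀ b, Feasible F C (caps op u) b →
        ∑ c ∈ Finset.range C, cst c (τ.narr 7 c) ≤ ∑ c ∈ Finset.range C, cst c (b c) := by
  refine Tri.seq (R := fun τ => ∀ f < F, τ.narr 8 f = 0 ∧ τ.rarr 4 f = 0) ?_ ?_
  · refine Tri.forLt (fun i ρ => ∀ f < i, ρ.narr 8 f = 0 ∧ ρ.rarr 4 f = 0) hc.numF hc.numF_le rfl
      (fun _ _ _ h => h) (by simp) ?_ fun _ _ h => h
    intro i hi ρ hs hx hI
    refine Tri.seq (R := fun τ => τ = ρ.putR 4 i 0) (Tri.putR (by simp [hx])) ?_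
    rintro _ - rfl
    refine Tri.putN (by simp) fun f hf => ?_
    rcases Nat.lt_succ_iff_lt_or_eq.1 hf with hf | rfl
    · simpa [hx, hf.ne] using hI f hf
    · simp [hx]
  intro ρ hs h0
  have hcρ := hc.same hs rfl
  refine Tri.forLt (fun i τ => Equilibrium F i (caps op u) cst (τ.narr 7) (τ.narr 8)
    (τ.rarr 4)) hcρ.numC hc.numC_le rfl (fun _ _ _ h => h) ?_ ?_
    fun τ _ h => ⟨h.feasible, fun b hb => h.cost_le hb⟩
  · exact ⟨by simp, by simp, fun f hf => (h0 f hf).2.ge, fun f hf => by simp [(h0 f hf).1],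
      fun f hf => by simp [(h0 f hf).1], fun f hf _ => (h0 f hf).2⟩
  · intro i hi ρ' hs' hx hI
    exact tri_insert (hcρ.same hs' rfl) hx hi hcap hI

end Assign

end RAM

/-! ## Shortest paths -/

theorem index_inj {F c c' f f' : ℕ} (hf : f < F) (hf' : f' < F) (h : c * F + f = c' * F + f') :
    c = c' ∧ f = f' := by
  have h1 := congrArg (· / F) h
  have h2 := congrArg (· % F) h
  have hF : 0 < F := by omega
  simp only [mul_comm _ F, Nat.mul_add_div hF, Nat.div_eq_of_lt hf, Nat.div_eq_of_lt hf',
    Nat.mul_add_mod, Nat.mod_eq_of_lt hf, Nat.mod_eq_of_lt hf'] at h1 h2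
  exact ⟨h1, h2⟩

/-- The invariant of the Floyd–Warshall algorithm: the triangle inequality holds via the vertices
below `K`, and distances are realized in the sense of `Rz`. -/
structure Closed (m K : ℕ) (W : ℕ → ℕ → ℝ) (Rz : ℕ → ℕ → ℝ → Prop) (D : ℕ → ℕ → ℝ) : Prop where
  nonneg : ∀ i < m, ∀ j < m, 0 ≤ D i j
  self : ∀ i < m, D i i = 0
  le : ∀ i < m, ∀ j < m, D i j ≤ W i j
  realized : ∀ i < m, ∀ j < m, Rz i j (D i j)
  triangle : ∀ k < K, ∀ i < m, ∀ j < m, D i j ≤ D i k + D k j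

/-- One round of the Floyd–Warshall algorithm. -/
noncomputable def floydRound (K : ℕ) (D : ℕ → ℕ → ℝ) (i j : ℕ) : ℝ := min (D i j) (D i K + D K j)

section
variable {m K : ℕ} {W D D' : ℕ → ℕ → ℝ} {Rz : ℕ → ℕ → ℝ → Prop}

theorem Closed.congr (h : Closed m K W Rz D) (hK : K ≤ m)
    (hD : ∀ i < m, ∀ j < m, D' i j = D i j) : Closed m K W Rz D' where
  nonneg i hi j hj := by rw [hD i hi j hj]; exact h.nonneg i hi j hj
  self i hi := by rw [hD i hi i hi]; exact h.self i hi
  le i hi j hj := by rw [hD i hi j hj]; exact h.le i hi j hj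
  realized i hi j hj := by rw [hD i hi j hj]; exact h.realized i hi j hj
  triangle k hk i hi j hj := by
    rw [hD i hi j hj, hD i hi k (by omega), hD k (by omega) j hj]; exact h.triangle k hk i hi j hj

/-- As `D K K = 0`, a round leaves row and column `K` alone. This makes the in-place update of the
program equal to the simultaneous one. -/
theorem floydRound_col (h : Closed m K W Rz D) (hK : K < m) (i : ℕ) :
    floydRound K D i K = D i K := by simp [floydRound, h.self K hK]

theorem floydRound_row (h : Closed m K W Rz D) (hK : K < m) (j : ℕ) :
    floydRound K D K j = D K j := by simp [floydRound, h.self K hK]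

/-- For an old intermediate vertex `k`, if both legs use `K`, the loop from `K` to `k` and back is
dropped at no loss by nonnegativity; the other cases use the old triangle inequalities. -/
theorem Closed.round (hRz : ∀ i < m, ∀ k < m, ∀ j < m, ∀ x x', Rz i k x → Rz k j x' →
    Rz i j (x + x')) (h : Closed m K W Rz D) (hK : K < m) :
    Closed m (K + 1) W Rz (floydRound K D) where
  nonneg i hi j hj := le_min (h.nonneg i hi j hj)
    (add_nonneg (h.nonneg i hi K hK) (h.nonneg K hK j hj))
  self i hi := by
    have h1 := h.nonneg i hi K hK
    have h2 := h.nonneg K hK i hi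
    rw [floydRound, h.self i hi, min_eq_left (by linarith)]
  le i hi j hj := (min_le_left _ _).trans (h.le i hi j hj)
  realized i hi j hj := by
    unfold floydRound
    rcases min_choice (D i j) (D i K + D K j) with h1 | h1 <;> rw [h1]
    · exact h.realized i hi j hj
    · exact hRz i hi K hK j hj _ _ (h.realized i hi K hK) (h.realized K hK j hj)
  triangle k hk i hi j hj := by
    rcases Nat.lt_succ_iff_lt_or_eq.1 hk with hk | rfl
    · have hkm : k < m := by omega
      have t1 := h.triangle k hk i hi j hj
      have t2 := h.triangle k hk K hK j hj
      have t3 := h.triangle k hk i hi K hK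
      have p1 := h.nonneg K hK k hkm
      have p2 := h.nonneg k hkm K hK
      have m1 : floydRound K D i j ≤ D i j := min_le_left _ _
      have m2 : floydRound K D i j ≤ D i K + D K j := min_le_right _ _
      rcases min_choice (D i k) (D i K + D K k) with h1 | h1 <;>
      rcases min_choice (D k j) (D k K + D K j) with h2 | h2 <;>
      simp only [floydRound, h1, h2] at m1 m2 ⊢ <;> linarith
    · rw [floydRound_col h hK, floydRound_row h hK]
      exact min_le_right _ _

end

/-! ## Preprocessing -/

namespace RAM

namespace Prep

/-- The entry of a matrix indexed by the vertices, stored row by row. -/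
abbrev idx (x y : NExp) : NExp := .add (.mul x (.var 5)) y

/-- The index of the entry for two centers. -/
abbrev cidx (x y : NExp) : NExp := idx (.add (.var 6) x) (.add (.var 6) y)

/-- Store the number of vertices, the number of points, and the number of facilities to open. -/
abbrev sizes : Prog :=
  .seq (.setN 6 (.add (.var 0) (.var 1))) (.seq (.setN 5 (.add (.var 6) (.var 2)))
    (.ite (.nle (.var 4) (.var 0)) (.setN 7 (.var 4)) (.setN 7 (.var 0))))

/-- Store the center of every point in word array 3 and the weight of its edge in real array 1. -/
abbrev centers : Prog :=
  .forLt 11 6 (.forLt 12 2 (.when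
    (.nlt (.const 0) (.get 0 (idx (.var 11) (.add (.var 6) (.var 12)))))
    (.seq (.putN 3 (.var 11) (.var 12))
      (.putR 1 (.var 11) (.get 0 (idx (.var 11) (.add (.var 6) (.var 12))))))))

/-- The Floyd–Warshall algorithm on the centers. -/
abbrev floyd : Prog :=
  .forLt 11 2 (.forLt 12 2 (.forLt 13 2 (.when
    (.rlt (.add (.get 0 (cidx (.var 12) (.var 11))) (.get 0 (cidx (.var 11) (.var 13))))
      (.get 0 (cidx (.var 12) (.var 13))))
    (.putR 0 (cidx (.var 12) (.var 13))
      (.add (.get 0 (cidx (.var 12) (.var 11))) (.get 0 (cidx (.var 11) (.var 13))))))))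

/-- Store the distances of clients and facilities in real array 3. -/
abbrev costs : Prog :=
  .forLt 11 1 (.forLt 12 0 (.putR 3 (.add (.mul (.var 11) (.var 0)) (.var 12))
    (.add (.add (.get 1 (.add (.var 0) (.var 11)))
      (.get 0 (cidx (.get 3 (.add (.var 0) (.var 11))) (.get 3 (.var 12)))))
      (.get 1 (.var 12)))))

/-- The preprocessing. -/
abbrev main : Prog := .seq sizes (.seq centers (.seq floyd costs))

variable {N B F C m k : ℕ} {σ : State}

/-- The sizes of an instance are stored. -/
structure Sizes (B F C m : ℕ) (σ : State) : Prop where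
  numF : σ.nvar 0 = F
  numC : σ.nvar 1 = C
  numS : σ.nvar 2 = m
  le : F + C + m ≤ B
  size : σ.nvar 5 = F + C + m
  points : σ.nvar 6 = F + C

theorem Sizes.same (h : Sizes B F C m σ) {p : Prog} {τ : State} (hs : Same p σ τ)
    (hp : (p.writesN 0 || p.writesN 1 || p.writesN 2 || p.writesN 5 || p.writesN 6) = false) :
    Sizes B F C m τ := by
  simp only [Bool.or_eq_false_iff] at hp
  obtain ⟨⟨⟨⟨h0, h1⟩, h2⟩, h5⟩, h6⟩ := hp
  exact ⟨(hs.nvar 0 h0).trans h.numF, (hs.nvar 1 h1).trans h.numC, (hs.nvar 2 h2).trans h.numS,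
    h.le, (hs.nvar 5 h5).trans h.size, (hs.nvar 6 h6).trans h.points⟩

theorem tri_sizes (h0 : σ.nvar 0 = F) (h1 : σ.nvar 1 = C) (h2 : σ.nvar 2 = m) (h4 : σ.nvar 4 = k)
    (hB : F + C + m ≤ B) (hN : F + C + m ≤ N) :
    Tri N B sizes σ fun τ => Sizes B F C m τ ∧ τ.nvar 7 = min k F := by
  refine Tri.seq (R := fun τ => τ = σ.setN 6 (F + C)) (Tri.setN (fun _ => by simp [h0, h1]; omega)
    (by simp [h0, h1])) ?_
  rintro _ - rfl
  refine Tri.seq (R := fun τ => τ = (σ.setN 6 (F + C)).setN 5 (F + C + m))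
    (Tri.setN (fun _ => by simp [h2]; omega) (by simp [h2])) ?_
  rintro _ - rfl
  refine Tri.ite (fun hb => Tri.setN (fun hσ => hσ.nvar 4) ?_)
    (fun hb => Tri.setN (fun hσ => hσ.nvar 0) ?_)
  · simp [h0, h4] at hb
    exact ⟨⟨h0, h1, h2, hB, rfl, rfl⟩, by simp [h4, hb]⟩
  · simp [h0, h4] at hb
    exact ⟨⟨h0, h1, h2, hB, rfl, rfl⟩, by simp [h0, hb.le]⟩

theorem tri_centers (h : Sizes B F C m σ) {cen : ℕ → ℕ} (hcen : ∀ v < F + C, cen v < m)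
    (hadj : ∀ v < F + C, ∀ s < m, σ.narr 0 (v * (F + C + m) + (F + C + s)) =
      if s = cen v then 1 else 0) :
    Tri N B centers σ fun τ => ∀ v < F + C, τ.narr 3 v = cen v ∧
      τ.rarr 1 v = σ.rarr 0 (v * (F + C + m) + (F + C + cen v)) := by
  have hB := h.le
  refine Tri.forLt (fun i ρ => ∀ v < i, ρ.narr 3 v = cen v ∧
      ρ.rarr 1 v = σ.rarr 0 (v * (F + C + m) + (F + C + cen v))) h.points (by omega) rfl
      (fun _ _ _ h => h) (by simp) ?_ fun _ _ h => h
  intro v hv ρ hs hx hI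
  have hρ := h.same hs rfl
  -- The row of `v` is claimed only when the scan has passed its center; the earlier rows are
  -- carried along.
  refine Tri.forLt (fun j ρ' => ∀ v' < v + 1, (v' = v → cen v < j) → ρ'.narr 3 v' = cen v' ∧
      ρ'.rarr 1 v' = σ.rarr 0 (v' * (F + C + m) + (F + C + cen v'))) hρ.numS (by omega) rfl
      (fun _ _ _ h => h) (fun v' h1 h2 => hI v' ((Nat.lt_succ_iff_lt_or_eq.1 h1).resolve_right fun h =>
        absurd (h2 h) (Nat.not_lt_zero _))) ?_ fun τ _ h v' hv' => h v' hv' fun _ => hcen v hv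
  intro s hs' ρ' hsa hx' hI'
  have hρ' := hρ.same hsa rfl
  have h11 : ρ'.nvar 11 = v := (hsa.nvar 11 rfl).trans hx
  have hn0 : ρ'.narr 0 = σ.narr 0 := (hsa.narr 0 rfl).trans (hs.narr 0 rfl)
  have hr0 : ρ'.rarr 0 = σ.rarr 0 := (hsa.rarr 0 rfl).trans (hs.rarr 0 rfl)
  have hA := hadj v hv s hs'
  refine Tri.ite (fun hb => ?_) (fun hb => Tri.nop fun v' h1 h2 => hI' v' h1 fun h3 => ?_)
  · have hsc : s = cen v := by
      by_contra hne
      simp [h11, hρ'.size, hρ'.points, hx', hn0, hA, hne] at hb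
    refine Tri.seq (R := fun τ => τ = ρ'.putN 3 v s)
      (Tri.putN (fun hσ => hσ.nvar 12) (by simp [h11, hx'])) ?_
    rintro _ - rfl
    refine Tri.putR fun v' h1 h2 => ?_
    by_cases hvv : v' = v
    · subst hvv
      simp [h11, hρ'.size, hρ'.points, hx', hr0, hsc]
    · simpa [h11, hvv] using hI' v' h1 fun h => absurd h hvv
  · have h4 := h2 h3
    have hne : s ≠ cen v := by
      intro hsc
      rw [if_pos hsc] at hA
      simp [h11, hρ'.size, hρ'.points, hx', hn0, hA] at hb
    omega

/-- The matrix of real array 0, restricted to the centers. -/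
abbrev mat (P m : ℕ) (σ : State) (i j : ℕ) : ℝ := σ.rarr 0 ((P + i) * (P + m) + (P + j))

theorem tri_floyd (h : Sizes B F C m σ) {W : ℕ → ℕ → ℝ} {Rz : ℕ → ℕ → ℝ → Prop}
    (hRz : ∀ i < m, ∀ k < m, ∀ j < m, ∀ x x', Rz i k x → Rz k j x' → Rz i j (x + x'))
    (hD : Closed m 0 W Rz (mat (F + C) m σ)) :
    Tri N B floyd σ fun τ => Closed m m W Rz (mat (F + C) m τ) := by
  have hB := h.le
  refine Tri.forLt (fun i ρ => Closed m i W Rz (mat (F + C) m ρ)) h.numS (by omega) rfl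
    (fun _ _ _ h => h) hD ?_ fun _ _ h => h
  intro k hk ρ hs hx hI
  have hρ := h.same hs rfl
  set D := mat (F + C) m ρ with hDdef
  suffices hsuff : Tri N B (.forLt 12 2 (.forLt 13 2 (.when
    (.rlt (.add (.get 0 (cidx (.var 12) (.var 11))) (.get 0 (cidx (.var 11) (.var 13))))
      (.get 0 (cidx (.var 12) (.var 13))))
    (.putR 0 (cidx (.var 12) (.var 13))
      (.add (.get 0 (cidx (.var 12) (.var 11))) (.get 0 (cidx (.var 11) (.var 13)))))))) ρ
      fun τ => ∀ i < m, ∀ j < m, mat (F + C) m τ i j = floydRound k D i j from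
    hsuff.mono fun τ _ hτ => (hI.round hRz hk).congr hk hτ
  refine Tri.forLt (fun i τ => ∀ i' < m, ∀ j' < m, mat (F + C) m τ i' j' =
    if i' < i then floydRound k D i' j' else D i' j') hρ.numS (by omega) rfl
    (fun _ _ _ h => h) (by simp [D]) ?_ fun τ _ h i' hi' j' hj' => by rw [h i' hi' j' hj', if_pos hi']
  intro i hi ρ₁ hs₁ hx₁ hI₁
  have hρ₁ := hρ.same hs₁ rfl
  refine Tri.forLt (fun j τ => ∀ i' < m, ∀ j' < m, mat (F + C) m τ i' j' =
    if i' < i ∨ (i' = i ∧ j' < j) then floydRound k D i' j' else D i' j') hρ₁.numS (by omega) rfl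
    (fun _ _ _ h => h) (fun i' hi' j' hj' => by simpa using hI₁ i' hi' j' hj') ?_
    fun τ _ h i' hi' j' hj' => by
      rw [h i' hi' j' hj']
      exact if_congr (by omega) rfl rfl
  intro j hj ρ₂ hs₂ hx₂ hI₂
  have hρ₂ := hρ₁.same hs₂ rfl
  have h12 : ρ₂.nvar 12 = i := (hs₂.nvar 12 rfl).trans hx₁
  have h11 : ρ₂.nvar 11 = k := ((hs₂.nvar 11 rfl).trans (hs₁.nvar 11 rfl)).trans hx
  -- Row and column `k` may already have been processed in this round, but with unchanged values.
  have e1 : mat (F + C) m ρ₂ i k = D i k := by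
    rw [hI₂ i hi k hk]
    split_ifs
    · exact floydRound_col hI hk i
    · rfl
  have e2 : mat (F + C) m ρ₂ k j = D k j := by
    rw [hI₂ k hk j hj]
    split_ifs
    · exact floydRound_row hI hk j
    · rfl
  have e3 : mat (F + C) m ρ₂ i j = D i j := by
    rw [hI₂ i hi j hj, if_neg (by omega)]
  simp only [mat] at e1 e2 e3
  have key : ∀ τ : State, (∀ i' j', mat (F + C) m τ i' j' = if i' = i ∧ j' = j then
      floydRound k D i j else mat (F + C) m ρ₂ i' j') → ∀ i' < m, ∀ j' < m,
      mat (F + C) m τ i' j' =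
        if i' < i ∨ (i' = i ∧ j' < j + 1) then floydRound k D i' j' else D i' j' := by
    intro τ hτ i' hi' j' hj'
    rw [hτ]
    split_ifs with h1 h2 h2
    · rw [h1.1, h1.2]
    · omega
    · rw [hI₂ i' hi' j' hj', if_pos (by omega)]
    · rw [hI₂ i' hi' j' hj', if_neg (by omega)]
  refine Tri.ite (fun hb => Tri.putR ?_) (fun hb => Tri.nop ?_)
  · simp only [Test.Holds, RExp.eval, NExp.eval, h11, h12, hx₂, hρ₂.size, hρ₂.points, e1, e2, e3,
      not_le] at hb
    intro i' hi' j' hj'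
    by_cases hij : i' = i ∧ j' = j
    · obtain ⟨rfl, rfl⟩ := hij
      rw [if_pos (by omega)]
      simp only [mat, State.putR_rarr, NExp.eval, RExp.eval, h11, h12, hx₂, hρ₂.size, hρ₂.points,
        Function.update_self, e1, e2]
      rw [floydRound, min_eq_right hb.le]
    · have hne : (F + C + i') * (F + C + m) + (F + C + j') ≠
          (F + C + i) * (F + C + m) + (F + C + j) := by
        intro heq
        have := index_inj (by omega) (by omega) heq
        omega
      have h1 := hI₂ i' hi' j' hj'
      simp only [mat, State.putR_rarr, NExp.eval, RExp.eval, h11, h12, hx₂, hρ₂.size, hρ₂.points,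
        Function.update_self, Function.update_of_ne hne] at h1 ⊢
      rw [h1]
      exact if_congr (by omega) rfl rfl
  · simp only [Test.Holds, RExp.eval, NExp.eval, h11, h12, hx₂, hρ₂.size, hρ₂.points, e1, e2, e3,
      not_not] at hb
    refine key _ fun i' j' => ?_
    split_ifs with hij
    · rw [hij.1, hij.2, floydRound, min_eq_left hb]
      exact e3
    · rfl

theorem tri_costs (h : Sizes B F C m σ) :
    Tri N B costs σ fun τ => ∀ c < C, ∀ f < F, τ.rarr 3 (c * F + f) =
      σ.rarr 1 (F + c) + mat (F + C) m σ (σ.narr 3 (F + c)) (σ.narr 3 f) + σ.rarr 1 f := by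
  have hB := h.le
  refine Tri.forLt (fun i τ => ∀ c < C, ∀ f < F, c < i → τ.rarr 3 (c * F + f) =
      σ.rarr 1 (F + c) + mat (F + C) m σ (σ.narr 3 (F + c)) (σ.narr 3 f) + σ.rarr 1 f)
      h.numC (by omega) rfl (fun _ _ _ h => h) (by simp) ?_ fun τ _ h c hc f hf => h c hc f hf hc
  intro i hi ρ hs hx hI
  have hρ := h.same hs rfl
  refine Tri.forLt (fun j τ => ∀ c < C, ∀ f < F, (c < i ∨ c = i ∧ f < j) → τ.rarr 3 (c * F + f) =
      σ.rarr 1 (F + c) + mat (F + C) m σ (σ.narr 3 (F + c)) (σ.narr 3 f) + σ.rarr 1 f)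
      hρ.numF (by omega) rfl (fun _ _ _ h => h) (fun c hc f hf h => hI c hc f hf (by omega)) ?_
      fun τ _ h c hc f hf hci => h c hc f hf (by omega)
  intro j hj ρ' hs' hx' hI'
  have hρ' := hρ.same hs' rfl
  have h11 : ρ'.nvar 11 = i := (hs'.nvar 11 rfl).trans hx
  have h3 : ρ'.narr 3 = σ.narr 3 := (hs'.narr 3 rfl).trans (hs.narr 3 rfl)
  have r0 : ρ'.rarr 0 = σ.rarr 0 := (hs'.rarr 0 rfl).trans (hs.rarr 0 rfl)
  have r1 : ρ'.rarr 1 = σ.rarr 1 := (hs'.rarr 1 rfl).trans (hs.rarr 1 rfl)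
  refine Tri.putR fun c hc f hf hcf => ?_
  by_cases hij : c = i ∧ f = j
  · obtain ⟨rfl, rfl⟩ := hij
    simp [h11, hx', hρ'.numF, hρ'.size, hρ'.points, h3, r0, r1]
  · have hne : c * F + f ≠ i * F + j := by
      intro heq
      have := index_inj hf hj heq
      omega
    simpa [h11, hx', hρ'.numF, hne] using hI' c hc f hf (by omega)

/-- The preprocessing computes centers, edge weights and distances. -/
theorem tri_main (h0 : σ.nvar 0 = F) (h1 : σ.nvar 1 = C) (h2 : σ.nvar 2 = m) (h4 : σ.nvar 4 = k)
    (hB : F + C + m ≤ B) (hN : F + C + m ≤ N) {cen : ℕ → ℕ} (hcen : ∀ v < F + C, cen v < m)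
    (hadj : ∀ v < F + C, ∀ s < m, σ.narr 0 (v * (F + C + m) + (F + C + s)) =
      if s = cen v then 1 else 0)
    {W : ℕ → ℕ → ℝ} {Rz : ℕ → ℕ → ℝ → Prop}
    (hRz : ∀ i < m, ∀ k < m, ∀ j < m, ∀ x x', Rz i k x → Rz k j x' → Rz i j (x + x'))
    (hD : Closed m 0 W Rz (mat (F + C) m σ)) {w : ℕ → ℝ}
    (hw : ∀ v < F + C, σ.rarr 0 (v * (F + C + m) + (F + C + cen v)) = w v) :
    Tri N B main σ fun τ => τ.nvar 7 = min k F ∧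
      (∀ f < F, τ.narr 3 f = cen f ∧ τ.rarr 1 f = w f) ∧
      ∃ D, Closed m m W Rz D ∧ ∀ c < C, ∀ f < F, τ.rarr 3 (c * F + f) =
        w (F + c) + D (cen (F + c)) (cen f) + w f := by
  refine Tri.seq (tri_sizes h0 h1 h2 h4 hB hN) ?_
  rintro ρ₁ s₁ ⟨z₁, k₁⟩
  refine Tri.seq (tri_centers z₁ hcen (by rwa [s₁.narr 0 rfl])) ?_
  intro ρ₂ s₂ i₂
  have z₂ := z₁.same s₂ rfl
  have hr : ρ₂.rarr 0 = σ.rarr 0 := (s₂.rarr 0 rfl).trans (s₁.rarr 0 rfl)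
  refine Tri.seq (tri_floyd z₂ hRz
    (hD.congr (Nat.zero_le m) fun i _ j _ => by simp only [mat, hr])) ?_
  intro ρ₃ s₃ i₃
  have z₃ := z₂.same s₃ rfl
  refine (tri_costs z₃).mono fun τ s₄ i₄ => ?_
  have hc : ∀ v < F + C, ρ₃.narr 3 v = cen v ∧ ρ₃.rarr 1 v = w v := by
    intro v hv
    rw [s₃.narr 3 rfl, s₃.rarr 1 rfl, (i₂ v hv).1, (i₂ v hv).2, s₁.rarr 0 rfl, hw v hv]
    exact ⟨rfl, rfl⟩
  refine ⟨?_, fun f hf => ?_, _, i₃, fun c hc' f hf => ?_⟩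
  · rw [s₄.nvar 7 rfl, s₃.nvar 7 rfl, s₂.nvar 7 rfl, k₁]
  · rw [s₄.narr 3 rfl, s₄.rarr 1 rfl]
    exact hc f (by omega)
  · rw [i₄ c hc' f hf, (hc (F + c) (by omega)).1, (hc (F + c) (by omega)).2,
      (hc f (by omega)).1, (hc f (by omega)).2]

end Prep

end RAM

/-! ## Distances in centered graphs -/

namespace WGraph

/-- The total weight of a walk. -/
noncomputable def length {V : Type} (G : WGraph V) {x y : V} (p : G.graph.Walk x y) : ℝ≥0 :=
  (p.edges.map G.weight).sum

@[simp] theorem length_nil {V : Type} (G : WGraph V) (x : V) :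
    G.length (.nil : G.graph.Walk x x) = 0 := by simp [length]

@[simp] theorem length_cons {V : Type} (G : WGraph V) {x y z : V} (h : G.graph.Adj x y)
    (p : G.graph.Walk y z) : G.length (.cons h p) = G.weight s(x, y) + G.length p := by
  simp [length]

@[simp] theorem length_append {V : Type} (G : WGraph V) {x y z : V} (p : G.graph.Walk x y)
    (q : G.graph.Walk y z) : G.length (p.append q) = G.length p + G.length q := by
  simp [length]

/-- A potential that decreases along every edge by at most its weight bounds lengths of walks. -/
theorem le_length_of_potential {V : Type} (G : WGraph V) (φ : V → ℝ)
    (h : ∀ a b, G.graph.Adj a b → φ a ≤ G.weight s(a, b) + φ b) {x y : V}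
    (p : G.graph.Walk x y) : φ x ≤ G.length p + φ y := by
  induction p with
  | nil => simp
  | cons hab p ih =>
    have := h _ _ hab
    rw [length_cons]
    push_cast
    linarith

/-- The walk `p` both attains the bound and makes the family of walks nonempty, without which the
infimum could not be bounded below. -/
theorem dist_eq_of_forall {V : Type} (G : WGraph V) {x y : V} {r : ℝ}
    (h₁ : ∀ p : G.graph.Walk x y, r ≤ G.length p) (p : G.graph.Walk x y)
    (h₂ : (G.length p : ℝ) ≤ r) : (G.dist x y : ℝ) = r := by
  have : Nonempty (G.graph.Walk x y) := ⟨p⟩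
  apply le_antisymm
  · refine le_trans ?_ h₂
    exact_mod_cast ciInf_le (OrderBot.bddBelow _) p
  · have hr : r.toNNReal ≤ G.dist x y := le_ciInf fun q => Real.toNNReal_le_iff_le_coe.2 (h₁ q)
    exact Real.toNNReal_le_iff_le_coe.1 hr

variable {P : Type} {m : ℕ}

/-- Distances of points, in terms of the distances `D` of centers. -/
theorem dist_point (G : WGraph (P ⊕ Fin m)) (cen : P → Fin m)
    (hcen : ∀ v x, G.graph.Adj (.inl v) x ↔ x = .inr (cen v)) (D : Fin m → Fin m → ℝ)
    (hself : ∀ s, D s s = 0) (htri : ∀ s t r, D s r ≤ D s t + D t r)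
    (hle : ∀ s t, G.graph.Adj (.inr s) (.inr t) → D s t ≤ G.weight s(.inr s, .inr t))
    (hreal : ∀ s t, ∃ p : G.graph.Walk (.inr s) (.inr t), (G.length p : ℝ) ≤ D s t)
    {x y : P} (hxy : x ≠ y) :
    (G.dist (.inl x) (.inl y) : ℝ) = G.weight s(.inl x, .inr (cen x)) + D (cen x) (cen y) +
      G.weight s(.inl y, .inr (cen y)) := by
  classical
  set w : P → ℝ := fun v => G.weight s(.inl v, .inr (cen v)) with hw
  have hw0 : ∀ v, 0 ≤ w v := fun v => NNReal.coe_nonneg _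
  have hadj : ∀ v, G.graph.Adj (.inl v) (.inr (cen v)) := fun v => (hcen v _).2 rfl
  obtain ⟨p, hp⟩ := hreal (cen x) (cen y)
  refine dist_eq_of_forall G ?_ (.cons (hadj x) (p.append (.cons (hadj y).symm .nil))) ?_
  · intro q
    -- The potential is the claimed distance to `y`, with value 0 at `y` itself. At `x` it equals
    -- the claimed formula because `x ≠ y`.
    have key := G.le_length_of_potential (fun a => a.elim
      (fun v => if v = y then 0 else w v + D (cen v) (cen y) + w y)
      (fun s => D s (cen y) + w y)) ?_ q
    · simpa [hxy] using key
    rintro (a | s) (b | t) hab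
    · simpa using (hcen a _).1 hab
    · obtain rfl : t = cen a := by simpa using (hcen a _).1 hab
      have h1 := hw0 a
      by_cases hay : a = y
      · subst hay
        simp only [Sum.elim_inl, if_pos, Sum.elim_inr, hself]
        have : 0 ≤ w a + (0 + w a) := by linarith
        exact this
      · simp only [Sum.elim_inl, if_neg hay, Sum.elim_inr]
        have : w a + D (cen a) (cen y) + w y ≤ w a + (D (cen a) (cen y) + w y) := by linarith
        exact this
    · obtain rfl : s = cen b := by simpa using (hcen b _).1 hab.symm
      have h1 := hw0 b
      rw [Sym2.eq_swap]
      by_cases hby : b = y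
      · subst hby
        simp only [Sum.elim_inl, if_pos, Sum.elim_inr, hself]
        have : 0 + w b ≤ w b + 0 := by linarith
        exact this
      · simp only [Sum.elim_inl, if_neg hby, Sum.elim_inr]
        have : D (cen b) (cen y) + w y ≤ w b + (w b + D (cen b) (cen y) + w y) := by linarith
        exact this
    · have h1 := hle s t hab
      have h2 := htri s t (cen y)
      simp only [Sum.elim_inr]
      linarith
  · simp only [length_cons, length_append, length_nil]
    push_cast
    rw [Sym2.eq_swap (a := Sum.inr (cen y))]
    linarith

end WGraph

/-! ### Vertex numbering and matrix storage -/

namespace CKM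

variable {m : ℕ} (I : CKM)

theorem code_lt (x : I.Point ⊕ Fin m) : I.code x < I.size m := by
  rcases x with (f | c) | s <;> simp only [code, size]
  · have := f.2; omega
  · have := c.2; omega
  · have := s.2; omega

theorem code_injective : Function.Injective (I.code (m := m)) := by
  rintro ((f | c) | s) ((f' | c') | s') h <;> simp only [code] at h
  · simp [Fin.ext_iff, h]
  · have := f.2; omega
  · have := f.2; omega
  · have := f'.2; omega
  · simp only [Sum.inl.injEq, Sum.inr.injEq, Fin.ext_iff]; omega
  · have := c.2; omega
  · have := f'.2; omega
  · have := c'.2; omega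
  · simp only [Sum.inr.injEq, Fin.ext_iff]; omega

theorem flatten_code {R : Type} [AddCommMonoid R] (M : I.Point ⊕ Fin m → I.Point ⊕ Fin m → R)
    (x y : I.Point ⊕ Fin m) : I.flatten M (I.code x * I.size m + I.code y) = M x y := by
  unfold flatten
  have h : ∀ x' y', I.code x' * I.size m + I.code y' = I.code x * I.size m + I.code y ↔
      x' = x ∧ y' = y := by
    intro x' y'
    constructor
    · intro h
      obtain ⟨h1, h2⟩ := index_inj (I.code_lt y') (I.code_lt y) h
      exact ⟨I.code_injective h1, I.code_injective h2⟩
    · rintro ⟨rfl, rfl⟩; rfl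
  simp only [h]
  rw [Finset.sum_eq_single x _ (by simp), Finset.sum_eq_single y _ (by simp)]
  · simp
  · intro y' _ hy; simp [hy]
  · intro x' _ hx; simp [hx]

end CKM

/-! ## Opening facilities -/

/-- The facilities that are opened for the first `i` entries of the tuple `t` of centers: for each
entry, a facility of minimum weight among the unopened ones at that center. -/
noncomputable def greedy (F : ℕ) (cen : ℕ → ℕ) (w : ℕ → ℝ) (t : ℕ → ℕ) : ℕ → Finset ℕ
  | 0 => ∅
  | i + 1 =>
    let s := argmin F (fun f => cen f = t i ∧ f ∉ greedy F cen w t i) w F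
    if s < F then insert s (greedy F cen w t i) else greedy F cen w t i

/-- The clients below `C` are assigned to facilities in `O`, at most `u` to each. -/
structure Serves (C u : ℕ) (O : Finset ℕ) (b : ℕ → ℕ) : Prop where
  mem : ∀ c < C, b c ∈ O
  count_le : ∀ f ∈ O, ((Finset.range C).filter fun c => b c = f).card ≤ u

section
variable {F C u K m : ℕ} {cen : ℕ → ℕ} {w : ℕ → ℝ} {cst : ℕ → ℕ → ℝ} {O S : Finset ℕ}
  {b : ℕ → ℕ}

/-- The first alternative is a wasted entry: its center has no unopened facility, and `argmin`
returns the sentinel `F`. -/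
theorem greedy_succ (t : ℕ → ℕ) (i : ℕ) :
    (greedy F cen w t (i + 1) = greedy F cen w t i ∧
      ∀ f < F, cen f = t i → f ∈ greedy F cen w t i) ∨
    ∃ s < F, greedy F cen w t (i + 1) = insert s (greedy F cen w t i) ∧ cen s = t i ∧
      s ∉ greedy F cen w t i ∧
      ∀ f < F, cen f = t i → f ∉ greedy F cen w t i → w s ≤ w f := by
  simp only [greedy]
  rcases argmin_spec (F := F) (P := fun f => cen f = t i ∧ f ∉ greedy F cen w t i) (w := w)
    le_rfl with ⟨h1, h2⟩ | ⟨h1, h2, h3⟩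
  · refine Or.inl ⟨by rw [if_neg (by omega)], fun f hf hc => ?_⟩
    by_contra hO
    exact h2 f hf ⟨hc, hO⟩
  · exact Or.inr ⟨_, h1, by rw [if_pos h1], h2.1, h2.2, fun f hf hc hO => h3 f hf ⟨hc, hO⟩⟩

theorem greedy_subset (t : ℕ → ℕ) (i : ℕ) : greedy F cen w t i ⊆ Finset.range F := by
  induction i with
  | zero => simp [greedy]
  | succ i ih =>
    rcases greedy_succ (F := F) (cen := cen) (w := w) t i with ⟨h, -⟩ | ⟨s, hs, h, -⟩ <;> rw [h]
    · exact ih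
    · exact Finset.insert_subset (by simpa using hs) ih

theorem card_greedy_le (t : ℕ → ℕ) (i : ℕ) : (greedy F cen w t i).card ≤ i := by
  induction i with
  | zero => simp [greedy]
  | succ i ih =>
    rcases greedy_succ (F := F) (cen := cen) (w := w) t i with ⟨h, -⟩ | ⟨s, hs, h, -⟩ <;> rw [h]
    · omega
    · exact (Finset.card_insert_le _ _).trans (by omega)

theorem greedy_congr {t t' : ℕ → ℕ} {i : ℕ} (h : ∀ j < i, t j = t' j) :
    greedy F cen w t i = greedy F cen w t' i := by
  induction i with
  | zero => rfl
  | succ i ih => simp only [greedy, ih fun j hj => h j (by omega), h i (by omega)]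

theorem Serves.mono (h : Serves C u O b) (hOS : O ⊆ S) : Serves C u S b where
  mem c hc := hOS (h.mem c hc)
  count_le f hf := by
    by_cases hfO : f ∈ O
    · exact h.count_le f hfO
    · have : (Finset.range C).filter (fun c => b c = f) = ∅ :=
        Finset.filter_eq_empty_iff.2 fun c hc hbc => hfO (hbc ▸ h.mem c (by simpa using hc))
      simp [this]

/-- Replace an open facility by another one. -/
theorem Serves.swap (h : Serves C u S b) {f s : ℕ} (hf : f ∈ S) (hs : s ∉ S) :
    Serves C u (insert s (S.erase f)) fun c => if b c = f then s else b c where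
  mem c hc := by
    have := h.mem c hc
    split_ifs with hcf
    · simp
    · simp [hcf, this]
  count_le g hg := by
    have hbs : ∀ c < C, b c ≠ s := fun c hc hbc => hs (hbc ▸ h.mem c hc)
    rcases Finset.mem_insert.1 hg with rfl | hg
    · refine le_trans (Finset.card_le_card fun c hc => ?_) (h.count_le f hf)
      simp only [Finset.mem_filter, Finset.mem_range] at hc ⊢
      refine ⟨hc.1, ?_⟩
      by_contra hne
      rw [if_neg hne] at hc
      exact hbs c hc.1 hc.2
    · obtain ⟨hgf, hgS⟩ := Finset.mem_erase.1 hg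
      refine le_trans (Finset.card_le_card fun c hc => ?_) (h.count_le g hgS)
      simp only [Finset.mem_filter, Finset.mem_range] at hc ⊢
      refine ⟨hc.1, ?_⟩
      have h2 := hc.2
      split_ifs at h2 with hcf
      · exact absurd (h2 ▸ hgS) hs
      · exact h2

/-- Some tuple of centers leads to open facilities that are at least as good as `S`. -/
theorem exists_greedy_le {h : ℕ → ℕ → ℝ} (hm : 0 < K → 0 < m) (hcen : ∀ f < F, cen f < m)
    (hcst : ∀ c < C, ∀ f < F, cst c f = h c (cen f) + w f) (hS : S ⊆ Finset.range F)
    (hSK : S.card ≤ K) (hb : Serves C u S b) :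
    ∃ t : ℕ → ℕ, (∀ i < K, t i < m) ∧ ∃ b', Serves C u (greedy F cen w t K) b' ∧
      ∑ c ∈ Finset.range C, cst c (b' c) ≤ ∑ c ∈ Finset.range C, cst c (b c) := by
  -- Exchange argument: after `i` entries the greedy set lies in the open set `S'` of a solution no
  -- worse than the given one, with at most `K - i` facilities of `S'` still missing. At `i = K`
  -- none is missing.
  have key : ∀ i ≤ K, ∃ t : ℕ → ℕ, (∀ j < i, t j < m) ∧ ∃ S' b', Serves C u S' b' ∧
      S' ⊆ Finset.range F ∧ greedy F cen w t i ⊆ S' ∧ (S' \ greedy F cen w t i).card ≤ K - i ∧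
      ∑ c ∈ Finset.range C, cst c (b' c) ≤ ∑ c ∈ Finset.range C, cst c (b c) := by
    intro i
    induction i with
    | zero => exact fun _ => ⟨fun _ => 0, by simp, S, b, hb, hS, by simp [greedy],
        by simpa [greedy] using hSK, le_rfl⟩
    | succ i ih =>
      intro hi
      obtain ⟨t, ht, S', b', hb', hS', hOS, hcard, hcost⟩ := ih (by omega)
      have upd : ∀ x, greedy F cen w (Function.update t i x) i = greedy F cen w t i := fun x =>
        greedy_congr fun j hj => Function.update_of_ne hj.ne _ _
      have updlt : ∀ x < m, ∀ j < i + 1, Function.update t i x j < m := by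
        intro x hx j hj
        rcases Nat.lt_succ_iff_lt_or_eq.1 hj with hj | rfl
        · rw [Function.update_of_ne hj.ne]; exact ht j hj
        · simpa using hx
      set O := greedy F cen w t i with hO
      rcases (S' \ O).eq_empty_or_nonempty with hemp | ⟨f, hf⟩
      -- Everything in `S'` is already open, so any center will do as the next entry; `hm` makes 0
      -- admissible.
      · set t' := Function.update t i 0
        refine ⟨t', updlt 0 (hm (by omega)), S' ∪ greedy F cen w t' (i + 1), b',
          hb'.mono Finset.subset_union_left, Finset.union_subset hS' (greedy_subset _ _),
          Finset.subset_union_right, ?_, hcost⟩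
        have hsub : S' ⊆ greedy F cen w t' (i + 1) := by
          refine (Finset.sdiff_eq_empty_iff_subset.1 hemp).trans ?_
          rcases greedy_succ (F := F) (cen := cen) (w := w) t' i with ⟨h1, -⟩ | ⟨s, -, h1, -⟩ <;>
            rw [h1, upd]
          exact Finset.subset_insert _ _
        rw [Finset.union_eq_right.2 hsub]
        simp
      · obtain ⟨hfS, hfO⟩ := Finset.mem_sdiff.1 hf
        have hfF : f < F := by simpa using hS' hfS
        -- Name the center of a missing facility `f`; greedy then opens some `s` there with `w s ≤ w
        -- f`. If `s` is not in `S'`, it replaces `f`.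
        set t' := Function.update t i (cen f) with ht'
        have hti : t' i = cen f := by simp [ht']
        have hpos : 0 < (S' \ O).card := Finset.card_pos.2 ⟨f, hf⟩
        rcases greedy_succ (F := F) (cen := cen) (w := w) t' i with ⟨-, h1⟩ | ⟨s, hsF, h1, h2, h3, h4⟩
        · rw [upd] at h1
          exact absurd (h1 f hfF hti.symm) hfO
        rw [upd] at h1 h3 h4
        have hws := h4 f hfF hti.symm hfO
        by_cases hsS : s ∈ S'
        · refine ⟨t', updlt _ (hcen f hfF), S', b', hb', hS', ?_, ?_, hcost⟩
          · rw [h1]; exact Finset.insert_subset hsS hOS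
          · rw [h1, Finset.sdiff_insert, Finset.card_erase_of_mem (by simp [hsS, h3])]
            omega
        · refine ⟨t', updlt _ (hcen f hfF), _, _, hb'.swap hfS hsS, ?_, ?_, ?_, le_trans ?_ hcost⟩
          · exact Finset.insert_subset (by simpa using hsF)
              ((Finset.erase_subset _ _).trans hS')
          · rw [h1]
            refine Finset.insert_subset_insert _ fun g hg => Finset.mem_erase.2 ⟨?_, hOS hg⟩
            rintro rfl
            exact hfO hg
          · have : insert s (S'.erase f) \ greedy F cen w t' (i + 1) = (S' \ O).erase f := by
              rw [h1]
              ext g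
              simp only [Finset.mem_sdiff, Finset.mem_insert, Finset.mem_erase]
              constructor
              · rintro ⟨h5 | h5, h6⟩
                · exact absurd (Or.inl h5) h6
                · exact ⟨h5.1, h5.2, fun h7 => h6 (Or.inr h7)⟩
              · rintro ⟨h5, h6, h7⟩
                refine ⟨Or.inr ⟨h5, h6⟩, ?_⟩
                rintro (rfl | h8)
                · exact hsS h6
                · exact h7 h8
            rw [this, Finset.card_erase_of_mem hf]
            omega
          · refine Finset.sum_le_sum fun c hc => ?_
            have hc : c < C := by simpa using hc
            split_ifs with hcf
            -- Since `s` and `f` share their center, the cost changes by `w s - w f ≤ 0`.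
            · rw [hcf, hcst c hc s hsF, hcst c hc f hfF, h2, hti]
              linarith
            · exact le_rfl
  obtain ⟨t, ht, S', b', hb', hS', hOS, hcard, hcost⟩ := key K le_rfl
  have hsub : S' ⊆ greedy F cen w t K := by
    rw [← Finset.sdiff_eq_empty_iff_subset, ← Finset.card_eq_zero]
    omega
  exact ⟨t, ht, b', hb'.mono hsub, hcost⟩

end

/-! ## Enumerating tuples of centers -/

/-- The digits of `j` in base `m`. -/
def digits (m j i : ℕ) : ℕ := j / m ^ i % m

/-- The inverse of `finFunctionFinEquiv` is digit extraction in base `m`, definitionally the same as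
`digits`. -/
theorem exists_digits {m K : ℕ} {t : ℕ → ℕ} (ht : ∀ i < K, t i < m) :
    ∃ j < m ^ K, ∀ i < K, t i = digits m j i := by
  let g : Fin K → Fin m := fun i => ⟨t i, ht i i.2⟩
  refine ⟨finFunctionFinEquiv g, (finFunctionFinEquiv g).2, fun i hi => ?_⟩
  have h1 := congrFun (finFunctionFinEquiv.symm_apply_apply g) ⟨i, hi⟩
  exact (congrArg Fin.val h1).symm

/-- For positive `m`, `m ^ i ∣ j + 1` says that incrementing `j` sends a carry into position `i`.
This lemma and the next three are the cases of an increment: no carry arrives, the carry passes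
through, it is absorbed, it must be passed on. -/
theorem digits_succ_of_not_dvd {m j i : ℕ} (h : ¬ m ^ i ∣ j + 1) :
    digits m (j + 1) i = digits m j i := by
  rw [digits, digits, Nat.succ_div, if_neg h, add_zero]

theorem digits_succ_of_dvd {m j i : ℕ} (h : m ^ (i + 1) ∣ j + 1) : digits m (j + 1) i = 0 := by
  rw [digits]
  apply Nat.mod_eq_zero_of_dvd
  exact Nat.dvd_div_of_mul_dvd (by rwa [← pow_succ])

theorem digits_succ_eq {m j i : ℕ} (h : m ^ i ∣ j + 1) (hlt : digits m j i + 1 < m) :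
    digits m (j + 1) i = digits m j i + 1 ∧ ¬ m ^ (i + 1) ∣ j + 1 := by
  have h1 : digits m (j + 1) i = digits m j i + 1 := by
    unfold digits at hlt ⊢
    rw [Nat.succ_div, if_pos h, Nat.add_mod, Nat.mod_eq_of_lt (a := 1) (by omega),
      Nat.mod_eq_of_lt hlt]
  refine ⟨h1, fun h2 => ?_⟩
  rw [digits_succ_of_dvd h2] at h1
  omega

theorem dvd_succ_of_digits {m j i : ℕ} (hm : 0 < m) (h : m ^ i ∣ j + 1)
    (hge : m ≤ digits m j i + 1) : m ^ (i + 1) ∣ j + 1 := by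
  have h0 : digits m j i < m := Nat.mod_lt _ hm
  have h1 : m ∣ j / m ^ i + 1 := by
    unfold digits at hge h0
    have h2 := Nat.div_add_mod (j / m ^ i) m
    exact ⟨j / m ^ i / m + 1, by rw [mul_add]; omega⟩
  have h2 : (j + 1) / m ^ i = j / m ^ i + 1 := by rw [Nat.succ_div, if_pos h]
  rw [← h2] at h1
  rw [pow_succ]
  exact Nat.mul_dvd_of_dvd_div h h1

/-! ### The enumeration program -/

namespace RAM

namespace Enum

open Assignment Assign

/-- Open a facility at the center given by entry 11 of the tuple. -/
abbrev openStep : Prog :=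
  .seq (.argmin 12 13 0 (.and (.neq (.get 3 (.var 12)) (.get 4 (.var 11)))
      (.neq (.get 5 (.var 12)) (.const 0))) 1)
    (.when (.nlt (.var 13) (.var 0))
      (.seq (.putN 5 (.var 13) (.const 1)) (.setN 10 (.add (.var 10) (.const 1)))))

/-- Open facilities according to the tuple. -/
abbrev openAll : Prog :=
  .seq (.setN 10 (.const 0)) (.seq (.forLt 12 0 (.putN 5 (.var 12) (.const 0)))
    (.forLt 11 7 openStep))

/-- Compute the cost of the assignment. -/
abbrev total : Prog :=
  .seq (.setR 2 .zero) (.forLt 11 1 (.setR 2 (.add (.var 2)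
    (.get 3 (.add (.mul (.var 11) (.var 0)) (.get 7 (.var 11)))))))

/-- Store the current solution. -/
abbrev record : Prog :=
  .seq (.setR 0 (.var 2)) (.seq (.setN 9 (.const 1))
    (.seq (.forLt 11 0 (.putN 1 (.var 11) (.get 5 (.var 11))))
      (.forLt 11 1 (.putN 2 (.var 11) (.get 7 (.var 11))))))

/-- Compare the best solution for the open facilities with the best one so far. -/
abbrev evaluate : Prog :=
  .when (.nle (.var 1) (.mul (.var 10) (.var 3))) (.seq Assign.main (.seq total
    (.when (.not (.and (.neq (.var 9) (.const 1)) (.rle (.var 0) (.var 2)))) record)))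

/-- Proceed to the next tuple. -/
abbrev advance : Prog :=
  .seq (.setN 8 (.const 1)) (.forLt 11 7 (.when (.neq (.var 8) (.const 1))
    (.ite (.nlt (.add (.get 4 (.var 11)) (.const 1)) (.var 2))
      (.seq (.putN 4 (.var 11) (.add (.get 4 (.var 11)) (.const 1))) (.setN 8 (.const 0)))
      (.putN 4 (.var 11) (.const 0)))))

/-- Process a tuple. -/
abbrev body : Prog := .seq openAll (.seq evaluate advance)

variable {N B F C u m K j : ℕ} {σ : State} {cen : ℕ → ℕ} {w : ℕ → ℝ} {cst : ℕ → ℕ → ℝ}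
  {O : Finset ℕ} {V : Finset ℕ → Prop}

/-- The preprocessed instance is stored. -/
structure Ready (B F C m u K : ℕ) (cen : ℕ → ℕ) (w : ℕ → ℝ) (cst : ℕ → ℕ → ℝ) (σ : State) :
    Prop where
  numF : σ.nvar 0 = F
  numC : σ.nvar 1 = C
  numS : σ.nvar 2 = m
  unit : σ.nvar 3 = u
  numK : σ.nvar 7 = K
  cen : σ.narr 3 = cen
  weight : σ.rarr 1 = w
  cost : ∀ c f, σ.rarr 3 (c * F + f) = cst c f
  numF_le : F ≤ B
  numC_le : C ≤ B
  numK_le : K ≤ F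

theorem Ready.same (h : Ready B F C m u K cen w cst σ) {p : Prog} {τ : State} (hs : Same p σ τ)
    (hp : (p.writesN 0 || p.writesN 1 || p.writesN 2 || p.writesN 3 || p.writesN 7 ||
      p.writesNArr 3 || p.writesRArr 1 || p.writesRArr 3) = false) :
    Ready B F C m u K cen w cst τ := by
  simp only [Bool.or_eq_false_iff] at hp
  obtain ⟨⟨⟨⟨⟨⟨⟨h0, h1⟩, h2⟩, h3⟩, h7⟩, hc⟩, hw⟩, hr⟩ := hp
  exact ⟨(hs.nvar 0 h0).trans h.numF, (hs.nvar 1 h1).trans h.numC, (hs.nvar 2 h2).trans h.numS,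
    (hs.nvar 3 h3).trans h.unit, (hs.nvar 7 h7).trans h.numK, (hs.narr 3 hc).trans h.cen,
    (hs.rarr 1 hw).trans h.weight, fun c f => by rw [hs.rarr 3 hr, h.cost], h.numF_le, h.numC_le,
    h.numK_le⟩

/-- The set `O` of open facilities is stored. -/
structure Opened (F : ℕ) (O : Finset ℕ) (σ : State) : Prop where
  ind : ∀ f < F, σ.narr 5 f = if f ∈ O then 1 else 0
  card : σ.nvar 10 = O.card

/-- The selected facility is never already open, so variable 10 counts the open set exactly and
stays at most `F`. -/
theorem tri_openStep (h : Ready B F C m u K cen w cst σ) {i : ℕ} (hi : σ.nvar 11 = i)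
    (t : ℕ → ℕ) (ht : σ.narr 4 i = t i) (hO : Opened F (greedy F cen w t i) σ) :
    Tri N B openStep σ (Opened F (greedy F cen w t (i + 1))) := by
  set O := greedy F cen w t i with hOdef
  refine Tri.seq (R := fun τ => τ.nvar 13 = argmin F (fun f => cen f = t i ∧ f ∉ O) w F)
    ((Tri.argmin (P := fun f => cen f = t i ∧ σ.narr 5 f = 0) (F := F) rfl h.numF h.numF_le
      fun ρ hs => ?_).mono fun τ _ hτ => ?_) fun ρ hs hρ => ?_
  · have h3 : ρ.narr 3 = cen := (hs.narr 3 rfl).trans h.cen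
    have h4 : ρ.narr 4 = σ.narr 4 := hs.narr 4 rfl
    have h5 : ρ.narr 5 = σ.narr 5 := hs.narr 5 rfl
    have h11 : ρ.nvar 11 = i := (hs.nvar 11 rfl).trans hi
    simp only [Test.Holds, NExp.eval, h3, h4, h5, h11, ht]
    omega
  · rw [hτ, h.weight]
    refine argmin_congr _ fun f hf => ?_
    rw [hO.ind f hf]
    simp
  · have h0 : ρ.nvar 0 = F := (hs.nvar 0 rfl).trans h.numF
    have h5 : ρ.narr 5 = σ.narr 5 := hs.narr 5 rfl
    have h10 : ρ.nvar 10 = O.card := (hs.nvar 10 rfl).trans hO.card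
    have hg : greedy F cen w t (i + 1) =
        if ρ.nvar 13 < F then insert (ρ.nvar 13) O else O := by rw [hρ]; rfl
    rw [hg]
    refine Tri.ite (fun hb => ?_) (fun hb => Tri.nop ?_)
    · have hlt : ρ.nvar 13 < F := by simpa [h0] using hb
      rw [if_pos hlt]
      set s := ρ.nvar 13 with hsdef
      have hsO : s ∉ O := by
        rcases argmin_spec (F := F) (P := fun f => cen f = t i ∧ f ∉ O) (w := w) le_rfl with
          ⟨h1, -⟩ | ⟨-, h2, -⟩
        · omega
        · rw [hρ]; exact h2.2
      have hins : insert s O ⊆ Finset.range F :=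
        Finset.insert_subset (by simpa using hlt) (greedy_subset t i)
      have hcard := Finset.card_le_card hins
      rw [Finset.card_insert_of_notMem hsO, Finset.card_range] at hcard
      refine Tri.seq (R := fun τ => τ = ρ.putN 5 s 1)
        (Tri.putN (fun hσ => by have := hσ.two_le; simp; omega) (by simp [hsdef])) ?_
      rintro _ - rfl
      refine Tri.setN (fun hσ => ?_) ⟨fun f hf => ?_, ?_⟩
      · have := hσ.nvar 0
        simp [h0, h10] at this ⊢
        omega
      · by_cases hfs : f = s
        · simp [hfs]
        · simp [hfs, h5, hO.ind f hf]
      · simp [h10, Finset.card_insert_of_notMem hsO]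
    · have hlt : ¬ ρ.nvar 13 < F := by simpa [h0] using hb
      rw [if_neg hlt]
      exact ⟨by rw [h5]; exact hO.ind, h10⟩

theorem tri_openAll (h : Ready B F C m u K cen w cst σ) (t : ℕ → ℕ)
    (ht : ∀ i < K, σ.narr 4 i = t i) :
    Tri N B openAll σ (Opened F (greedy F cen w t K)) := by
  refine Tri.seq (R := fun τ => τ.nvar 10 = 0) (Tri.setN (by simp) (by simp)) ?_
  intro ρ₁ s₁ h10
  have h₁ := h.same s₁ rfl
  refine Tri.seq (R := fun τ => ∀ f < F, τ.narr 5 f = 0) ?_ ?_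
  · refine Tri.forLt (fun i τ => ∀ f < i, τ.narr 5 f = 0) h₁.numF h₁.numF_le rfl
      (fun _ _ _ h => h) (by simp) ?_ fun _ _ h => h
    intro i hi ρ hs hx hI
    refine Tri.putN (by simp) fun f hf => ?_
    rcases Nat.lt_succ_iff_lt_or_eq.1 hf with hf | rfl
    · simpa [hx, hf.ne] using hI f hf
    · simp [hx]
  intro ρ₂ s₂ h5
  have h₂ := h₁.same s₂ rfl
  have hKB := h.numK_le.trans h.numF_le
  refine Tri.forLt (fun i τ => Opened F (greedy F cen w t i) τ) h₂.numK hKB rfl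
    (fun _ _ _ h => ⟨h.ind, h.card⟩) ⟨by simpa [greedy] using h5, ?_⟩ ?_ fun _ _ h => h
  · rw [s₂.nvar 10 rfl, h10]; simp [greedy]
  · intro i hi ρ₃ s₃ hx hI
    refine tri_openStep (h₂.same s₃ rfl) hx t ?_ hI
    rw [s₃.narr 4 rfl, s₂.narr 4 rfl, s₁.narr 4 rfl, ht i hi]

/-- The best solution among those whose set of open facilities satisfies `V` is stored. -/
structure Best (F C u K : ℕ) (cst : ℕ → ℕ → ℝ) (V : Finset ℕ → Prop) (σ : State) : Prop where
  le : ∀ O, V O → ∀ b, Serves C u O b → σ.nvar 9 = 1 ∧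
    σ.rvar 0 ≤ ∑ c ∈ Finset.range C, cst c (b c)
  sound : σ.nvar 9 = 0 ∨ σ.nvar 9 = 1 ∧ ∃ O ⊆ Finset.range F, O.card ≤ K ∧
    Serves C u O (σ.narr 2) ∧ (∀ f < F, σ.narr 1 f = if f ∈ O then 1 else 0) ∧
    σ.rvar 0 = ∑ c ∈ Finset.range C, cst c (σ.narr 2 c)

theorem Best.same (h : Best F C u K cst V σ) {p : Prog} {τ : State} (hs : Same p σ τ)
    (hp : (p.writesN 9 || p.writesNArr 1 || p.writesNArr 2 || p.writesR 0) = false) :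
    Best F C u K cst V τ := by
  simp only [Bool.or_eq_false_iff] at hp
  obtain ⟨⟨⟨h9, h1⟩, h2⟩, h0⟩ := hp
  have e9 := hs.nvar 9 h9
  have e0 := hs.rvar 0 h0
  have e1 := hs.narr 1 h1
  have e2 := hs.narr 2 h2
  exact ⟨by rw [e9, e0]; exact h.le, by rw [e9, e0, e1, e2]; exact h.sound⟩

/-- A closed facility is treated as one of capacity `0 * u`, so the assignment program always runs
over all `F` facilities. -/
theorem feasible_iff_serves (hO : O ⊆ Finset.range F) {op b : ℕ → ℕ}
    (hop : ∀ f < F, op f = if f ∈ O then 1 else 0) :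
    Feasible F C (caps op u) b ↔ Serves C u O b := by
  constructor
  · intro h
    refine ⟨fun c hc => ?_, fun f hf => ?_⟩
    · by_contra hn
      have h1 := h.count_le (b c) (h.lt c hc)
      rw [caps, hop _ (h.lt c hc), if_neg hn, zero_mul, Nat.le_zero, Finset.card_eq_zero,
        Finset.filter_eq_empty_iff] at h1
      exact h1 (by simpa using hc) rfl
    · have hfF : f < F := by simpa using hO hf
      simpa [caps, hop f hfF, hf] using h.count_le f hfF
  · intro h
    refine ⟨fun c hc => by simpa using hO (h.mem c hc), fun f hf => ?_⟩
    by_cases hfO : f ∈ O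
    · simpa [caps, hop f hf, hfO] using h.count_le f hfO
    · have : (Finset.range C).filter (fun c => b c = f) = ∅ :=
        Finset.filter_eq_empty_iff.2 fun c hc hbc => hfO (hbc ▸ h.mem c (by simpa using hc))
      simp [this]

/-- Counting clients by facility; this justifies skipping a set of too small total capacity. -/
theorem _root_.Serves.card_le {b : ℕ → ℕ} (h : Serves C u O b) : C ≤ O.card * u := by
  have h1 := Finset.card_eq_sum_card_fiberwise (s := Finset.range C) (t := O) (f := b)
    (fun c hc => h.mem c (by simpa using hc))
  rw [Finset.card_range] at h1
  rw [h1]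
  exact (Finset.sum_le_card_nsmul _ _ _ h.count_le).trans (by simp)

theorem sum_caps (hO : O ⊆ Finset.range F) {op : ℕ → ℕ}
    (hop : ∀ f < F, op f = if f ∈ O then 1 else 0) :
    ∑ f ∈ Finset.range F, caps op u f = O.card * u := by
  rw [← Finset.sum_mul, Finset.sum_congr rfl fun f hf => hop f (by simpa using hf),
    Finset.sum_ite_mem, Finset.inter_eq_right.2 hO]
  simp

theorem tri_total (h : Ready B F C m u K cen w cst σ) :
    Tri N B total σ fun τ => τ.rvar 2 = ∑ c ∈ Finset.range C, cst c (σ.narr 7 c) := by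
  refine Tri.seq (R := fun τ => τ.rvar 2 = 0) (Tri.setR (by simp)) fun ρ s₁ h2 => ?_
  have h₁ := h.same s₁ rfl
  refine Tri.forLt (fun i τ => τ.rvar 2 = ∑ c ∈ Finset.range i, cst c (σ.narr 7 c)) h₁.numC
    h₁.numC_le rfl (fun _ _ _ h => h) (by simp [h2]) ?_ fun _ _ h => h
  intro i hi ρ' s₂ hx hI
  have h₂ := h₁.same s₂ rfl
  have h7 : ρ'.narr 7 = σ.narr 7 := (s₂.narr 7 rfl).trans (s₁.narr 7 rfl)
  exact Tri.setR (by simp [hI, hx, h₂.numF, h₂.cost, h7, Finset.sum_range_succ])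

theorem tri_record (h : Ready B F C m u K cen w cst σ) :
    Tri N B record σ fun τ => τ.nvar 9 = 1 ∧ τ.rvar 0 = σ.rvar 2 ∧
      (∀ f < F, τ.narr 1 f = σ.narr 5 f) ∧ ∀ c < C, τ.narr 2 c = σ.narr 7 c := by
  refine Tri.seq (R := fun τ => τ.rvar 0 = σ.rvar 2) (Tri.setR (by simp)) fun ρ₁ s₁ h0 => ?_
  refine Tri.seq (R := fun τ => τ.nvar 9 = 1)
    (Tri.setN (fun hσ => by have := hσ.two_le; simp; omega) (by simp)) fun ρ₂ s₂ h9 => ?_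
  have h₂ := (h.same s₁ rfl).same s₂ rfl
  refine Tri.seq (R := fun τ => ∀ f < F, τ.narr 1 f = ρ₂.narr 5 f) ?_ fun ρ₃ s₃ h1 => ?_
  · refine Tri.forLt (fun i τ => ∀ f < i, τ.narr 1 f = ρ₂.narr 5 f) h₂.numF h₂.numF_le rfl
      (fun _ _ _ h => h) (by simp) ?_ fun _ _ h => h
    intro i hi ρ hs hx hI
    refine Tri.putN (fun hσ => hσ.narr 5 _) fun f hf => ?_
    rcases Nat.lt_succ_iff_lt_or_eq.1 hf with hf | rfl
    · simpa [hx, hf.ne] using hI f hf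
    · simp [hx, hs.narr 5 rfl]
  have h₃ := h₂.same s₃ rfl
  refine Tri.forLt (fun i τ => ∀ c < i, τ.narr 2 c = ρ₃.narr 7 c) h₃.numC h₃.numC_le rfl
      (fun _ _ _ h => h) (by simp) ?_ fun τ s₄ h2 => ⟨?_, ?_, fun f hf => ?_, fun c hc => ?_⟩
  · intro i hi ρ hs hx hI
    refine Tri.putN (fun hσ => hσ.narr 7 _) fun f hf => ?_
    rcases Nat.lt_succ_iff_lt_or_eq.1 hf with hf | rfl
    · simpa [hx, hf.ne] using hI f hf
    · simp [hx, hs.narr 7 rfl]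
  · rw [s₄.nvar 9 rfl, s₃.nvar 9 rfl, h9]
  · rw [s₄.rvar 0 rfl, s₃.rvar 0 rfl, s₂.rvar 0 rfl, h0]
  · rw [s₄.narr 1 rfl, h1 f hf, s₂.narr 5 rfl, s₁.narr 5 rfl]
  · rw [h2 c hc, s₃.narr 7 rfl, s₂.narr 7 rfl, s₁.narr 7 rfl]

/-- If the capacity of `O` is below `C`, nobody serves the clients from `O` and the record stays
valid; otherwise the assignment program applies. The record is replaced when it is empty or strictly
worse. -/
theorem tri_evaluate (h : Ready B F C m u K cen w cst σ) (hO : O ⊆ Finset.range F)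
    (hOK : O.card ≤ K) (hop : Opened F O σ) (hbest : Best F C u K cst V σ) :
    Tri N B evaluate σ (Best F C u K cst fun O' => V O' ∨ O' = O) := by
  refine Tri.ite (fun hb => ?_) (fun hb => Tri.nop ⟨?_, hbest.sound⟩)
  swap
  · rintro O' (hV | rfl) b hS
    · exact hbest.le O' hV b hS
    · refine absurd hS.card_le ?_
      simpa [h.numC, h.unit, hop.card] using hb
  have hb' : C ≤ O.card * u := by simpa [h.numC, h.unit, hop.card] using hb
  refine Tri.seq (Assign.tri_main (op := σ.narr 5) ⟨h.numF, h.numC, h.unit, rfl, h.cost, h.numF_le,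
    h.numC_le⟩ (by rwa [sum_caps hO hop.ind])) ?_
  rintro ρ₁ s₁ ⟨a₁, a₂⟩
  simp only [feasible_iff_serves hO hop.ind] at a₁ a₂
  have h₁ := h.same s₁ rfl
  refine Tri.seq (tri_total h₁) fun ρ₂ s₂ htot => ?_
  have h₂ := h₁.same s₂ rfl
  have hbest₂ := (hbest.same s₁ rfl).same s₂ rfl
  have e7 : ρ₂.narr 7 = ρ₁.narr 7 := s₂.narr 7 rfl
  have e5 : ρ₂.narr 5 = σ.narr 5 := (s₂.narr 5 rfl).trans (s₁.narr 5 rfl)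
  refine Tri.ite (fun hc => ?_) (fun hc => Tri.nop ⟨?_, hbest₂.sound⟩)
  · refine (tri_record h₂).mono ?_
    rintro τ - ⟨h9, h0, h1, h2⟩
    have hsum : ∑ c ∈ Finset.range C, cst c (τ.narr 2 c) =
        ∑ c ∈ Finset.range C, cst c (ρ₁.narr 7 c) :=
      Finset.sum_congr rfl fun c hc => by rw [h2 c (by simpa using hc), e7]
    refine ⟨?_, Or.inr ⟨h9, O, hO, hOK, ⟨fun c hc => ?_, fun f hf => ?_⟩, fun f hf => ?_, ?_⟩⟩
    · rintro O' (hV | rfl) b hS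
      · refine ⟨h9, ?_⟩
        obtain ⟨k1, k2⟩ := hbest₂.le O' hV b hS
        have hc' : ρ₂.rvar 2 < ρ₂.rvar 0 := by simpa [k1] using hc
        rw [h0]
        linarith
      · exact ⟨h9, by rw [h0, htot]; exact a₂ b hS⟩
    · rw [h2 c hc, e7]; exact a₁.mem c hc
    · rw [Finset.filter_congr fun c hc => by rw [h2 c (by simpa using hc), e7]]
      exact a₁.count_le f hf
    · rw [h1 f hf, e5, hop.ind f hf]
    · rw [h0, htot, hsum]
  · have hc' : ρ₂.nvar 9 = 1 ∧ ρ₂.rvar 0 ≤ ρ₂.rvar 2 := by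
      simp only [Test.Holds, NExp.eval, RExp.eval, not_not] at hc
      exact ⟨by omega, hc.2⟩
    rintro O' (hV | rfl) b hS
    · exact hbest₂.le O' hV b hS
    · refine ⟨hc'.1, hc'.2.trans ?_⟩
      rw [htot]
      exact a₂ b hS

/-- Variable 8 is the carry of a base-`m` increment of the tuple. It survives all `K` positions only
if `m ^ K ∣ j + 1`, that is, if `j` was the last tuple; so it doubles as the stop flag. -/
theorem tri_advance (h : Ready B F C m u K cen w cst σ) (hm : 0 < K → 0 < m)
    (ht : ∀ i < K, σ.narr 4 i = digits m j i) (hj : j < m ^ K) :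
    Tri N B advance σ fun τ =>
      (j + 1 < m ^ K → τ.nvar 8 = 0 ∧ ∀ i < K, τ.narr 4 i = digits m (j + 1) i) ∧
      (j + 1 = m ^ K → τ.nvar 8 = 1) := by
  refine Tri.seq (R := fun τ => τ.nvar 8 = 1)
    (Tri.setN (fun hσ => by have := hσ.two_le; simp; omega) (by simp)) fun ρ₁ s₁ h8 => ?_
  have h₁ := h.same s₁ rfl
  have hKB := h.numK_le.trans h.numF_le
  refine Tri.forLt (fun i τ =>
    (τ.nvar 8 = 1 ∧ m ^ i ∣ j + 1 ∧ ∀ i' < K, τ.narr 4 i' = if i' < i then 0 else digits m j i') ∨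
    (τ.nvar 8 = 0 ∧ ¬ m ^ K ∣ j + 1 ∧ ∀ i' < K, τ.narr 4 i' = digits m (j + 1) i'))
    h₁.numK hKB rfl (fun _ _ _ h => h) (Or.inl ⟨h8, by simp, ?_⟩) ?_ ?_
  · intro i hi
    rw [s₁.narr 4 rfl, ht i hi]
    simp
  · intro i hi ρ s₂ hx hI
    have h₂ := h₁.same s₂ rfl
    have hm0 := hm (by omega)
    refine Tri.ite (fun hb => ?_) (fun hb => Tri.nop ?_)
    · rcases hI with ⟨-, hd, hI⟩ | ⟨h0, -⟩
      swap
      · simp [h0] at hb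
      have hti : ρ.narr 4 i = digits m j i := by simpa using hI i hi
      refine Tri.ite (fun hc => ?_) (fun hc => ?_)
      · have hc' : digits m j i + 1 < m := by simpa [hx, h₂.numS, hti] using hc
        obtain ⟨d1, d2⟩ := digits_succ_eq hd hc'
        refine Tri.seq (R := fun τ => τ = ρ.putN 4 i (digits m j i + 1))
          (Tri.putN (fun hσ => ?_) (by simp [hx, hti])) ?_
        · have := hσ.nvar 2
          simp [hx, hti, h₂.numS] at this ⊢
          omega
        rintro _ - rfl
        refine Tri.setN (by simp) (Or.inr ⟨by simp, fun hd' => d2 ?_, fun i' hi' => ?_⟩)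
        · exact (pow_dvd_pow m hi).trans hd'
        · rcases lt_trichotomy i' i with hlt | rfl | hgt
          · simp [hlt.ne, hI i' hi', hlt]
            exact (digits_succ_of_dvd ((pow_dvd_pow m hlt).trans hd)).symm
          · simp [d1]
          · simp [hgt.ne', hI i' hi', hgt.not_gt]
            exact (digits_succ_of_not_dvd fun hd' => d2 ((pow_dvd_pow m hgt).trans hd')).symm
      · have hc' : m ≤ digits m j i + 1 := by simpa [hx, h₂.numS, hti] using hc
        refine Tri.putN (by simp) (Or.inl ⟨?_, dvd_succ_of_digits hm0 hd hc', fun i' hi' => ?_⟩)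
        · simp at hb ⊢; omega
        · rcases lt_trichotomy i' i with hlt | rfl | hgt
          · simp [hx, hlt.ne, hI i' hi', hlt, Nat.lt_succ_of_lt hlt]
          · simp [hx]
          · simp [hx, hgt.ne', hI i' hi', hgt.not_gt, Nat.not_lt.2 hgt]
    · rcases hI with ⟨h1, -⟩ | hI
      · simp [h1] at hb
      · exact Or.inr hI
  · rintro τ - (⟨h1, h2, -⟩ | ⟨h1, h2, h3⟩)
    · have := Nat.le_of_dvd (Nat.succ_pos j) h2
      exact ⟨fun h => by omega, fun _ => h1⟩
    · exact ⟨fun _ => ⟨h1, h3⟩, fun h => absurd (h ▸ dvd_rfl) h2⟩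

/-- The invariant of the enumeration. -/
structure Progress (F C m u K : ℕ) (cen : ℕ → ℕ) (w : ℕ → ℝ) (cst : ℕ → ℕ → ℝ) (j : ℕ)
    (σ : State) : Prop where
  best : Best F C u K cst (fun O => ∃ j' < j, O = greedy F cen w (digits m j') K) σ
  active : j < m ^ K → σ.nvar 8 = 0 ∧ ∀ i < K, σ.narr 4 i = digits m j i
  done : j = m ^ K → σ.nvar 8 = 1

theorem tri_body (h : Ready B F C m u K cen w cst σ) (hm : 0 < K → 0 < m) (hj : j < m ^ K)
    (hI : Progress F C m u K cen w cst j σ) :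
    Tri N B body σ (Progress F C m u K cen w cst (j + 1)) := by
  obtain ⟨-, ht⟩ := hI.active hj
  refine Tri.seq (tri_openAll h _ ht) fun ρ₁ s₁ h₁ => ?_
  refine Tri.seq (tri_evaluate (h.same s₁ rfl) (greedy_subset _ _) (card_greedy_le _ _) h₁
    (hI.best.same s₁ rfl)) fun ρ₂ s₂ h₂ => ?_
  refine (tri_advance ((h.same s₁ rfl).same s₂ rfl) hm (fun i hi => ?_) hj).mono
    fun τ s₃ h₃ => ⟨?_, h₃.1, h₃.2⟩
  · rw [s₂.narr 4 rfl, s₁.narr 4 rfl, ht i hi]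
  · have h₄ := h₂.same s₃ rfl
    refine ⟨?_, h₄.sound⟩
    rintro O ⟨j', hj', rfl⟩
    refine h₄.le _ ?_
    rcases Nat.lt_succ_iff_lt_or_eq.1 hj' with hlt | rfl
    · exact Or.inl ⟨j', hlt, rfl⟩
    · exact Or.inr rfl

end Enum

end RAM

/-! ## Solutions and the final theorem -/

namespace CKM

variable {I : CKM} {u m : ℕ}

theorem card_range_eq_card_fin {n : ℕ} (p : ℕ → Prop) [DecidablePred p] :
    ((Finset.range n).filter p).card = (Finset.univ.filter fun c : Fin n => p c).card := by
  rw [Finset.card_filter, Finset.card_filter, Finset.sum_range]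

theorem IsFeasible.exists_serves (hu : I.IsUniform u) {s : I.Sol} (hs : I.IsFeasible s)
    {cst : ℕ → ℕ → ℝ}
    (hcst : ∀ (c : Fin I.numC) (f : Fin I.numF), cst c f = I.dist (.inr c) (.inl f)) :
    ∃ O ⊆ Finset.range I.numF, O.card ≤ min I.k I.numF ∧ ∃ b, Serves I.numC u O b ∧
      ∑ c ∈ Finset.range I.numC, cst c (b c) = I.cost s := by
  obtain ⟨h1, h2, h3⟩ := hs
  have hO : s.opened.map Fin.valEmbedding ⊆ Finset.range I.numF := by
    intro f hf
    obtain ⟨f', -, rfl⟩ := Finset.mem_map.1 hf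
    simp
  set b : ℕ → ℕ := fun c => if h : c < I.numC then s.assign ⟨c, h⟩ else 0 with hb
  have hbc : ∀ c : Fin I.numC, b c = s.assign c := fun c => by simp [hb]
  refine ⟨_, hO, le_min (by simpa using h1) (by simpa using Finset.card_le_card hO), b,
    ⟨fun c hc => ?_, fun f hf => ?_⟩, ?_⟩
  · rw [hbc ⟨c, hc⟩]
    exact Finset.mem_map_of_mem _ (h2 _)
  · obtain ⟨f', hf', rfl⟩ := Finset.mem_map.1 hf
    have := h3 f' hf'
    rw [hu f'] at this
    rw [card_range_eq_card_fin]
    simpa [hbc, Fin.ext_iff] using this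
  · rw [Finset.sum_range]
    exact Finset.sum_congr rfl fun c _ => by rw [hbc, hcst]

theorem exists_sol_of_serves (hu : I.IsUniform u) {O : Finset ℕ} (hO : O ⊆ Finset.range I.numF)
    (hk : O.card ≤ I.k) {b : ℕ → ℕ} (hb : Serves I.numC u O b) {cst : ℕ → ℕ → ℝ}
    (hcst : ∀ (c : Fin I.numC) (f : Fin I.numF), cst c f = I.dist (.inr c) (.inl f)) :
    ∃ s : I.Sol, I.IsFeasible s ∧ I.cost s = ∑ c ∈ Finset.range I.numC, cst c (b c) ∧
      (∀ f, f ∈ s.opened ↔ (f : ℕ) ∈ O) ∧ ∀ c : Fin I.numC, b c = s.assign c := by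
  have hlt : ∀ c : Fin I.numC, b c < I.numF := fun c => by simpa using hO (hb.mem c c.2)
  refine ⟨⟨Finset.univ.filter fun f => (f : ℕ) ∈ O, fun c => ⟨b c, hlt c⟩⟩, ⟨?_, ?_, ?_⟩, ?_, ?_, ?_⟩
  · refine le_trans ?_ hk
    rw [← Finset.card_map Fin.valEmbedding]
    refine Finset.card_le_card fun f hf => ?_
    obtain ⟨f', hf', rfl⟩ := Finset.mem_map.1 hf
    simpa using hf'
  · intro c
    simpa using hb.mem c c.2
  · intro f hf
    have hfO : (f : ℕ) ∈ O := by simpa using hf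
    have := hb.count_le f hfO
    rw [card_range_eq_card_fin] at this
    rw [hu f]
    simpa [Fin.ext_iff] using this
  · rw [Finset.sum_range]
    exact Finset.sum_congr rfl fun c _ => by rw [← hcst]
  · intro f; simp
  · intro c; rfl

theorem flatten_le_one (M : I.Point ⊕ Fin m → I.Point ⊕ Fin m → ℕ) (hM : ∀ x y, M x y ≤ 1)
    (j : ℕ) : I.flatten M j ≤ 1 := by
  by_cases h : ∃ x y : I.Point ⊕ Fin m, I.code x * I.size m + I.code y = j
  · obtain ⟨x, y, rfl⟩ := h
    rw [flatten_code]
    exact hM x y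
  · push Not at h
    simp [flatten, h]

theorem input_bdd (I : CKM) (u : ℕ) (G : WGraph (I.Point ⊕ Fin m)) :
    (I.input u G).Bdd (I.size m + u + I.k + 2) where
  two_le := by omega
  nvar x := by
    simp only [input, size]
    split_ifs <;> omega
  narr a i := by
    simp only [input]
    split_ifs
    · exact (flatten_le_one _ (fun x y => by split_ifs <;> simp) i).trans (by omega)
    · simp

/-- Every number below the number of points is the code of a point. -/
theorem exists_code_eq (I : CKM) (m : ℕ) {v : ℕ} (hv : v < I.numF + I.numC) :
    ∃ x : I.Point, I.code (m := m) (.inl x) = v := by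
  by_cases h : v < I.numF
  · exact ⟨.inl ⟨v, h⟩, rfl⟩
  · exact ⟨.inr ⟨v - I.numF, by omega⟩, by simp [code]; omega⟩

theorem code_inl_lt (I : CKM) (x : I.Point) :
    I.code (m := m) (.inl x) < I.numF + I.numC := by
  rcases x with f | c <;> simp only [code]
  · have := f.2; omega
  · have := c.2; omega

end CKM

open RAM in
/-- What the preprocessing computes. -/
theorem CKM.tri_prep {I : CKM} {u ℓ m : ℕ} {G : WGraph (I.Point ⊕ Fin m)}
    (hG : I.IsCenteredBy ℓ G) :
    Tri (I.size m + u + I.k + 2) (I.size m) Prep.main (I.input u G) fun τ =>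
      τ.nvar 7 = min I.k I.numF ∧ (∀ f < I.numF, τ.narr 3 f < m) ∧
      (∃ h : ℕ → ℕ → ℝ, ∀ c < I.numC, ∀ f < I.numF, τ.rarr 3 (c * I.numF + f) =
        h c (τ.narr 3 f) + τ.rarr 1 f) ∧
      ∀ (c : Fin I.numC) (f : Fin I.numF),
        τ.rarr 3 (c * I.numF + f) = I.dist (.inr c) (.inl f) := by
  classical
  obtain ⟨-, hclique, hleaf, hdist⟩ := hG
  choose cen' hcen' using hleaf
  choose pt hpt using fun v (hv : v < I.numF + I.numC) => I.exists_code_eq m hv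
  -- The value 0 outside the vertex numbers of points is never used.
  set cen : ℕ → ℕ := fun v => if hv : v < I.numF + I.numC then cen' (pt v hv) else 0 with hcdef
  have hcen : ∀ x : I.Point, cen (I.code (m := m) (.inl x)) = cen' x := by
    intro x
    have hx := I.code_inl_lt (m := m) x
    have : pt _ hx = x := Sum.inl_injective (I.code_injective (hpt _ hx))
    simp only [hcdef, dif_pos hx, this]
  have hcode : ∀ v < I.numF + I.numC, ∃ x : I.Point, I.code (m := m) (.inl x) = v := fun v hv =>
    I.exists_code_eq m hv
  have hadj : ∀ x, G.graph.Adj (.inl x) (.inr (cen' x)) := fun x => (hcen' x _).2 rfl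
  set σ := I.input u G with hσ
  have hn0 : ∀ x y : I.Point ⊕ Fin m, σ.narr 0 (I.code x * (I.numF + I.numC + m) + I.code y) =
      if G.graph.Adj x y then 1 else 0 := fun x y => by
    rw [hσ]
    simp only [input, if_true]
    rw [← size, flatten_code]
  have hr0 : ∀ x y : I.Point ⊕ Fin m, σ.rarr 0 (I.code x * (I.numF + I.numC + m) + I.code y) =
      if G.graph.Adj x y then (G.weight s(x, y) : ℝ) else 0 := fun x y => by
    rw [hσ]
    simp only [input, if_true]
    rw [← size, flatten_code]
  have hmat : ∀ s t : Fin m, Prep.mat (I.numF + I.numC) m σ s t =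
      if G.graph.Adj (.inr s) (.inr t) then (G.weight s(.inr s, .inr t) : ℝ) else 0 :=
    fun s t => hr0 (.inr s) (.inr t)
  set w : ℕ → ℝ := fun v => σ.rarr 0 (v * (I.numF + I.numC + m) + (I.numF + I.numC + cen v))
    with hw
  have hwx : ∀ x : I.Point, w (I.code (m := m) (.inl x)) =
      G.weight s(.inl x, .inr (cen' x)) := by
    intro x
    have := hr0 (.inl x) (.inr (cen' x))
    rw [if_pos (hadj x)] at this
    rw [← this]
    simp only [hw, hcen]
    rfl
  refine (Prep.tri_main (F := I.numF) (C := I.numC) (m := m) (k := I.k) (cen := cen) (w := w)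
    (W := Prep.mat (I.numF + I.numC) m σ)
    -- Realized means that some walk is no longer than `x`; such bounds add under concatenation, and
    -- an upper bound is all that `WGraph.dist_point` needs.
    (Rz := fun i j x => ∀ (hi : i < m) (hj : j < m),
      ∃ p : G.graph.Walk (.inr ⟨i, hi⟩) (.inr ⟨j, hj⟩), (G.length p : ℝ) ≤ x)
    rfl rfl rfl rfl le_rfl (by simp only [size]; omega) ?_ ?_ ?_ ?_ (fun v _ => rfl)).mono ?_
  · intro v hv
    obtain ⟨x, rfl⟩ := hcode v hv
    rw [hcen]
    exact (cen' x).2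
  · intro v hv s hs
    obtain ⟨x, rfl⟩ := hcode v hv
    rw [hcen]
    refine (hn0 (.inl x) (.inr ⟨s, hs⟩)).trans (if_congr ?_ rfl rfl)
    rw [hcen']
    simp [Fin.ext_iff]
  · rintro i hi k hk j hj x x' h1 h2 - -
    obtain ⟨p, hp⟩ := h1 hi hk
    obtain ⟨q, hq⟩ := h2 hk hj
    refine ⟨p.append q, ?_⟩
    rw [WGraph.length_append]
    push_cast
    linarith
  · refine ⟨fun i hi j hj => ?_, fun i hi => ?_, fun _ _ _ _ => le_rfl, fun i _ j _ hi hj => ?_,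
      by simp⟩
    · rw [hmat ⟨i, hi⟩ ⟨j, hj⟩]
      split_ifs
      · exact NNReal.coe_nonneg _
      · exact le_rfl
    · rw [hmat ⟨i, hi⟩ ⟨i, hi⟩, if_neg (G.graph.irrefl)]
    · by_cases hij : i = j
      · subst hij
        refine ⟨.nil, ?_⟩
        rw [hmat ⟨i, hi⟩ ⟨i, hi⟩, if_neg (G.graph.irrefl)]
        simp
      -- Non-edges are stored as 0, which would be wrong off the diagonal; the clique hypothesis
      -- rules them out there.
      · have ha := hclique ⟨i, hi⟩ ⟨j, hj⟩ (by simpa using hij)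
        refine ⟨.cons ha .nil, ?_⟩
        rw [hmat ⟨i, hi⟩ ⟨j, hj⟩, if_pos ha]
        simp
  · rintro τ - ⟨h7, hf, D, hD, hcost⟩
    have hcen_lt : ∀ x : I.Point, cen (I.code (m := m) (.inl x)) < m := fun x => by
      rw [hcen]; exact (cen' x).2
    refine ⟨h7, fun f hfF => ?_, ⟨fun c g => w (I.numF + c) + D (cen (I.numF + c)) g,
      fun c hc f hfF => ?_⟩, fun c f => ?_⟩
    · rw [(hf f hfF).1]
      exact hcen_lt (.inl ⟨f, hfF⟩)
    · rw [hcost c hc f hfF, (hf f hfF).1, (hf f hfF).2]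
    · have key := G.dist_point cen' hcen' (fun s t => D s t) (fun s => hD.self s s.2)
        (fun s t r => hD.triangle t t.2 s s.2 r r.2)
        (fun s t hst => by
          have := hD.le s s.2 t t.2
          rwa [hmat, if_pos hst] at this)
        (fun s t => hD.realized s s.2 t t.2 s.2 t.2)
        (x := .inr c) (y := .inl f) (by simp)
      rw [hdist, key, hcost c c.2 f f.2, ← hwx, ← hwx, ← hcen, ← hcen]
      rfl

open RAM in
/-- The result of the enumeration solves the instance. -/
theorem CKM.solved_of_best {I : CKM} {u m : ℕ} (hu : I.IsUniform u) {cen : ℕ → ℕ} {w : ℕ → ℝ}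
    {cst h : ℕ → ℕ → ℝ} (hm : 0 < min I.k I.numF → 0 < m) (hcen : ∀ f < I.numF, cen f < m)
    (hh : ∀ c < I.numC, ∀ f < I.numF, cst c f = h c (cen f) + w f)
    (hcst : ∀ (c : Fin I.numC) (f : Fin I.numF), cst c f = I.dist (.inr c) (.inl f)) {σ : State}
    (hb : Enum.Best I.numF I.numC u (min I.k I.numF) cst
      (fun O => ∃ j < m ^ min I.k I.numF,
        O = greedy I.numF cen w (digits m j) (min I.k I.numF)) σ) :
    I.Solved (σ.setN 0 (σ.nvar 9)) := by
  -- Every feasible solution is dominated by the greedy set of some tuple, and every tuple is the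
  -- digit sequence of an enumerated number.
  have hle : ∀ s, I.IsFeasible s → σ.nvar 9 = 1 ∧ σ.rvar 0 ≤ I.cost s := by
    intro s hs
    obtain ⟨O, hO, hOK, b, hbS, hcost⟩ := hs.exists_serves hu hcst
    obtain ⟨t, ht, b', hb', hle⟩ := exists_greedy_le hm hcen hh hO hOK hbS
    obtain ⟨j, hj, hjt⟩ := exists_digits ht
    obtain ⟨h1, h2⟩ := hb.le _ ⟨j, hj, rfl⟩ b' (by rwa [← greedy_congr hjt])
    exact ⟨h1, by linarith⟩
  refine ⟨?_, fun hno => ?_⟩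
  · rintro ⟨s₀, hs₀⟩
    have h9 := (hle s₀ hs₀).1
    refine ⟨by simp [h9], ?_⟩
    rcases hb.sound with h0 | ⟨-, O, hO, hOK, hS, h1, h2⟩
    · omega
    obtain ⟨s, hs, hcost, hopen, hassign⟩ :=
      exists_sol_of_serves hu hO (hOK.trans (min_le_left _ _)) hS hcst
    refine ⟨s, ⟨hs, fun s' hs' => ?_⟩, fun f => ?_, hassign⟩
    · rw [hcost, ← h2]
      exact (hle s' hs').2
    · exact (h1 f f.2).trans (if_congr (hopen f).symm rfl rfl)
  · rcases hb.sound with h0 | ⟨-, O, hO, hOK, hS, -⟩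
    · simp [h0]
    · obtain ⟨s, hs, -⟩ := exists_sol_of_serves hu hO (hOK.trans (min_le_left _ _)) hS hcst
      exact absurd ⟨s, hs⟩ hno

theorem mainTheorem4 :
    ∃ (p : RAM.Prog) (A : ℕ),
      ∀ (I : CKM) (u ℓ m : ℕ) (G : WGraph (I.Point ⊕ Fin m)),
        1 ≤ ℓ → I.IsUniform u → I.IsCenteredBy ℓ G →
        ∃ (t : ℕ) (τ : RAM.State),
          RAM.Exec ((I.size m + u + I.k + 2) ^ A) p (I.input u G) t τ ∧
          t ≤ A * ℓ ^ I.k * (I.size m + 1) ^ A ∧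
          I.Solved τ := by
  obtain ⟨P, hP⟩ : ∃ P, P = RAM.Prep.main := ⟨_, rfl⟩
  obtain ⟨E, hE⟩ : ∃ E, E = RAM.Enum.body := ⟨_, rfl⟩
  -- Variable 0 holds the number of facilities during the run, so success is flagged in variable 9
  -- and copied at the end.
  refine ⟨.seq P (.seq (.loop (.neq (.var 8) (.const 0)) E) (.setN 0 (.var 9))),
    -- Weights (2 for the loop test) bound the exponent of the words, sizes the time factor, depths
    -- the exponent of the time. The constant 20 covers the 18 units charged to the outer loop tests
    -- and the final assignment.
    P.weight + E.weight + 2 + (P.size + E.size + 20) + (P.depth + E.depth), ?_⟩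
  intro I u ℓ m G hℓ hu hG
  set N := I.size m + u + I.k + 2 with hN
  set B := I.size m with hB
  -- As `k` may exceed the number of vertices, tuples are cut to length at most `numF`, so that
  -- loops over their entries are bounded by `B`.
  set K := min I.k I.numF with hK
  have hm : 0 < K → 0 < m := by
    intro h0
    obtain ⟨s, -⟩ := hG.2.2.1 (.inl ⟨0, by omega⟩)
    exact s.pos
  have hbdd := I.input_bdd u G
  have hW : ∀ a ≤ P.weight + E.weight + 2 + (P.size + E.size + 20) + (P.depth + E.depth),
      N ^ a ≤ N ^ (P.weight + E.weight + 2 + (P.size + E.size + 20) + (P.depth + E.depth)) :=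
    fun a ha => Nat.pow_le_pow_right (by omega) ha
  have hprep := I.tri_prep (u := u) hG
  rw [← hP] at hprep
  obtain ⟨t₁, ρ, e₁, l₁, b₁, h7, hcen, ⟨h, hh⟩, hdist⟩ := hprep hbdd _ (hW _ (by omega))
  have hs := e₁.same
  rw [hP] at hs
  have hready : RAM.Enum.Ready B I.numF I.numC m u K (ρ.narr 3) (ρ.rarr 1)
      (fun c f => ρ.rarr 3 (c * I.numF + f)) ρ :=
    ⟨hs.nvar 0 rfl, hs.nvar 1 rfl, hs.nvar 2 rfl, hs.nvar 3 rfl, h7, rfl, rfl, fun _ _ => rfl,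
      by simp only [hB, CKM.size]; omega, by simp only [hB, CKM.size]; omega, min_le_right _ _⟩
  have h8 : ρ.nvar 8 = 0 := hs.nvar 8 rfl
  have h9 : ρ.nvar 9 = 0 := hs.nvar 9 rfl
  have h4 : ρ.narr 4 = 0 := hs.narr 4 rfl
  -- For `K = 0` there is exactly one tuple, the empty one, even without centers.
  have hpos : 0 < m ^ K := by
    rcases Nat.eq_zero_or_pos K with h | h
    · simp [h]
    · exact pow_pos (hm h) K
  -- The number `m ^ K` of rounds is not bounded by `B`, so this one loop is counted explicitly. It
  -- starts at the all-zero tuple, the digits of 0, with an empty record.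
  obtain ⟨t₂, ρ', e₂, l₂, b₂, hbest⟩ := RAM.Tri.exec_loop (N := N) (B := B) (p := E) (σ := ρ)
    (b := .neq (.var 8) (.const 0)) (n := m ^ K)
    (Inv := RAM.Enum.Progress I.numF I.numC m u K (ρ.narr 3) (ρ.rarr 1)
      (fun c f => ρ.rarr 3 (c * I.numF + f)))
    (Q := RAM.Enum.Best I.numF I.numC u K (fun c f => ρ.rarr 3 (c * I.numF + f))
      (fun O => ∃ j < m ^ K, O = greedy I.numF (ρ.narr 3) (ρ.rarr 1) (digits m j) K))
    ⟨⟨by simp, Or.inl h9⟩, fun _ => ⟨h8, fun i _ => by simp [h4, digits]⟩, fun h0 => by omega⟩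
    (fun j hj ρ₁ hs₁ hI => ⟨by simp [(hI.active hj).1], by
      rw [hE] at hs₁ ⊢
      exact RAM.Enum.tri_body (hready.same hs₁ rfl) hm hj hI⟩)
    (fun ρ₁ hs₁ hI => ⟨by simp [hI.done rfl], hI.best⟩) b₁
    (hW _ (by simp [RAM.Prog.weight, RAM.Test.weight, RAM.NExp.weight]; omega))
  refine ⟨_, _, e₁.seq (e₂.seq (.setN ρ' 0 (.var 9) ?_)), ?_,
    I.solved_of_best hu hm hcen hh hdist hbest⟩
  · exact (b₂.nvar 9).trans (by simpa using hW 1 (by omega))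
  · have hZ : ∀ d ≤ P.depth + E.depth, (B + 1) ^ d ≤ (B + 1) ^ (P.weight + E.weight + 2 +
        (P.size + E.size + 20) + (P.depth + E.depth)) :=
      fun d hd => Nat.pow_le_pow_right (Nat.succ_pos B) (by omega)
    have hZ1 := hZ P.depth (by omega)
    have hZ2 := hZ E.depth (by omega)
    have hZ0 := hZ 0 (by omega)
    -- Here `1 ≤ ℓ` is needed to raise the exponent from `K` to `k`.
    have hY : m ^ K ≤ ℓ ^ I.k := (Nat.pow_le_pow_left hG.1 K).trans
      (Nat.pow_le_pow_right hℓ (min_le_left _ _))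
    have hY0 : 1 ≤ ℓ ^ I.k := Nat.one_le_pow _ _ hℓ
    have hA : P.size + E.size + 18 ≤
      P.weight + E.weight + 2 + (P.size + E.size + 20) + (P.depth + E.depth) := by omega
    generalize P.weight + E.weight + 2 + (P.size + E.size + 20) + (P.depth + E.depth) = A at *
    set Z := (B + 1) ^ A
    set Y := ℓ ^ I.k
    have hbt : (RAM.Test.neq (.var 8) (.const 0)).time = 7 := rfl
    rw [hbt] at l₂
    have hYZ : Z ≤ Y * Z := Nat.le_mul_of_pos_left _ hY0
    have q₁ : t₁ ≤ P.size * (Y * Z) :=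
      l₁.trans (Nat.mul_le_mul_left _ (hZ1.trans hYZ))
    have q₂ : m ^ K * (7 + 1 + E.size * (B + 1) ^ E.depth) ≤ Y * (8 * Z + E.size * Z) :=
      Nat.mul_le_mul hY (Nat.add_le_add (by simpa using hZ0) (Nat.mul_le_mul_left _ hZ2))
    have q₃ : 1 ≤ Y * Z := (by simpa using hZ0 : 1 ≤ Z).trans hYZ
    calc t₁ + (t₂ + ((RAM.NExp.var 9).time + 1))
        ≤ P.size * (Y * Z) + (Y * (8 * Z + E.size * Z) + (7 + 1) + 2) :=
          Nat.add_le_add q₁ (Nat.add_le_add (l₂.trans (Nat.add_le_add_right q₂ _)) le_rfl)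
      _ ≤ (P.size + E.size + 18) * (Y * Z) := by nlinarith
      _ ≤ A * (Y * Z) := Nat.mul_le_mul_right _ hA
      _ = A * Y * Z := by ring
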